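/- For integers $m\ge 2$, $n\ge 0$ and $k\in\mathbb Z$ let $T^{(k)}(m,n)$ be the closure of the braid $(\sigma_{m-1}\sigma_{m-2}\cdots\sigma_2\sigma_1)^n\sigma_1^k$ on $m$ strands, oriented as a closed braid, where the generators $\sigma_i$ are positive crossings. Let $H^{i,j}$ denote integral (unreduced) Khovanov homology, normalized so that $H^{i,j}(\vec D)=H_{w-2i,\,3w-2j}(D)$, where $w$ is the writhe of the oriented diagram $\vec D$ and $H_{a,b}(D)$ is the framed Khovanov homology of the diagram: the homology of the complex of enhanced Kauffman states $s$ graded by $a(s)=\sigma(s)$ (the number of $A$-labels minus the number of $B$-labels) and $b(s)=\sigma(s)+2\tau(s)$ ($\tau(s)$ the sum of the signs of the circles), with differential $\partial_{a,b}\colon C_{a,b}\to C_{a-2,b}$. Let $m\ge 2$ and $k\in\mathbb Z$, and put $u=\left\lfloor \frac{m(m+2)}{2}\right\rfloor+k$. Then: 1. for all $i,j\in\mathbb Z$ with $(i,j)\notin\{(u,3u),\,(u,3u-2),\,(u-1,3u),\,(u-1,3u-2)\}$ there is an isomorphism of abelian groups $$H^{i,j}\bigl(T^{(k)}(m,m+2)\bigr)\cong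 H^{i,j-1}\bigl(T^{(k-1)}(m,m+2)\bigr);$$ 2. for all $i,j\in\mathbb Z$ with $(i,j)\notin\{(u,3u),\,(u,3u-2)\}$ the torsion subgroups are isomorphic: $$\operatorname{tor}H^{i,j}\bigl(T^{(k)}(m,m+2)\bigr)\cong \operatorname{tor}H^{i,j-1}\bigl(T^{(k-1)}(m,m+2)\bigr).$$ -/

import Mathlib

namespace Khovanov

/-! ## Link diagrams, Kauffman states and framed Khovanov homology -/

/-- An unoriented link diagram, presented combinatorially.  `V` is a set of marked points on the
diagram (away from the crossings), `X` is the set of crossings.  Deleting small discs around the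
crossings and cutting at the marked points leaves crossingless arcs, recorded by `arc`.  At the
crossing `x` the four points `ends x 0, ends x 1, ends x 2, ends x 3` are met in counterclockwise
order, and `ends x 0`, `ends x 2` are the two ends of the lower (under-passing) strand.

Below this is used for planar diagrams only (closed braids). -/
structure LinkDiagram (V X : Type) where
  /-- two marked points are joined by a crossingless arc -/
  arc : V → V → Prop
  /-- the four points around a crossing, counterclockwise, starting at an end of the under-strand -/
  ends : X → Fin 4 → V

/-- The two labels of a Kauffman state. -/
inductive Label : Type
  | A : Label
  | B : Label
  deriving DecidableEq

instance : Finite Label :=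
  Finite.of_surjective (fun b : Bool => if b then Label.A else Label.B) (by
    rintro (_ | _)
    · exact ⟨true, rfl⟩
    · exact ⟨false, rfl⟩)

namespace LinkDiagram

variable {V X : Type} (D : LinkDiagram V X)

/-- `D.Joined s p q`: the points `p` and `q` are joined by a piece of the curve `sD`, that is,
either by an arc of `D`, or by a piece of the smoothing of a crossing.  Turning the over-strand
(ends `1`, `3`) counterclockwise sweeps out the regions between the ends `1, 2` and `3, 0`; the
`A`-smoothing merges these two regions and the `B`-smoothing merges the two other ones. -/
inductive Joined (s : X → Label) : V → V → Prop
  | arc {p q : V} : D.arc p q → Joined s p q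
  | a₁ (x : X) : s x = Label.A → Joined s (D.ends x 0) (D.ends x 1)
  | a₂ (x : X) : s x = Label.A → Joined s (D.ends x 2) (D.ends x 3)
  | b₁ (x : X) : s x = Label.B → Joined s (D.ends x 0) (D.ends x 3)
  | b₂ (x : X) : s x = Label.B → Joined s (D.ends x 1) (D.ends x 2)

/-- The circles of `sD`: the classes of the equivalence relation generated by `D.Joined s`. -/
def Circle (s : X → Label) : Type := Quot (D.Joined s)

/-- The circle of `sD` through the point `p`. -/
def circleAt (s : X → Label) (p : V) : D.Circle s := Quot.mk _ p

/-- The set of marked points on a circle of `sD`. -/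
def points {s : X → Label} (c : D.Circle s) : Set V := {p | D.circleAt s p = c}

/-- An enhanced Kauffman state: a label for each crossing and a sign for each resulting circle. -/
structure EnhancedState where
  label : X → Label
  sign : D.Circle label → ℤˣ

instance [Finite V] (s : X → Label) : Finite (D.Circle s) :=
  inferInstanceAs (Finite (Quot (D.Joined s)))

noncomputable instance [Finite V] (s : X → Label) : Fintype (D.Circle s) := Fintype.ofFinite _

instance [Finite V] [Finite X] : Finite D.EnhancedState :=
  Finite.of_injective
    (β := Σ s : X → Label, (D.Circle s → ℤˣ)) (fun S => ⟨S.label, S.sign⟩) (by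
      rintro ⟨s, e⟩ ⟨s', e'⟩ h
      cases h
      rfl)

variable {D}

/-- `σ(s) = |s⁻¹(A)| - |s⁻¹(B)|`. -/
def EnhancedState.σ [Fintype X] (S : D.EnhancedState) : ℤ :=
  ((Finset.univ.filter fun x => S.label x = Label.A).card : ℤ)
    - (Finset.univ.filter fun x => S.label x = Label.B).card

/-- `τ(s)`: the sum of the signs of all circles. -/
noncomputable def EnhancedState.τ [Finite V] (S : D.EnhancedState) : ℤ :=
  ∑ c : D.Circle S.label, (S.sign c : ℤ)

/-- The degree `a(s) = σ(s)`. -/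
def EnhancedState.a [Fintype X] (S : D.EnhancedState) : ℤ := S.σ

/-- The degree `b(s) = σ(s) + 2 τ(s)`. -/
noncomputable def EnhancedState.b [Finite V] [Fintype X] (S : D.EnhancedState) : ℤ :=
  S.σ + 2 * S.τ

/-- `S'` is adjacent to `S`, and `x` is the crossing whose label changes from `A` to `B`.  The last
condition says that the circles common to both smoothings have the same sign in `S` and `S'`. -/
structure AdjacentAt [Finite V] [Fintype X] (S S' : D.EnhancedState) (x : X) : Prop where
  a_eq : S'.a = S.a - 2
  b_eq : S'.b = S.b
  label_A : S.label x = Label.A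
  label_B : S'.label x = Label.B
  label_eq : ∀ y, y ≠ x → S'.label y = S.label y
  sign_eq : ∀ (c : D.Circle S.label) (c' : D.Circle S'.label),
    D.points c = D.points c' → S.sign c = S'.sign c'

open Classical in
/-- The incidence number `(S : S')`: it is `(-1)^t` if `S'` is adjacent to `S`, where `t` is the
number of `B`-labelled crossings of `S` after the changed crossing, and `0` otherwise.  (The changed
crossing is unique, so the sum has at most one nonzero term.) -/
noncomputable def incidence [Finite V] [Fintype X] [LinearOrder X] (S S' : D.EnhancedState) : ℤ :=
  ∑ x : X, if AdjacentAt S S' x then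
    (-1) ^ (Finset.univ.filter fun y => x < y ∧ S.label y = Label.B).card else 0

variable (D)

/-- The enhanced states of bidegree `(a, b)`. -/
def Gen [Finite V] [Fintype X] (a b : ℤ) : Type := {S : D.EnhancedState // S.a = a ∧ S.b = b}

instance [Finite V] [Fintype X] (a b : ℤ) : Finite (D.Gen a b) :=
  inferInstanceAs (Finite {S : D.EnhancedState // S.a = a ∧ S.b = b})

noncomputable instance [Finite V] [Fintype X] (a b : ℤ) : Fintype (D.Gen a b) := Fintype.ofFinite _

/-- The chain group `C_{a,b}(D)`: free abelian on the enhanced states of bidegree `(a, b)`. -/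
abbrev Chain [Finite V] [Fintype X] (a b : ℤ) : Type := D.Gen a b →₀ ℤ

/-- The map `C_{a,b}(D) → C_{a',b}(D)`, `S ↦ ∑ (S : S') S'`.  It is the differential `∂_{a,b}` when
`a' = a - 2` (and zero for all other `a'`). -/
noncomputable def boundary [Finite V] [Fintype X] [LinearOrder X] (a a' b : ℤ) :
    D.Chain a b →ₗ[ℤ] D.Chain a' b :=
  Finsupp.linearCombination ℤ fun S : D.Gen a b =>
    ∑ S' : D.Gen a' b, incidence S.1 S'.1 • Finsupp.single S' (1 : ℤ)

/-- The framed Khovanov homology `H_{a,b}(D) = ker ∂_{a,b} / im ∂_{a+2,b}`. -/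
abbrev FramedHomology [Finite V] [Fintype X] [LinearOrder X] (a b : ℤ) : Type :=
  LinearMap.ker (D.boundary a (a - 2) b) ⧸
    (LinearMap.range (D.boundary (a + 2) a b)).submoduleOf (LinearMap.ker (D.boundary a (a - 2) b))

end LinkDiagram

/-! ## Closed braids -/

/-- Braid words on `m` strands.  The letter `(i, true)` is the Artin generator `σ_{i+1}`, and
`(i, false)` is its inverse; `i` runs through `0, …, m - 2`. -/
abbrev BraidWord (m : ℕ) : Type := List (Fin (m - 1) × Bool)

namespace BraidWord

variable {m : ℕ}

/-- The left one of the two strand positions at which `σ_{i+1}` acts. -/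
def left (i : Fin (m - 1)) : Fin m := ⟨i, by omega⟩

/-- The right one of the two strand positions at which `σ_{i+1}` acts. -/
def right (i : Fin (m - 1)) : Fin m := ⟨i + 1, by omega⟩

/-- The standard diagram of the closure of a braid word `w`.  The strands run upwards; the marked
points are `(p, t)`, with `p` a strand position and `t` one of the heights `0, …, w.length`, and the
`t`-th letter gives the `t`-th crossing, between the heights `t` and `t + 1`.  The remaining strands
pass vertically from height `t` to height `t + 1`, and the closure joins `(p, w.length)` to `(p, 0)`.

In a positive letter the over-strand goes from bottom left to top right, which gives a
positive crossing; in a negative letter it goes from bottom right to top left. -/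
def closure (w : BraidWord m) : LinkDiagram (Fin m × Fin (w.length + 1)) (Fin w.length) where
  arc P Q :=
    (∃ (p : Fin m) (t : Fin w.length), p ≠ left (w.get t).1 ∧ p ≠ right (w.get t).1 ∧
      P = (p, t.castSucc) ∧ Q = (p, t.succ)) ∨
    (∃ p : Fin m, P = (p, Fin.last w.length) ∧ Q = (p, 0))
  ends t :=
    let bl := (left (w.get t).1, t.castSucc)
    let br := (right (w.get t).1, t.castSucc)
    let tl := (left (w.get t).1, t.succ)
    let tr := (right (w.get t).1, t.succ)
    if (w.get t).2 then ![br, tr, tl, bl] else ![bl, br, tr, tl]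

/-- The writhe of the closure of a braid word, all strands being oriented upwards: the number of
positive crossings minus the number of negative ones. -/
def writhe (w : BraidWord m) : ℤ := (w.map fun l => if l.2 then (1 : ℤ) else -1).sum

/-- The Khovanov homology `H^{i,j} = H_{w-2i, 3w-2j}` (with `w` the writhe) of the closure of a braid
word, oriented as a closed braid. -/
abbrev KhovanovHomology (β : BraidWord m) (i j : ℤ) : Type :=
  β.closure.FramedHomology (β.writhe - 2 * i) (3 * β.writhe - 2 * j)

end BraidWord

/-- The braid word `(σ_{m-1} σ_{m-2} ⋯ σ_2 σ_1)^n`, whose closure is the torus link `T(m,n)`. -/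
def torusWord (m n : ℕ) : BraidWord m :=
  (List.replicate n ((List.finRange (m - 1)).reverse.map fun i => (i, true))).flatten

/-- The braid word `(σ_{m-1} σ_{m-2} ⋯ σ_2 σ_1)^n σ_1^k`, whose closure is the link `T^{(k)}(m,n)`. -/
def twistedTorusWord (m n : ℕ) (hm : 2 ≤ m) (k : ℤ) : BraidWord m :=
  torusWord m n ++ List.replicate k.natAbs (⟨0, by omega⟩, decide (0 ≤ k))

/-- The Khovanov homology `H^{i,j}(T^{(k)}(m,n))`. -/
abbrev twistedTorusHomology (m n : ℕ) (hm : 2 ≤ m) (k i j : ℤ) : Type :=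
  (twistedTorusWord m n hm k).KhovanovHomology i j

end Khovanov

set_option linter.unusedSectionVars false

/-! The two links differ in one crossing of the twist region. One smoothing of that crossing deletes
it and gives the diagram with one crossing fewer. The other replaces it by a cup-cap on the first
two strands. States with label `B` at the crossing span a subcomplex and states with label `A` the
quotient, so the long exact sequence bounds the difference between the two homologies by the
homology of the cup-cap diagram in two adjacent homological degrees. The cup-cap diagram is an
unknot with some framing: its homology is ℤ in two bidegrees, whence at most four exceptional pairs
`(i, j)`. Since this homology is free, it cannot obstruct a torsion class, and for torsion only the
two pairs needed for injectivity have to be excluded.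

That the cup-cap diagram is an unknot is a computation with crossings `s i`, cup-caps `e i` and a
central framing change `κ`, using only kinks, the second Reidemeister move, planar isotopy, far
commutation and cyclic rotation (`TurnbackRelations`); the third Reidemeister move never occurs.
With `n = m - 1` and a row `s (n-1) ⋯ s 0`, a cup-cap `e i` passes a row and becomes `e (i+1)`. At
the last strand, `e (n-1)` and two rows collapse to `κ ^ 2` times the chain `e (n-1) ⋯ e 0`. The
chain absorbs two crossings of each further row, which lowers the width by two at the price of `κ ^
2`. By `trace_rows`, `m + 2` rows closed with `e 0` give the closure of the chain, a single circle
(`tl_cups`), with framing `2 + 2⌊m/2⌋`. The remaining twists next to the cup-cap are kinks. The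
identity `two_mul_half` turns the framing into the number `u`.

The homological input is built from cubes of partitions of marked points, with signs as functions on
the points. A label change has to merge or split classes. For closed braids this is a parity
argument: with even strands running upwards and odd strands downwards, the circles are the cycles of
a permutation, and a cup-cap multiplies it by a transposition (`isSaddle_tl`). The differential
squares to zero because the edge maps commute with the generator acting at each point, so a face has
to be checked on the unit only (`face_unitElt`). Invariance under the moves comes from cancelling
acyclic pieces in which an isolated circle is merged with sign `-1` or split off with sign `1`
(`exactAt_merge`, `exactAt_split`). -/

namespace Khovanov

/-! ## Bigraded complexes with a basis -/

/-- A bigraded complex of free abelian groups with a finite basis `T`, a subset of an ambient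
type, and with matrix coefficients `c g h` of the differential. -/
structure BasedComplex (G : Type) where
  T : Set G
  a : G → ℤ
  b : G → ℤ
  c : G → G → ℤ

namespace BasedComplex

variable {G G' : Type} [Fintype G] [Fintype G'] (K : BasedComplex G) (K' : BasedComplex G')

open Classical in
/-- The differential, on integral functions on the ambient type. -/
noncomputable def d : (G → ℤ) →+ (G → ℤ) where
  toFun m h := if h ∈ K.T then ∑ g, m g * K.c g h else 0
  map_zero' := by ext; simp
  map_add' m n := by
    ext h
    by_cases hh : h ∈ K.T <;> simp [hh, add_mul, Finset.sum_add_distrib]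

open Classical in
theorem d_apply (m : G → ℤ) (h : G) :
    K.d m h = if h ∈ K.T then ∑ g, m g * K.c g h else 0 := rfl

/-- The chains of bidegree `(a, b)`. -/
def Ch (a b : ℤ) : AddSubgroup (G → ℤ) where
  carrier := {m | ∀ g, m g ≠ 0 → g ∈ K.T ∧ K.a g = a ∧ K.b g = b}
  zero_mem' := by simp
  add_mem' {m n} hm hn g hg := by
    by_cases h : m g = 0
    · exact hn g (by simpa [h] using hg)
    · exact hm g h
  neg_mem' {m} hm g hg := hm g (by simpa using hg)

/-- The cycles of bidegree `(a, b)`. -/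
noncomputable def Z (a b : ℤ) : AddSubgroup (G → ℤ) := K.Ch a b ⊓ K.d.ker

/-- The boundaries of bidegree `(a, b)`. -/
noncomputable def Bd (a b : ℤ) : AddSubgroup (G → ℤ) := (K.Ch (a + 2) b).map K.d

/-- The homology in bidegree `(a, b)`. -/
abbrev H (a b : ℤ) : Type := K.Z a b ⧸ (K.Bd a b).addSubgroupOf (K.Z a b)

/-- The differential is homogeneous of bidegree `(-2, 0)` and has square zero. -/
structure IsComplex : Prop where
  hom : ∀ g ∈ K.T, ∀ h ∈ K.T, K.c g h ≠ 0 → K.a h = K.a g - 2 ∧ K.b h = K.b g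
  sq : ∀ g ∈ K.T, ∀ k ∈ K.T, ∑ h, K.T.indicator (fun h => K.c g h * K.c h k) h = 0

/-- The span of a part of the basis. -/
def res (S : Set G) : BasedComplex G := { K with T := K.T ∩ S }

variable {K K'}

theorem IsComplex.d_mem (hK : K.IsComplex) {a b : ℤ} {m : G → ℤ} (hm : m ∈ K.Ch a b) :
    K.d m ∈ K.Ch (a - 2) b := by
  intro h hh
  rw [d_apply] at hh
  split_ifs at hh with hT
  · obtain ⟨g, -, hg⟩ := Finset.exists_ne_zero_of_sum_ne_zero hh
    obtain ⟨h1, h2, h3⟩ := hm g (left_ne_zero_of_mul hg)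
    obtain ⟨h4, h5⟩ := hK.hom g h1 h hT (right_ne_zero_of_mul hg)
    exact ⟨hT, by omega, by omega⟩
  · exact absurd rfl hh

theorem IsComplex.d_d (hK : K.IsComplex) {m : G → ℤ} (hm : ∀ g, m g ≠ 0 → g ∈ K.T) :
    K.d (K.d m) = 0 := by
  classical
  ext k
  rw [d_apply]
  split_ifs with hk
  · have : ∀ h, K.d m h * K.c h k =
        ∑ g, m g * K.T.indicator (fun h => K.c g h * K.c h k) h := by
      intro h
      rw [d_apply]
      by_cases hh : h ∈ K.T
      · simp only [hh, if_true, Set.indicator_of_mem, Finset.sum_mul]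
        exact Finset.sum_congr rfl fun g _ => by ring
      · simp [hh]
    simp only [this]
    rw [Finset.sum_comm]
    refine Finset.sum_eq_zero fun g _ => ?_
    rw [← Finset.mul_sum]
    by_cases hg : m g = 0
    · simp [hg]
    · rw [hK.sq g (hm g hg) k hk, mul_zero]
  · rfl

theorem Ch_support {a b : ℤ} {m : G → ℤ} (hm : m ∈ K.Ch a b) : ∀ g, m g ≠ 0 → g ∈ K.T :=
  fun g hg => (hm g hg).1

theorem IsComplex.d_d_Ch (hK : K.IsComplex) {a b : ℤ} {m : G → ℤ} (hm : m ∈ K.Ch a b) :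
    K.d (K.d m) = 0 := hK.d_d (Ch_support hm)

theorem IsComplex.Bd_le (hK : K.IsComplex) (a b : ℤ) : K.Bd a b ≤ K.Z a b := by
  rintro _ ⟨n, hn, rfl⟩
  refine ⟨?_, hK.d_d_Ch hn⟩
  have := hK.d_mem hn
  rwa [add_sub_cancel_right] at this

/-! ### Maps between homology groups -/

/-- The map of homology groups induced by an additive map preserving cycles and boundaries. -/
noncomputable def homologyMap {a b a' b' : ℤ} (f : (G → ℤ) →+ (G' → ℤ))
    (hZ : ∀ m ∈ K.Z a b, f m ∈ K'.Z a' b') (hB : ∀ m ∈ K.Bd a b, f m ∈ K'.Bd a' b') :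
    K.H a b →+ K'.H a' b' :=
  QuotientAddGroup.map _ _ (((f.comp (K.Z a b).subtype)).codRestrict (K'.Z a' b')
    fun m => hZ m m.2) fun m hm => hB m hm

theorem homologyMap_injective {a b a' b' : ℤ} (f : (G → ℤ) →+ (G' → ℤ))
    (hZ : ∀ m ∈ K.Z a b, f m ∈ K'.Z a' b') (hB : ∀ m ∈ K.Bd a b, f m ∈ K'.Bd a' b')
    (hinj : ∀ m ∈ K.Z a b, f m ∈ K'.Bd a' b' → m ∈ K.Bd a b) :
    Function.Injective (homologyMap f hZ hB) := by
  rw [injective_iff_map_eq_zero]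
  intro x hx
  induction x using QuotientAddGroup.induction_on with
  | H z =>
    erw [QuotientAddGroup.map_mk, QuotientAddGroup.eq_zero_iff] at hx
    rw [QuotientAddGroup.eq_zero_iff]
    exact hinj z z.2 hx

theorem homologyMap_mk {a b a' b' : ℤ} (f : (G → ℤ) →+ (G' → ℤ))
    (hZ : ∀ m ∈ K.Z a b, f m ∈ K'.Z a' b') (hB : ∀ m ∈ K.Bd a b, f m ∈ K'.Bd a' b')
    (z : K.Z a b) : homologyMap f hZ hB (QuotientAddGroup.mk z) =
      QuotientAddGroup.mk (⟨f z, hZ z z.2⟩ : K'.Z a' b') := rfl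

theorem mk_eq_mk {a b : ℤ} (x y : K.Z a b) :
    (QuotientAddGroup.mk x : K.H a b) = QuotientAddGroup.mk y ↔
      (x : G → ℤ) - y ∈ K.Bd a b := by
  rw [QuotientAddGroup.eq_iff_sub_mem, AddSubgroup.mem_addSubgroupOf, AddSubgroup.coe_sub]

/-- All conditions concern cycles and boundaries of a single bidegree, so `f` need not be a chain
map. Inclusions, restrictions to a quotient basis and shifts of degree are all covered. -/
theorem nonempty_equiv {a b a' b' : ℤ} (f : (G → ℤ) →+ (G' → ℤ))
    (hZ : ∀ m ∈ K.Z a b, f m ∈ K'.Z a' b') (hB : ∀ m ∈ K.Bd a b, f m ∈ K'.Bd a' b')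
    (hinj : ∀ m ∈ K.Z a b, f m ∈ K'.Bd a' b' → m ∈ K.Bd a b)
    (hsurj : ∀ z ∈ K'.Z a' b', ∃ m ∈ K.Z a b, f m - z ∈ K'.Bd a' b') :
    Nonempty (K.H a b ≃+ K'.H a' b') := by
  refine ⟨AddEquiv.ofBijective (homologyMap f hZ hB) ⟨homologyMap_injective f hZ hB hinj, ?_⟩⟩
  intro x
  induction x using QuotientAddGroup.induction_on with
  | H z =>
    obtain ⟨m, hm, h⟩ := hsurj z z.2
    exact ⟨QuotientAddGroup.mk ⟨m, hm⟩, by rw [homologyMap_mk, mk_eq_mk]; exact h⟩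

/-- An injective homomorphism reflects finite order, so a preimage of a torsion element is again
torsion. Hence surjectivity is needed on torsion elements only. -/
theorem nonempty_torsion_equiv_of_injective {A B : Type} [AddCommGroup A] [AddCommGroup B]
    (f : A →+ B) (hf : Function.Injective f) (hs : ∀ y ∈ AddCommGroup.torsion B, ∃ x, f x = y) :
    Nonempty (AddCommGroup.torsion A ≃+ AddCommGroup.torsion B) := by
  have hm : ∀ x, x ∈ AddCommGroup.torsion A → f x ∈ AddCommGroup.torsion B := fun x hx =>
    AddMonoidHom.isOfFinAddOrder f hx
  refine ⟨AddEquiv.ofBijective ((f.comp (AddCommGroup.torsion A).subtype).codRestrict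
    (AddCommGroup.torsion B) fun x => hm x x.2) ⟨?_, ?_⟩⟩
  · intro x y hxy
    exact Subtype.ext (hf (congrArg Subtype.val hxy))
  · rintro ⟨y, hy⟩
    obtain ⟨x, rfl⟩ := hs y hy
    refine ⟨⟨x, ?_⟩, rfl⟩
    have : IsOfFinAddOrder (f x) := hy
    exact (Function.Injective.isOfFinAddOrder_iff hf).1 this

/-- No torsion in the homology in bidegree `(a, b)`. -/
def TorsionFreeAt (K : BasedComplex G) (a b : ℤ) : Prop :=
  ∀ z ∈ K.Z a b, ∀ n : ℕ, 0 < n → n • z ∈ K.Bd a b → z ∈ K.Bd a b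

theorem nonempty_torsion_equiv {a b a' b' : ℤ} (f : (G → ℤ) →+ (G' → ℤ))
    (hZ : ∀ m ∈ K.Z a b, f m ∈ K'.Z a' b') (hB : ∀ m ∈ K.Bd a b, f m ∈ K'.Bd a' b')
    (hinj : ∀ m ∈ K.Z a b, f m ∈ K'.Bd a' b' → m ∈ K.Bd a b)
    (hsurj : ∀ z ∈ K'.Z a' b', ∀ n : ℕ, 0 < n → n • z ∈ K'.Bd a' b' →
      ∃ m ∈ K.Z a b, f m - z ∈ K'.Bd a' b') :
    Nonempty (AddCommGroup.torsion (K.H a b) ≃+ AddCommGroup.torsion (K'.H a' b')) := by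
  refine nonempty_torsion_equiv_of_injective _ (homologyMap_injective f hZ hB hinj) ?_
  intro x hx
  induction x using QuotientAddGroup.induction_on with
  | H z =>
    obtain ⟨n, hn, h0⟩ := isOfFinAddOrder_iff_nsmul_eq_zero.1 hx
    rw [← QuotientAddGroup.mk_nsmul, QuotientAddGroup.eq_zero_iff] at h0
    obtain ⟨m, hm, h⟩ := hsurj z z.2 n hn h0
    exact ⟨QuotientAddGroup.mk ⟨m, hm⟩, by rw [homologyMap_mk, mk_eq_mk]; exact h⟩

theorem TorsionFreeAt.of_equiv {a b a' b' : ℤ} (e : K.H a b ≃+ K'.H a' b')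
    (h : K'.TorsionFreeAt a' b') : K.TorsionFreeAt a b := by
  have key : ∀ x : K.H a b, ∀ n : ℕ, 0 < n → n • x = 0 → x = 0 := by
    intro x n hn hx
    apply e.injective
    rw [map_zero]
    have h1 : n • e x = 0 := by rw [← map_nsmul, hx, map_zero]
    generalize e x = y at h1
    induction y using QuotientAddGroup.induction_on with
    | H z =>
      rw [← QuotientAddGroup.mk_nsmul, QuotientAddGroup.eq_zero_iff] at h1
      rw [QuotientAddGroup.eq_zero_iff]
      exact h z z.2 n hn h1
  intro z hz n hn hB
  have := key (QuotientAddGroup.mk ⟨z, hz⟩) n hn (by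
    rw [← QuotientAddGroup.mk_nsmul, QuotientAddGroup.eq_zero_iff]
    exact hB)
  rw [QuotientAddGroup.eq_zero_iff] at this
  exact this

/-- The homology vanishes in bidegree `(a, b)`. -/
def ExactAt (K : BasedComplex G) (a b : ℤ) : Prop := K.Z a b ≤ K.Bd a b

theorem ExactAt.of_equiv {a b a' b' : ℤ} (e : K.H a b ≃+ K'.H a' b')
    (h : K'.ExactAt a' b') : K.ExactAt a b := by
  intro z hz
  have : (QuotientAddGroup.mk ⟨z, hz⟩ : K.H a b) = 0 := by
    apply e.injective
    rw [map_zero]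
    generalize e _ = y
    induction y using QuotientAddGroup.induction_on with
    | H z =>
      rw [QuotientAddGroup.eq_zero_iff]
      exact h z.2
  rw [QuotientAddGroup.eq_zero_iff] at this
  exact this

/-! ### Signed bijections of bases -/

/-- By `hc` the two matrices are conjugate under `φ` by the diagonal matrix of signs `ε`. Chains are
functions, so the isomorphism is written through the inverse `ψ` of `φ` on the basis. -/
theorem nonempty_equiv_of_bijOn (φ : G → G') (hφ : Set.BijOn φ K.T K'.T) (ε : G → ℤˣ)
    (α β : ℤ) (ha : ∀ g ∈ K.T, K'.a (φ g) = K.a g + α) (hb : ∀ g ∈ K.T, K'.b (φ g) = K.b g + β)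
    (hc : ∀ g ∈ K.T, ∀ h ∈ K.T, K'.c (φ g) (φ h) = ε g * ε h * K.c g h) (a b : ℤ) :
    Nonempty (K.H a b ≃+ K'.H (a + α) (b + β)) := by
  classical
  -- The inverse below is `Function.invFunOn`, which requires a point of `G`. Without one both bases
  -- are empty and the zero map serves.
  rcases isEmpty_or_nonempty G with hG | hG
  · have hT' : K'.T = ∅ := by
      rw [← hφ.image_eq, Set.eq_empty_of_isEmpty K.T, Set.image_empty]
    have h0 : ∀ a b, ∀ m ∈ K'.Ch a b, m = 0 := by
      intro a b m hm
      ext g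
      by_contra hg
      have := (hm g hg).1
      rw [hT'] at this
      exact this
    refine nonempty_equiv (0 : (G → ℤ) →+ (G' → ℤ)) (fun m _ => zero_mem _) (fun m _ => zero_mem _)
      (fun m _ _ => ?_) fun z hz => ⟨0, zero_mem _, ?_⟩
    · rw [Subsingleton.elim m 0]; exact zero_mem _
    · rw [h0 _ _ z hz.1]; simp
  set ψ := Function.invFunOn φ K.T with hψ
  have hψT : ∀ g' ∈ K'.T, ψ g' ∈ K.T := fun g' hg' => Function.invFunOn_mem (hφ.surjOn hg')
  have hφψ : ∀ g' ∈ K'.T, φ (ψ g') = g' := fun g' hg' => Function.invFunOn_eq (hφ.surjOn hg')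
  have hψφ : ∀ g ∈ K.T, ψ (φ g) = g := fun g hg =>
    hφ.injOn (hψT _ (hφ.mapsTo hg)) hg (hφψ _ (hφ.mapsTo hg))
  have hεε : ∀ g, ((ε g : ℤˣ) : ℤ) * (ε g : ℤˣ) = 1 := fun g => by
    rw [← Units.val_mul, Int.units_mul_self, Units.val_one]
  let f : (G → ℤ) →+ (G' → ℤ) :=
    { toFun := fun m g' => if g' ∈ K'.T then ε (ψ g') * m (ψ g') else 0
      map_zero' := by ext; simp
      map_add' := fun m n => by
        ext g'
        by_cases h : g' ∈ K'.T <;> simp [h, mul_add] }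
  have fφ : ∀ m, ∀ g ∈ K.T, f m (φ g) = ε g * m g := by
    intro m g hg
    have : f m (φ g) = if φ g ∈ K'.T then ε (ψ (φ g)) * m (ψ (φ g)) else 0 := rfl
    rw [this, if_pos (hφ.mapsTo hg), hψφ g hg]
  have f0 : ∀ m, ∀ g' ∉ K'.T, f m g' = 0 := fun m g' hg' => if_neg hg'
  have fCh : ∀ a b, ∀ m ∈ K.Ch a b, f m ∈ K'.Ch (a + α) (b + β) := by
    intro a b m hm g' hg'
    by_cases h : g' ∈ K'.T
    · rw [← hφψ g' h, fφ m _ (hψT _ h)] at hg'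
      obtain ⟨h1, h2, h3⟩ := hm _ (right_ne_zero_of_mul hg')
      refine ⟨h, ?_, ?_⟩
      · rw [← hφψ g' h, ha _ h1, h2]
      · rw [← hφψ g' h, hb _ h1, h3]
    · exact absurd (f0 m g' h) hg'
  have fd : ∀ m : G → ℤ, (∀ g, m g ≠ 0 → g ∈ K.T) → f (K.d m) = K'.d (f m) := by
    intro m hm
    ext g'
    by_cases h : g' ∈ K'.T
    · obtain ⟨h0, hh0, rfl⟩ := hφ.surjOn h
      rw [fφ _ _ hh0, d_apply, d_apply, if_pos hh0, if_pos h, Finset.mul_sum]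
      have e1 : ∑ g, (ε h0 : ℤ) * (m g * K.c g h0) =
          ∑ g ∈ Finset.univ.filter (· ∈ K.T), (ε h0 : ℤ) * (m g * K.c g h0) := by
        rw [Finset.sum_filter_of_ne]
        intro g _ hg
        exact hm g (left_ne_zero_of_mul (right_ne_zero_of_mul hg))
      have e2 : ∑ g', f m g' * K'.c g' (φ h0) =
          ∑ g' ∈ Finset.univ.filter (· ∈ K'.T), f m g' * K'.c g' (φ h0) := by
        rw [Finset.sum_filter_of_ne]
        intro g' _ hg
        by_contra hn
        exact hg (by rw [f0 m g' hn, zero_mul])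
      rw [e1, e2]
      refine Finset.sum_bij (fun g _ => φ g) ?_ ?_ ?_ ?_
      · intro g hg
        simp only [Finset.mem_filter, Finset.mem_univ, true_and] at hg ⊢
        exact hφ.mapsTo hg
      · intro g hg g2 hg2 hh
        simp only [Finset.mem_filter, Finset.mem_univ, true_and] at hg hg2
        exact hφ.injOn hg hg2 hh
      · intro g' hg'
        simp only [Finset.mem_filter, Finset.mem_univ, true_and] at hg'
        exact ⟨ψ g', by simpa using hψT g' hg', hφψ g' hg'⟩
      · intro g hg
        simp only [Finset.mem_filter, Finset.mem_univ, true_and] at hg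
        rw [fφ m g hg, hc g hg h0 hh0]
        linear_combination (-(ε h0 : ℤ) * m g * K.c g h0) * hεε g
    · rw [f0 _ _ h, d_apply, if_neg h]
  have fsurj : ∀ a b, ∀ m' ∈ K'.Ch (a + α) (b + β), ∃ m ∈ K.Ch a b, f m = m' := by
    intro a b m' hm'
    refine ⟨fun g => if g ∈ K.T then ε g * m' (φ g) else 0, ?_, ?_⟩
    · intro g hg
      simp only [ne_eq, ite_eq_right_iff, Classical.not_imp] at hg
      obtain ⟨h1, h2, h3⟩ := hm' _ (right_ne_zero_of_mul hg.2)
      have := ha g hg.1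
      have := hb g hg.1
      exact ⟨hg.1, by omega, by omega⟩
    · ext g'
      by_cases h : g' ∈ K'.T
      · obtain ⟨h0, hh0, rfl⟩ := hφ.surjOn h
        rw [fφ _ _ hh0, if_pos hh0]
        linear_combination m' (φ h0) * hεε h0
      · rw [f0 _ _ h]
        by_contra hn
        exact h (hm' g' fun h' => hn h'.symm).1
  have finj : ∀ m : G → ℤ, (∀ g, m g ≠ 0 → g ∈ K.T) → f m = 0 → m = 0 := by
    intro m hm h0
    ext g
    by_cases h : g ∈ K.T
    · have := congrFun h0 (φ g)
      rw [fφ _ _ h] at this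
      simpa using this
    · by_contra hn
      exact h (hm g hn)
  refine nonempty_equiv f ?_ ?_ ?_ ?_
  · intro m hm
    refine ⟨fCh _ _ _ hm.1, ?_⟩
    have : K.d m = 0 := hm.2
    change K'.d (f m) = 0
    rw [← fd m (Ch_support hm.1), this, map_zero]
  · rintro _ ⟨n, hn, rfl⟩
    refine ⟨f n, ?_, (fd n (Ch_support hn)).symm⟩
    have := fCh _ _ _ hn
    rwa [add_right_comm] at this
  · rintro m hm ⟨n', hn', h⟩
    have hn'' : n' ∈ K'.Ch (a + 2 + α) (b + β) := by rwa [add_right_comm] at hn'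
    obtain ⟨n, hn, rfl⟩ := fsurj _ _ _ hn''
    refine ⟨n, hn, ?_⟩
    rw [← fd n (Ch_support hn)] at h
    rw [← sub_eq_zero]
    refine finj _ ?_ (by rw [map_sub, h, sub_self])
    intro g hg
    by_cases h1 : m g = 0
    · have h2 : K.d n g ≠ 0 := by simpa [h1] using hg
      rw [d_apply] at h2
      split_ifs at h2 with h3
      · exact h3
      · exact absurd rfl h2
    · exact Ch_support hm.1 g h1
  · intro z hz
    obtain ⟨m, hm, rfl⟩ := fsurj _ _ _ hz.1
    refine ⟨m, ⟨hm, ?_⟩, by rw [sub_self]; exact zero_mem _⟩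
    have hs := Ch_support hm
    have h1 : K'.d (f m) = 0 := hz.2
    refine finj _ ?_ (by rw [fd m hs, h1])
    intro g hg
    rw [d_apply] at hg
    split_ifs at hg with h3
    · exact h3
    · exact absurd rfl hg

end BasedComplex
end Khovanov

namespace Khovanov
namespace BasedComplex

variable {G : Type} [Fintype G] {K : BasedComplex G}

/-! ### Subcomplexes and quotients spanned by parts of the basis -/

/-- The differential does not leave `S`. -/
def ClosedIn (K : BasedComplex G) (S : Set G) : Prop :=
  ∀ g ∈ K.T, g ∈ S → ∀ h ∈ K.T, K.c g h ≠ 0 → h ∈ S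

/-- The square of the restricted differential only misses the two-step paths that start and end in
`S` with a middle vertex outside. The hypothesis kills these, which covers subcomplexes and
quotients at once. -/
theorem IsComplex.res (hK : K.IsComplex) {S : Set G}
    (hS : ∀ g ∈ K.T, g ∈ S → ∀ k ∈ K.T, k ∈ S → ∀ h ∈ K.T, h ∉ S → K.c g h * K.c h k = 0) :
    (K.res S).IsComplex := by
  constructor
  · intro g hg h hh
    exact hK.hom g hg.1 h hh.1
  · intro g hg k hk
    rw [← hK.sq g hg.1 k hk.1]
    refine Finset.sum_congr rfl fun h _ => ?_
    by_cases h1 : h ∈ K.T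
    · by_cases h2 : h ∈ S
      · rw [Set.indicator_of_mem h1, Set.indicator_of_mem (show h ∈ (K.res S).T from ⟨h1, h2⟩)]
        rfl
      · rw [Set.indicator_of_mem h1, hS g hg.1 hg.2 k hk.1 hk.2 h h1 h2,
          Set.indicator_of_notMem fun h' => h2 h'.2]
    · rw [Set.indicator_of_notMem h1, Set.indicator_of_notMem fun h' => h1 h'.1]

theorem IsComplex.res_sub (hK : K.IsComplex) {S : Set G} (hS : K.ClosedIn S) :
    (K.res S).IsComplex :=
  hK.res fun g hg hgS k _ _ h hh hhS => by
    by_contra h0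
    exact hhS (hS g hg hgS h hh (left_ne_zero_of_mul h0))

theorem IsComplex.res_quo (hK : K.IsComplex) {S : Set G} (hS : K.ClosedIn S) :
    (K.res Sᶜ).IsComplex :=
  hK.res fun g _ _ k hk hkS h hh hhS => by
    by_contra h0
    exact hkS (hS h hh (not_not.1 hhS) k hk (right_ne_zero_of_mul h0))

/-- Restriction of functions to `S`, extended by zero. -/
noncomputable def cut (S : Set G) : (G → ℤ) →+ (G → ℤ) where
  toFun := S.indicator
  map_zero' := Set.indicator_zero' ..
  map_add' := Set.indicator_add' S

theorem cut_apply_mem {S : Set G} {g : G} (h : g ∈ S) (m : G → ℤ) : cut S m g = m g :=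
  Set.indicator_of_mem h m

theorem cut_apply_notMem {S : Set G} {g : G} (h : g ∉ S) (m : G → ℤ) : cut S m g = 0 :=
  Set.indicator_of_notMem h m

theorem Ch_res_le (S : Set G) (a b : ℤ) : (K.res S).Ch a b ≤ K.Ch a b :=
  fun _ hm g hg => ⟨(hm g hg).1.1, (hm g hg).2⟩

theorem cut_mem {S : Set G} {a b : ℤ} {m : G → ℤ} (hm : m ∈ K.Ch a b) :
    cut S m ∈ (K.res S).Ch a b := by
  intro g hg
  by_cases h : g ∈ S
  · rw [cut_apply_mem h] at hg
    exact ⟨⟨(hm g hg).1, h⟩, (hm g hg).2⟩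
  · exact absurd (cut_apply_notMem h m) hg

theorem cut_eq_zero {S : Set G} {a b : ℤ} {m : G → ℤ} (hm : m ∈ (K.res S).Ch a b) :
    cut Sᶜ m = 0 := by
  ext g
  by_cases h : g ∈ S
  · exact cut_apply_notMem (not_not.2 h) m
  · rw [cut_apply_mem h]
    by_contra hg
    exact h (hm g hg).1.2

theorem cut_self {S : Set G} {a b : ℤ} {m : G → ℤ} (hm : m ∈ (K.res S).Ch a b) :
    cut S m = m := by
  ext g
  by_cases h : g ∈ S
  · exact cut_apply_mem h m
  · rw [cut_apply_notMem h]
    by_contra hg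
    exact h (hm g fun h' => hg h'.symm).1.2

theorem mem_res_of_cut {S : Set G} {a b : ℤ} {m : G → ℤ} (hm : m ∈ K.Ch a b)
    (h0 : cut Sᶜ m = 0) : m ∈ (K.res S).Ch a b := by
  intro g hg
  refine ⟨⟨(hm g hg).1, ?_⟩, (hm g hg).2⟩
  by_contra h
  have := congrFun h0 g
  rw [cut_apply_mem (show g ∈ Sᶜ from h)] at this
  exact hg this

theorem d_res (S : Set G) (m : G → ℤ) : (K.res S).d m = cut S (K.d m) := by
  classical
  ext h
  by_cases hS : h ∈ S
  · rw [cut_apply_mem hS, d_apply, d_apply]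
    by_cases hT : h ∈ K.T
    · rw [if_pos hT, if_pos ⟨hT, hS⟩]; rfl
    · rw [if_neg hT, if_neg fun h => hT h.1]
  · rw [cut_apply_notMem hS, d_apply, if_neg fun h => hS h.2]

theorem ClosedIn.cut_d {S : Set G} (hS : K.ClosedIn S) {a b : ℤ} {m : G → ℤ}
    (hm : m ∈ (K.res S).Ch a b) : cut Sᶜ (K.d m) = 0 := by
  classical
  ext h
  by_cases hh : h ∈ S
  · exact cut_apply_notMem (not_not.2 hh) _
  · rw [cut_apply_mem (show h ∈ Sᶜ from hh), d_apply]
    split_ifs with hT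
    · refine Finset.sum_eq_zero fun g _ => ?_
      by_contra h0
      have := (hm g (left_ne_zero_of_mul h0)).1
      exact hh (hS g this.1 this.2 h hT (right_ne_zero_of_mul h0))
    · rfl

theorem cut_add_cut (S : Set G) (m : G → ℤ) : cut S m + cut Sᶜ m = m :=
  Set.indicator_self_add_compl S m

theorem ClosedIn.d_res_sub {S : Set G} (hS : K.ClosedIn S) {a b : ℤ} {m : G → ℤ}
    (hm : m ∈ (K.res S).Ch a b) : (K.res S).d m = K.d m := by
  have := cut_add_cut S (K.d m)
  rw [hS.cut_d hm, add_zero] at this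
  rw [d_res, this]

/-- The part of `m` in `S` is mapped into `S` and contributes nothing outside. So restriction to the
complement is a chain map onto the quotient complex. -/
theorem ClosedIn.cut_d_cut {S : Set G} (hS : K.ClosedIn S) {a b : ℤ} {m : G → ℤ}
    (hm : m ∈ K.Ch a b) : (K.res Sᶜ).d (cut Sᶜ m) = cut Sᶜ (K.d m) := by
  conv_rhs => rw [← cut_add_cut S m, map_add, map_add, hS.cut_d (cut_mem hm), zero_add]
  rw [d_res]

variable {S : Set G} {a b : ℤ}

theorem Z_sub_le (hS : K.ClosedIn S) : (K.res S).Z a b ≤ K.Z a b := fun m hm =>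
  ⟨Ch_res_le S a b hm.1, by
    have : (K.res S).d m = 0 := hm.2
    rwa [hS.d_res_sub hm.1] at this⟩

theorem Bd_sub_le (hS : K.ClosedIn S) : (K.res S).Bd a b ≤ K.Bd a b := by
  rintro _ ⟨n, hn, rfl⟩
  exact ⟨n, Ch_res_le S _ b hn, (hS.d_res_sub hn).symm⟩

theorem cut_mem_Z (hS : K.ClosedIn S) {m : G → ℤ} (hm : m ∈ K.Z a b) :
    cut Sᶜ m ∈ (K.res Sᶜ).Z a b :=
  ⟨cut_mem hm.1, by
    have : K.d m = 0 := hm.2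
    change (K.res Sᶜ).d _ = 0
    rw [hS.cut_d_cut hm.1, this, map_zero]⟩

theorem cut_mem_Bd (hS : K.ClosedIn S) {m : G → ℤ} (hm : m ∈ K.Bd a b) :
    cut Sᶜ m ∈ (K.res Sᶜ).Bd a b := by
  obtain ⟨n, hn, rfl⟩ := hm
  exact ⟨cut Sᶜ n, cut_mem hn, hS.cut_d_cut hn⟩

/-- If `n` bounds `m` in the quotient, then `m - K.d n` is a cycle of the subcomplex, and it bounds
there by exactness. -/
theorem quo_injective (hK : K.IsComplex) (hS : K.ClosedIn S) (h0 : (K.res S).ExactAt a b)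
    {m : G → ℤ} (hm : m ∈ K.Z a b) (h : cut Sᶜ m ∈ (K.res Sᶜ).Bd a b) : m ∈ K.Bd a b := by
  obtain ⟨n, hn, hnm⟩ := h
  have hn' := Ch_res_le _ _ _ hn
  have hd : K.d n ∈ K.Z a b := hK.Bd_le _ _ ⟨n, hn', rfl⟩
  have h1 : m - K.d n ∈ K.Z a b := sub_mem hm hd
  have h2 : cut Sᶜ (m - K.d n) = 0 := by
    rw [map_sub, ← hS.cut_d_cut hn', cut_self hn, hnm, sub_self]
  have h3 := mem_res_of_cut h1.1 h2
  have h4 : m - K.d n ∈ (K.res S).Z a b := ⟨h3, by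
    change (K.res S).d _ = 0
    rw [hS.d_res_sub h3]
    exact h1.2⟩
  have h5 := Bd_sub_le hS (h0 h4)
  have := add_mem h5 (show K.d n ∈ K.Bd a b from ⟨n, hn', rfl⟩)
  rwa [sub_add_cancel] at this

/-- This is the connecting map of the long exact sequence on cycles. -/
theorem d_mem_Z_sub (hK : K.IsComplex) (hS : K.ClosedIn S) {z : G → ℤ}
    (hz : z ∈ (K.res Sᶜ).Z a b) : K.d z ∈ (K.res S).Z (a - 2) b := by
  have hz' := Ch_res_le _ _ _ hz.1
  have h1 : (K.res Sᶜ).d z = 0 := hz.2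
  rw [d_res] at h1
  have h2 := mem_res_of_cut (hK.d_mem hz') h1
  refine ⟨h2, ?_⟩
  change (K.res S).d _ = 0
  rw [hS.d_res_sub h2, hK.d_d_Ch hz']

/-- The image under the connecting map is the only obstruction to lifting a cycle of the quotient: a
primitive `n` in the subcomplex corrects `z` to `z - n`. -/
theorem quo_lift (hS : K.ClosedIn S) {z : G → ℤ}
    (hz : z ∈ (K.res Sᶜ).Z a b) (h : K.d z ∈ (K.res S).Bd (a - 2) b) :
    ∃ m ∈ K.Z a b, cut Sᶜ m - z ∈ (K.res Sᶜ).Bd a b := by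
  obtain ⟨n, hn, hnz⟩ := h
  rw [sub_add_cancel] at hn
  rw [hS.d_res_sub hn] at hnz
  have hzn : z - n ∈ K.Ch a b := sub_mem (Ch_res_le _ _ _ hz.1) (Ch_res_le _ _ _ hn)
  refine ⟨z - n, ⟨hzn, ?_⟩, ?_⟩
  · change K.d _ = 0
    rw [map_sub, hnz, sub_self]
  · rw [map_sub, cut_self hz.1, cut_eq_zero hn, sub_zero, sub_self]
    exact zero_mem _

theorem nonempty_equiv_quo (hK : K.IsComplex) (hS : K.ClosedIn S) (h0 : (K.res S).ExactAt a b)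
    (h1 : (K.res S).ExactAt (a - 2) b) : Nonempty (K.H a b ≃+ (K.res Sᶜ).H a b) :=
  nonempty_equiv (cut Sᶜ) (fun _ => cut_mem_Z hS) (fun _ => cut_mem_Bd hS)
    (fun _ => quo_injective hK hS h0) fun _ hz => quo_lift hS hz (h1 (d_mem_Z_sub hK hS hz))

/-- The connecting map sends a torsion class to a torsion class of the subcomplex, which is zero if
the homology there is torsion-free. So torsion classes lift without exactness in degree `a - 2`. -/
theorem nonempty_torsion_equiv_quo (hK : K.IsComplex) (hS : K.ClosedIn S)
    (h0 : (K.res S).ExactAt a b) (h1 : (K.res S).TorsionFreeAt (a - 2) b) :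
    Nonempty (AddCommGroup.torsion (K.H a b) ≃+ AddCommGroup.torsion ((K.res Sᶜ).H a b)) := by
  refine nonempty_torsion_equiv (cut Sᶜ) (fun _ => cut_mem_Z hS) (fun _ => cut_mem_Bd hS)
    (fun _ => quo_injective hK hS h0) fun z hz n hn hB =>
      quo_lift hS hz (h1 _ (d_mem_Z_sub hK hS hz) n hn ?_)
  obtain ⟨y, hy, hyz⟩ := hB
  have hy' := Ch_res_le _ _ _ hy
  have hz' := Ch_res_le _ _ _ hz.1
  have h2 : n • z - K.d y ∈ (K.res S).Ch a b := by
    refine mem_res_of_cut (sub_mem (nsmul_mem hz' n) (hK.Bd_le _ _ ⟨y, hy', rfl⟩).1) ?_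
    rw [map_sub, map_nsmul, cut_self hz.1, ← hyz, d_res, sub_self]
  refine ⟨n • z - K.d y, by rwa [sub_add_cancel], ?_⟩
  rw [hS.d_res_sub h2, map_sub, map_nsmul, hK.d_d_Ch hy', sub_zero]

/-- If `n` bounds `m` in the whole complex, its image in the quotient is a cycle, hence the boundary
of some `k`. Then `n - K.d k` lies in the subcomplex and still bounds `m`. -/
theorem sub_injective (hK : K.IsComplex) (hS : K.ClosedIn S) (h0 : (K.res Sᶜ).ExactAt (a + 2) b)
    {m : G → ℤ} (hm : m ∈ (K.res S).Z a b) (h : m ∈ K.Bd a b) : m ∈ (K.res S).Bd a b := by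
  obtain ⟨n, hn, rfl⟩ := h
  have h1 : cut Sᶜ n ∈ (K.res Sᶜ).Z (a + 2) b := ⟨cut_mem hn, by
    change (K.res Sᶜ).d _ = 0
    rw [hS.cut_d_cut hn, cut_eq_zero hm.1]⟩
  obtain ⟨k, hk, hkn⟩ := h0 h1
  have hk' := Ch_res_le _ _ _ hk
  have h2 : n - K.d k ∈ (K.res S).Ch (a + 2) b := by
    refine mem_res_of_cut (sub_mem hn (hK.Bd_le _ _ ⟨k, hk', rfl⟩).1) ?_
    rw [map_sub, ← hkn, d_res, sub_self]
  refine ⟨_, h2, ?_⟩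
  rw [hS.d_res_sub h2, map_sub, hK.d_d_Ch hk', sub_zero]

theorem sub_lift (hK : K.IsComplex) (hS : K.ClosedIn S) {z : G → ℤ} (hz : z ∈ K.Z a b)
    (h : cut Sᶜ z ∈ (K.res Sᶜ).Bd a b) : ∃ m ∈ (K.res S).Z a b, m - z ∈ K.Bd a b := by
  obtain ⟨n, hn, hnz⟩ := h
  have hn' := Ch_res_le _ _ _ hn
  have hB : K.d n ∈ K.Bd a b := ⟨n, hn', rfl⟩
  have h1 : z - K.d n ∈ K.Z a b := sub_mem hz (hK.Bd_le _ _ hB)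
  have h2 : z - K.d n ∈ (K.res S).Ch a b := by
    refine mem_res_of_cut h1.1 ?_
    rw [map_sub, ← hnz, d_res, sub_self]
  refine ⟨_, ⟨h2, ?_⟩, ?_⟩
  · change (K.res S).d _ = 0
    rw [hS.d_res_sub h2]
    exact h1.2
  · rw [sub_sub_cancel_left]
    exact neg_mem hB

theorem nonempty_equiv_sub (hK : K.IsComplex) (hS : K.ClosedIn S) (h0 : (K.res Sᶜ).ExactAt a b)
    (h1 : (K.res Sᶜ).ExactAt (a + 2) b) : Nonempty ((K.res S).H a b ≃+ K.H a b) :=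
  nonempty_equiv (AddMonoidHom.id _) (fun _ hm => Z_sub_le hS hm) (fun _ hm => Bd_sub_le hS hm)
    (fun _ hm h => sub_injective hK hS h1 hm h)
    fun _ hz => sub_lift hK hS hz (h0 (cut_mem_Z hS hz))

/-- The image of a torsion class in the quotient is torsion and therefore zero, so the class comes
from the subcomplex. -/
theorem nonempty_torsion_equiv_sub (hK : K.IsComplex) (hS : K.ClosedIn S)
    (h0 : (K.res Sᶜ).TorsionFreeAt a b) (h1 : (K.res Sᶜ).ExactAt (a + 2) b) :
    Nonempty (AddCommGroup.torsion ((K.res S).H a b) ≃+ AddCommGroup.torsion (K.H a b)) :=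
  nonempty_torsion_equiv (AddMonoidHom.id _) (fun _ hm => Z_sub_le hS hm)
    (fun _ hm => Bd_sub_le hS hm) (fun _ hm h => sub_injective hK hS h1 hm h)
    fun _ hz n hn hB => sub_lift hK hS hz (h0 _ (cut_mem_Z hS hz) n hn (by
      rw [← map_nsmul]
      exact cut_mem_Bd hS hB))

/-- A complex is acyclic if its basis consists of a part `P` and its complement, the complement
spans a subcomplex, and the remaining component of the differential is a signed bijection. -/
theorem exactAt_of_matching (hK : K.IsComplex) (P : Set G) (φ : G → G)
    (hφ : Set.BijOn φ (K.T ∩ P) (K.T ∩ Pᶜ))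
    (hne : ∀ p ∈ K.T, p ∈ P → IsUnit (K.c p (φ p)))
    (h0 : ∀ p ∈ K.T, p ∈ P → ∀ q ∈ K.T, q ∉ P → q ≠ φ p → K.c p q = 0)
    (a b : ℤ) : K.ExactAt a b := by
  classical
  intro z hz
  have key : ∀ n : G → ℤ, (∀ g, n g ≠ 0 → g ∈ K.T ∩ P) → ∀ p ∈ K.T ∩ P,
      K.d n (φ p) = n p * K.c p (φ p) := by
    intro n hn p hp
    have hT := hφ.mapsTo hp
    rw [d_apply, if_pos hT.1]
    refine Finset.sum_eq_single p ?_ (by simp)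
    intro g _ hg
    by_cases hg0 : n g = 0
    · simp [hg0]
    · have h1 := hn g hg0
      rw [h0 g h1.1 h1.2 _ hT.1 hT.2, mul_zero]
      exact fun h => hg (hφ.injOn h1 hp h.symm)
  let n : G → ℤ := fun g => if g ∈ K.T ∩ P then z (φ g) * K.c g (φ g) else 0
  have hnP : ∀ g, n g ≠ 0 → g ∈ K.T ∩ P := fun g hg => by
    by_contra h
    exact hg (if_neg h)
  have hn : n ∈ K.Ch (a + 2) b := by
    intro g hg
    have h1 := hnP g hg
    have h2 : n g = z (φ g) * K.c g (φ g) := if_pos h1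
    rw [h2] at hg
    obtain ⟨h3, h4, h5⟩ := hz.1 _ (left_ne_zero_of_mul hg)
    obtain ⟨h6, h7⟩ := hK.hom g h1.1 _ h3 (right_ne_zero_of_mul hg)
    exact ⟨h1.1, by omega, by omega⟩
  have hB : K.d n ∈ K.Bd a b := ⟨n, hn, rfl⟩
  have hy : z - K.d n ∈ K.Z a b := sub_mem hz (hK.Bd_le _ _ hB)
  -- The corrected cycle is supported on `P`. There the component of the differential along the
  -- matching is injective, so `y` vanishes.
  set y := z - K.d n with hydef
  have hyP : ∀ g, y g ≠ 0 → g ∈ K.T ∩ P := by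
    intro g hg
    have hT := (hy.1 g hg).1
    refine ⟨hT, ?_⟩
    by_contra hP
    obtain ⟨p, hp, rfl⟩ := hφ.surjOn ⟨hT, hP⟩
    apply hg
    rw [hydef, Pi.sub_apply, key n hnP p hp]
    have h2 : n p = z (φ p) * K.c p (φ p) := if_pos hp
    rw [h2, mul_assoc, Int.isUnit_mul_self (hne p hp.1 hp.2), mul_one, sub_self]
  have hy0 : y = 0 := by
    ext g
    by_contra hg
    have hp := hyP g hg
    have h1 := key y hyP g hp
    have h2 : K.d y = 0 := hy.2
    rw [h2] at h1
    exact mul_ne_zero hg (hne g hp.1 hp.2).ne_zero h1.symm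
  rw [hydef, sub_eq_zero] at hy0
  rw [hy0]
  exact hB

end BasedComplex
end Khovanov

namespace Khovanov

/-! ## Signs on the classes of a partition -/

section Partition

variable {V : Type}

/-- The sign function `ε` is constant on the classes of `P`. -/
def Compat (P : Setoid V) (ε : V → ℤˣ) : Prop := ∀ v w, P v w → ε v = ε w

/-- The partition obtained from `P` by uniting the classes of `p` and `q`. -/
def glue (P : Setoid V) (p q : V) : Setoid V where
  r u v := P u v ∨ (P u p ∧ P v q) ∨ (P u q ∧ P v p)
  iseqv := by
    refine ⟨fun u => Or.inl (P.refl u), ?_, ?_⟩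
    · rintro u v (h | ⟨h, h'⟩ | ⟨h, h'⟩)
      · exact Or.inl (P.symm h)
      · exact Or.inr (Or.inr ⟨h', h⟩)
      · exact Or.inr (Or.inl ⟨h', h⟩)
    · rintro u v w (h | ⟨h, h'⟩ | ⟨h, h'⟩) (k | ⟨k, k'⟩ | ⟨k, k'⟩)
      · exact Or.inl (P.trans h k)
      · exact Or.inr (Or.inl ⟨P.trans h k, k'⟩)
      · exact Or.inr (Or.inr ⟨P.trans h k, k'⟩)
      · exact Or.inr (Or.inl ⟨h, P.trans (P.symm k) h'⟩)
      · exact Or.inr (Or.inl ⟨h, k'⟩)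
      · exact Or.inl (P.trans h (P.symm k'))
      · exact Or.inr (Or.inr ⟨h, P.trans (P.symm k) h'⟩)
      · exact Or.inl (P.trans h (P.symm k'))
      · exact Or.inr (Or.inr ⟨h, k'⟩)

theorem le_glue (P : Setoid V) (p q : V) : P ≤ glue P p q := fun _ _ h => Or.inl h

theorem glue_pair (P : Setoid V) (p q : V) : glue P p q p q :=
  Or.inr (Or.inl ⟨P.refl p, P.refl q⟩)

theorem glue_le {P S : Setoid V} {p q : V} (h : P ≤ S) (hpq : S p q) : glue P p q ≤ S := by
  rintro u v (h1 | ⟨h1, h2⟩ | ⟨h1, h2⟩)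
  · exact h h1
  · exact S.trans (h h1) (S.trans hpq (S.symm (h h2)))
  · exact S.trans (h h1) (S.trans (S.symm hpq) (S.symm (h h2)))

theorem Compat.mono {P Q : Setoid V} (h : P ≤ Q) {ε : V → ℤˣ} (hε : Compat Q ε) : Compat P ε :=
  fun _ _ hvw => hε _ _ (h hvw)

theorem Compat.glue {P : Setoid V} {ε : V → ℤˣ} (hε : Compat P ε) {p q : V} (h : ε p = ε q) :
    Compat (glue P p q) ε := by
  rintro u v (h1 | ⟨h1, h2⟩ | ⟨h1, h2⟩)
  · exact hε _ _ h1
  · rw [hε _ _ h1, hε _ _ h2, h]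
  · rw [hε _ _ h1, hε _ _ h2, h]

/-- The class of `v` is the same in both partitions. -/
def SameClass (P Q : Setoid V) (v : V) : Prop := ∀ u, P v u ↔ Q v u

open Classical in
/-- The sum of the signs of the classes. -/
noncomputable def tau [Fintype V] (P : Setoid V) (ε : V → ℤˣ) : ℤ :=
  ∑ c : Quotient P, (ε c.out : ℤ)

variable [Fintype V] {P Q : Setoid V} {ε ε' : V → ℤˣ}

theorem tau_modify (hε : Compat P ε) (hε' : Compat P ε') (v : V)
    (h : ∀ u, ¬ P v u → ε u = ε' u) : tau P ε - tau P ε' = (ε v : ℤ) - ε' v := by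
  classical
  unfold tau
  rw [← Finset.sum_sub_distrib, Finset.sum_eq_single (Quotient.mk P v)]
  · have h1 : P v (Quotient.mk P v).out := P.symm (Quotient.mk_out v)
    rw [hε _ _ h1, hε' _ _ h1]
  · intro c _ hc
    rw [h, sub_self]
    intro h1
    apply hc
    rw [← Quotient.out_eq c]
    exact Quotient.sound (P.symm h1)
  · simp

/-- Mapping a class of `P` to the class of the glued partition containing it is a bijection once the
class of `q` is left out. That class contributes the extra `ε p`. -/
theorem tau_glue {p q : V} (hpq : ¬ P p q) (hε : Compat (glue P p q) ε) :
    tau P ε = tau (glue P p q) ε + ε p := by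
  classical
  have hP := hε.mono (le_glue P p q)
  have hq : ε p = ε q := hε _ _ (glue_pair P p q)
  unfold tau
  rw [← Finset.sum_erase_add _ _ (Finset.mem_univ (Quotient.mk P q))]
  have e1 : ε (Quotient.mk P q).out = ε p := by
    rw [hq]; exact hP _ _ (Quotient.mk_out q)
  rw [e1]
  congr 1
  refine Finset.sum_bij (fun c _ => Quotient.mk (glue P p q) c.out) (fun _ _ => Finset.mem_univ _)
    ?_ ?_ ?_
  · intro c hc c' hc' h
    have hc1 : ¬ P c.out q := fun h => Finset.ne_of_mem_erase hc (by
      rw [← Quotient.out_eq c]; exact Quotient.sound h)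
    have hc2 : ¬ P c'.out q := fun h => Finset.ne_of_mem_erase hc' (by
      rw [← Quotient.out_eq c']; exact Quotient.sound h)
    rcases Quotient.exact h with h1 | ⟨_, h2⟩ | ⟨h1, _⟩
    · rw [← Quotient.out_eq c, ← Quotient.out_eq c']
      exact Quotient.sound h1
    · exact absurd h2 hc2
    · exact absurd h1 hc1
  · intro c _
    by_cases h : P c.out q
    · refine ⟨Quotient.mk P p, Finset.mem_erase.2 ⟨fun h' => hpq (Quotient.exact h'),
        Finset.mem_univ _⟩, ?_⟩
      rw [← Quotient.out_eq c]
      refine Quotient.sound (Or.inr (Or.inl ⟨Quotient.mk_out p, h⟩))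
    · refine ⟨Quotient.mk P c.out, Finset.mem_erase.2 ⟨fun h' => h (Quotient.exact h'),
        Finset.mem_univ _⟩, ?_⟩
      conv_rhs => rw [← Quotient.out_eq c]
      exact Quotient.sound (Or.inl (Quotient.mk_out _))
  · intro c _
    rw [hε]
    exact (glue P p q).symm (Quotient.mk_out c.out)

/-- The sign functions of adjacent states: the sum of the signs increases by one, and the signs of
the common classes agree. -/
def Edge (P Q : Setoid V) (ε ε' : V → ℤˣ) : Prop :=
  tau Q ε' = tau P ε + 1 ∧ ∀ v, SameClass P Q v → ε v = ε' v

theorem sameClass_glue {p q : V} (hpq : ¬ P p q) (v : V) :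
    SameClass P (glue P p q) v ↔ ¬ glue P p q v p := by
  constructor
  · intro h hv
    have h1 := (h p).2 hv
    have h2 := (h q).2 ((glue P p q).trans hv (glue_pair P p q))
    exact hpq (P.trans (P.symm h1) h2)
  · intro h u
    refine ⟨fun h => Or.inl h, ?_⟩
    rintro (h1 | ⟨h1, _⟩ | ⟨h1, _⟩)
    · exact h1
    · exact absurd (Or.inl h1) h
    · exact absurd (Or.inr (Or.inr ⟨h1, P.refl p⟩)) h

theorem SameClass.symm {v : V} (h : SameClass P Q v) : SameClass Q P v := fun u => (h u).symm

/-- Interpolate by `ε₁`, equal to `ε` on the class of `p` and to `ε'` elsewhere. Each of the two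
steps changes the sign of a single class, and gluing is accounted for by `tau_glue`. -/
theorem tau_sub_tau {p q : V} (hpq : ¬ P p q) (hε : Compat P ε) (hε' : Compat (glue P p q) ε')
    (h : ∀ v, ¬ glue P p q v p → ε v = ε' v) :
    tau P ε - tau (glue P p q) ε' = (ε p : ℤ) + ε q - ε' p := by
  classical
  have hP := hε'.mono (le_glue P p q)
  have hq : ε' p = ε' q := hε' _ _ (glue_pair P p q)
  have h1 := tau_glue hpq hε'
  set ε₁ : V → ℤˣ := fun v => if P p v then ε v else ε' v with hε₁
  have hc : Compat P ε₁ := by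
    intro v w hvw
    by_cases hv : P p v
    · have hw := P.trans hv hvw
      simp only [hε₁, hv, hw, if_true, hε _ _ hvw]
    · have hw : ¬ P p w := fun h => hv (P.trans h (P.symm hvw))
      simp only [hε₁, hv, hw, if_false, hP _ _ hvw]
  have h2 := tau_modify hc hP p (fun u hu => if_neg hu)
  have h3 := tau_modify hε hc q (fun u hu => by
    by_cases h4 : P p u
    · simp only [hε₁, h4, if_true]
    · simp only [hε₁, h4, if_false]
      refine h u ?_
      rintro (h5 | ⟨h5, _⟩ | ⟨h5, _⟩)
      · exact h4 (P.symm h5)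
      · exact h4 (P.symm h5)
      · exact hu (P.symm h5))
  have h4 : ε₁ p = ε p := if_pos (P.refl p)
  have h5 : ε₁ q = ε' q := if_neg hpq
  rw [h4] at h2
  rw [h5, ← hq] at h3
  linarith

/-- This is the multiplication of ℤ[X]/X², with sign `-1` for the unit and sign `1` for X. The
equation has no solution when both factors have sign `1`, which is X² = 0. -/
theorem edge_merge {p q : V} (hpq : ¬ P p q) (hε : Compat P ε) (hε' : Compat (glue P p q) ε') :
    Edge P (glue P p q) ε ε' ↔
      (∀ v, ¬ glue P p q v p → ε v = ε' v) ∧ (ε' p : ℤ) = ε p + ε q + 1 := by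
  unfold Edge
  simp only [sameClass_glue hpq]
  rw [and_comm]
  refine and_congr_right fun h => ?_
  have := tau_sub_tau hpq hε hε' h
  constructor <;> intro <;> linarith

/-- This is the comultiplication: the unit goes to X⊗1 + 1⊗X and X goes to X⊗X, again with sign `1`
for X. -/
theorem edge_split {p q : V} (hpq : ¬ P p q) (hε : Compat (glue P p q) ε) (hε' : Compat P ε') :
    Edge (glue P p q) P ε ε' ↔
      (∀ v, ¬ glue P p q v p → ε v = ε' v) ∧ (ε' p : ℤ) + ε' q = ε p + 1 := by
  unfold Edge
  have h0 : ∀ v, SameClass (glue P p q) P v ↔ ¬ glue P p q v p := fun v => by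
    rw [← sameClass_glue hpq]
    exact ⟨SameClass.symm, SameClass.symm⟩
  simp only [h0]
  rw [and_comm]
  refine and_congr_right fun h => ?_
  have := tau_sub_tau hpq hε' hε fun v hv => (h v hv).symm
  constructor <;> intro <;> linarith

/-- `Q` is obtained from `P` by uniting the different classes of `p` and `q`. -/
def IsMerge (P Q : Setoid V) (p q : V) : Prop := ¬ P p q ∧ Q = glue P p q

/-- One of the partitions is obtained from the other one by uniting the classes of `p` and `q`. -/
def IsSaddle (P Q : Setoid V) (p q : V) : Prop := IsMerge P Q p q ∨ IsMerge Q P p q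

open Classical in
/-- The sign function which is `η` on the class of `v` and equal to `ε` elsewhere. -/
noncomputable def upd (P : Setoid V) (v : V) (η : ℤˣ) (ε : V → ℤˣ) : V → ℤˣ :=
  fun u => if P v u then η else ε u

theorem upd_of_rel {v u : V} (h : P v u) (η : ℤˣ) (ε : V → ℤˣ) : upd P v η ε u = η := if_pos h

theorem upd_of_not {v u : V} (h : ¬ P v u) (η : ℤˣ) (ε : V → ℤˣ) : upd P v η ε u = ε u := if_neg h

theorem Compat.upd (hε : Compat P ε) (v : V) (η : ℤˣ) : Compat P (upd P v η ε) := by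
  intro u w huw
  by_cases h : P v u
  · rw [upd_of_rel h, upd_of_rel (P.trans h huw)]
  · rw [upd_of_not h, upd_of_not fun h' => h (P.trans h' (P.symm huw)), hε _ _ huw]

theorem upd_upd (v : V) (η η' : ℤˣ) : upd P v η (upd P v η' ε) = upd P v η ε := by
  ext u
  by_cases h : P v u
  · rw [upd_of_rel h, upd_of_rel h]
  · rw [upd_of_not h, upd_of_not h, upd_of_not h]

theorem upd_self (hε : Compat P ε) {v : V} {η : ℤˣ} (h : ε v = η) : upd P v η ε = ε := by
  ext u
  by_cases hu : P v u
  · rw [upd_of_rel hu, ← hε _ _ hu, h]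
  · rw [upd_of_not hu]

theorem upd_congr {v w : V} (h : P v w) (η : ℤˣ) (ε : V → ℤˣ) : upd P v η ε = upd P w η ε := by
  ext u
  by_cases hu : P v u
  · rw [upd_of_rel hu, upd_of_rel (P.trans (P.symm h) hu)]
  · rw [upd_of_not hu, upd_of_not fun h' => hu (P.trans h h')]

theorem unit_cases (η : ℤˣ) : η = 1 ∨ η = -1 := Int.units_eq_one_or η

/-- An edge maps a sign `1` to a sign `1`. -/
theorem Edge.sign_one {p q : V} (hs : IsSaddle P Q p q) (hε : Compat P ε) (hε' : Compat Q ε')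
    (h : Edge P Q ε ε') {v : V} (hv : ε v = 1) : ε' v = 1 := by
  rcases hs with ⟨hpq, rfl⟩ | ⟨hpq, rfl⟩
  · obtain ⟨h1, h2⟩ := (edge_merge hpq hε hε').1 h
    by_cases h3 : glue P p q v p
    · have h5 : ε p = 1 ∨ ε q = 1 := by
        rcases h3 with h3 | ⟨h3, _⟩ | ⟨h3, _⟩
        · exact Or.inl (by rw [← hε _ _ h3, hv])
        · exact Or.inl (by rw [← hε _ _ h3, hv])
        · exact Or.inr (by rw [← hε _ _ h3, hv])
      rw [hε' _ _ h3]
      rcases unit_cases (ε' p) with h6 | h6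
      · exact h6
      · rcases unit_cases (ε p) with h7 | h7 <;> rcases unit_cases (ε q) with h8 | h8 <;>
          simp [h6, h7, h8] at h2 h5
    · rw [← h1 v h3, hv]
  · obtain ⟨h1, h2⟩ := (edge_split hpq hε hε').1 h
    by_cases h3 : glue Q p q v p
    · have h4 := hε _ _ h3
      rw [← h4, hv] at h2
      have h5 : ε' p = 1 ∧ ε' q = 1 := by
        rcases unit_cases (ε' p) with h7 | h7 <;>
          rcases unit_cases (ε' q) with h8 | h8 <;> simp [h7, h8] at h2 ⊢
      rcases h3 with h3 | ⟨h3, _⟩ | ⟨h3, _⟩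
      · rw [hε' _ _ h3, h5.1]
      · rw [hε' _ _ h3, h5.1]
      · rw [hε' _ _ h3, h5.2]
    · rw [← h1 v h3, hv]

/-- Together with `Edge.sign_one` this says, on matrix coefficients, that multiplication by X at `v`
commutes with the edge map. -/
theorem edge_upd_iff {p q : V} (hs : IsSaddle P Q p q) (hε : Compat P ε) (hε' : Compat Q ε')
    {v : V} (hv : ε v = -1) (hv' : ε' v = -1) :
    Edge P Q (upd P v 1 ε) (upd Q v 1 ε') ↔ Edge P Q ε ε' := by
  rcases hs with ⟨hpq, rfl⟩ | ⟨hpq, rfl⟩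
  · rw [edge_merge hpq hε hε', edge_merge hpq (hε.upd v 1) (hε'.upd v 1)]
    by_cases h3 : glue P p q v p
    · have e1 : upd (glue P p q) v 1 ε' p = 1 := upd_of_rel h3 ..
      have e2 := hε' _ _ h3
      rw [hv'] at e2
      refine and_congr ?_ ?_
      · refine forall_congr' fun u => forall_congr' fun hu => ?_
        have hvu : ¬ glue P p q v u := fun h => hu ((glue P p q).trans ((glue P p q).symm h) h3)
        rw [upd_of_not hvu, upd_of_not fun h => hvu (Or.inl h)]
      · rw [e1, ← e2]
        have key : P v p ∨ P v q := by
          rcases h3 with h3 | ⟨h3, _⟩ | ⟨h3, _⟩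
          · exact Or.inl h3
          · exact Or.inl h3
          · exact Or.inr h3
        rcases key with h4 | h4
        · have h5 : ¬ P v q := fun h => hpq (P.trans (P.symm h4) h)
          rw [upd_of_rel h4, upd_of_not h5, ← hε _ _ h4, hv]
          push_cast
          constructor <;> intro <;> linarith
        · have h5 : ¬ P v p := fun h => hpq (P.trans (P.symm h) h4)
          rw [upd_of_rel h4, upd_of_not h5, ← hε _ _ h4, hv]
          push_cast
          constructor <;> intro <;> linarith
    · have h4 : ∀ u, glue P p q v u ↔ P v u := fun u =>
        (((sameClass_glue hpq v).2 h3) u).symm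
      have h5 : ¬ P v p := fun h => h3 (Or.inl h)
      have h6 : ¬ P v q := fun h => h3 (Or.inr (Or.inr ⟨h, P.refl p⟩))
      rw [upd_of_not h3, upd_of_not h5, upd_of_not h6]
      refine and_congr ?_ Iff.rfl
      refine forall_congr' fun u => forall_congr' fun hu => ?_
      by_cases h7 : P v u
      · rw [upd_of_rel h7, upd_of_rel ((h4 u).2 h7), ← hε _ _ h7, hv, ← hε' _ _ ((h4 u).2 h7), hv']
        simp
      · rw [upd_of_not h7, upd_of_not fun h => h7 ((h4 u).1 h)]
  · rw [edge_split hpq hε hε', edge_split hpq (hε.upd v 1) (hε'.upd v 1)]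
    by_cases h3 : glue Q p q v p
    · have e1 : upd (glue Q p q) v 1 ε p = 1 := upd_of_rel h3 ..
      have e2 := hε _ _ h3
      rw [hv] at e2
      refine and_congr ?_ ?_
      · refine forall_congr' fun u => forall_congr' fun hu => ?_
        have hvu : ¬ glue Q p q v u := fun h => hu ((glue Q p q).trans ((glue Q p q).symm h) h3)
        rw [upd_of_not hvu, upd_of_not fun h => hvu (Or.inl h)]
      · rw [e1, ← e2]
        have key : Q v p ∨ Q v q := by
          rcases h3 with h3 | ⟨h3, _⟩ | ⟨h3, _⟩
          · exact Or.inl h3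
          · exact Or.inl h3
          · exact Or.inr h3
        rcases key with h4 | h4
        · have h5 : ¬ Q v q := fun h => hpq (Q.trans (Q.symm h4) h)
          rw [upd_of_rel h4, upd_of_not h5, ← hε' _ _ h4, hv']
          push_cast
          constructor <;> intro <;> linarith
        · have h5 : ¬ Q v p := fun h => hpq (Q.trans (Q.symm h) h4)
          rw [upd_of_rel h4, upd_of_not h5, ← hε' _ _ h4, hv']
          push_cast
          constructor <;> intro <;> linarith
    · have h4 : ∀ u, glue Q p q v u ↔ Q v u := fun u =>
        (((sameClass_glue hpq v).2 h3) u).symm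
      have h5 : ¬ Q v p := fun h => h3 (Or.inl h)
      have h6 : ¬ Q v q := fun h => h3 (Or.inr (Or.inr ⟨h, Q.refl p⟩))
      rw [upd_of_not h3, upd_of_not h5, upd_of_not h6]
      refine and_congr ?_ Iff.rfl
      refine forall_congr' fun u => forall_congr' fun hu => ?_
      by_cases h7 : Q v u
      · rw [upd_of_rel h7, upd_of_rel ((h4 u).2 h7), ← hε' _ _ h7, hv', ← hε _ _ ((h4 u).2 h7), hv]
        simp
      · rw [upd_of_not h7, upd_of_not fun h => h7 ((h4 u).1 h)]

end Partition
end Khovanov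

namespace Khovanov

/-! ### Edge maps are linear over the generators at the points, and faces of the cube commute -/

section Partition

variable {V : Type} [Fintype V]

theorem IsMerge.le {P Q : Setoid V} {p q : V} (h : IsMerge P Q p q) : P ≤ Q := h.2 ▸ le_glue P p q

theorem IsMerge.pair {P Q : Setoid V} {p q : V} (h : IsMerge P Q p q) : Q p q :=
  h.2 ▸ glue_pair P p q

theorem IsSaddle.symm {P Q : Setoid V} {p q : V} (h : IsSaddle P Q p q) : IsSaddle Q P p q :=
  Or.symm h

theorem upd_comm {P : Setoid V} (v w : V) (η : ℤˣ) (ε : V → ℤˣ) :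
    upd P v η (upd P w η ε) = upd P w η (upd P v η ε) := by
  ext u
  by_cases h : P v u <;> by_cases h' : P w u
  · rw [upd_of_rel h, upd_of_rel h']
  · rw [upd_of_rel h, upd_of_not h', upd_of_rel h]
  · rw [upd_of_not h, upd_of_rel h', upd_of_rel h']
  · rw [upd_of_not h, upd_of_not h', upd_of_not h', upd_of_not h]

open Classical in
/-- The map of an edge of the cube of resolutions, on formal combinations of sign functions. -/
noncomputable def edgeMap (P Q : Setoid V) : ((V → ℤˣ) →₀ ℤ) →ₗ[ℤ] ((V → ℤˣ) →₀ ℤ) :=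
  Finsupp.linearCombination ℤ fun ε =>
    ∑ ε' with Compat Q ε' ∧ Edge P Q ε ε', Finsupp.single ε' (1 : ℤ)

open Classical in
/-- Multiplication by the generator at the point `v`: it changes the sign `-1` of the class of `v`
to `1`, and annihilates the sign functions which are `1` there. -/
noncomputable def genMul (P : Setoid V) (v : V) : ((V → ℤˣ) →₀ ℤ) →ₗ[ℤ] ((V → ℤˣ) →₀ ℤ) :=
  Finsupp.linearCombination ℤ fun ε =>
    if ε v = -1 then Finsupp.single (upd P v 1 ε) (1 : ℤ) else 0

/-- The constant sign function `-1`. -/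
noncomputable def unitElt (V : Type) : (V → ℤˣ) →₀ ℤ := Finsupp.single (fun _ => -1) 1

open Classical in
theorem edgeMap_single (P Q : Setoid V) (ε : V → ℤˣ) : edgeMap P Q (Finsupp.single ε 1) =
    ∑ ε' with Compat Q ε' ∧ Edge P Q ε ε', Finsupp.single ε' (1 : ℤ) := by
  simp [edgeMap]

theorem genMul_single_neg {P : Setoid V} {v : V} {ε : V → ℤˣ} (h : ε v = -1) :
    genMul P v (Finsupp.single ε 1) = Finsupp.single (upd P v 1 ε) 1 := by
  simp [genMul, h]

theorem genMul_single_one {P : Setoid V} {v : V} {ε : V → ℤˣ} (h : ε v = 1) :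
    genMul P v (Finsupp.single ε 1) = 0 := by
  simp [genMul, h]

variable {P Q : Setoid V} {ε : V → ℤˣ}

theorem genMul_congr {v w : V} (h : P v w) (hε : Compat P ε) :
    genMul P v (Finsupp.single ε 1) = genMul P w (Finsupp.single ε 1) := by
  rcases unit_cases (ε v) with h1 | h1
  · rw [genMul_single_one h1, genMul_single_one (by rw [← hε _ _ h, h1])]
  · rw [genMul_single_neg h1, genMul_single_neg (by rw [← hε _ _ h, h1]), upd_congr h]

theorem genMul_comm (v w : V) (hε : Compat P ε) :
    genMul P v (genMul P w (Finsupp.single ε 1)) =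
      genMul P w (genMul P v (Finsupp.single ε 1)) := by
  by_cases h : P v w
  · rw [genMul_congr h hε]
    rcases unit_cases (ε w) with h1 | h1
    · rw [genMul_single_one h1, map_zero, map_zero]
    · rw [genMul_single_neg h1, genMul_congr h (hε.upd w 1)]
  · have h' : ¬ P w v := fun h' => h (P.symm h')
    rcases unit_cases (ε w) with h1 | h1 <;> rcases unit_cases (ε v) with h2 | h2
    · rw [genMul_single_one h1, genMul_single_one h2, map_zero, map_zero]
    · rw [genMul_single_one h1, genMul_single_neg h2, map_zero, genMul_single_one]
      rw [upd_of_not h, h1]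
    · rw [genMul_single_one h2, genMul_single_neg h1, map_zero, genMul_single_one]
      rw [upd_of_not h', h2]
    · rw [genMul_single_neg h1, genMul_single_neg h2, genMul_single_neg, genMul_single_neg,
        upd_comm]
      · rw [upd_of_not h, h1]
      · rw [upd_of_not h', h2]

/-- If `ε v = 1`, both sides vanish because an edge keeps sign `1` at `v`. Otherwise raising and
lowering the sign at `v` are inverse bijections between the terms on the two sides. -/
theorem edgeMap_genMul {p q : V} (hs : IsSaddle P Q p q) (hε : Compat P ε) (v : V) :
    edgeMap P Q (genMul P v (Finsupp.single ε 1)) =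
      genMul Q v (edgeMap P Q (Finsupp.single ε 1)) := by
  classical
  rcases unit_cases (ε v) with hv | hv
  · rw [genMul_single_one hv, map_zero, edgeMap_single, map_sum]
    refine (Finset.sum_eq_zero fun ε' h => ?_).symm
    simp only [Finset.mem_filter, Finset.mem_univ, true_and] at h
    exact genMul_single_one (h.2.sign_one hs hε h.1 hv)
  · rw [genMul_single_neg hv, edgeMap_single, edgeMap_single, map_sum]
    rw [← Finset.sum_filter_of_ne (p := fun ε' : V → ℤˣ => ε' v = -1)
      (f := fun ε' => genMul Q v (Finsupp.single ε' 1))]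
    swap
    · intro ε' _ h
      rcases unit_cases (ε' v) with h1 | h1
      · exact absurd (genMul_single_one h1) h
      · exact h1
    refine Finset.sum_bij' (fun ε' _ => upd Q v (-1) ε') (fun ε' _ => upd Q v 1 ε') ?_ ?_ ?_ ?_ ?_
    · intro ε' h
      simp only [Finset.mem_filter, Finset.mem_univ, true_and] at h ⊢
      have h1 : ε' v = 1 := h.2.sign_one hs (hε.upd v 1) h.1 (upd_of_rel (P.refl v) ..)
      have h2 : upd Q v (-1) ε' v = -1 := upd_of_rel (Q.refl v) ..
      refine ⟨⟨h.1.upd v (-1), ?_⟩, h2⟩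
      rw [← edge_upd_iff hs hε (h.1.upd v (-1)) hv h2, upd_upd, upd_self h.1 h1]
      exact h.2
    · intro ε' h
      simp only [Finset.mem_filter, Finset.mem_univ, true_and] at h ⊢
      exact ⟨h.1.1.upd v 1, (edge_upd_iff hs hε h.1.1 hv h.2).2 h.1.2⟩
    · intro ε' h
      simp only [Finset.mem_filter, Finset.mem_univ, true_and] at h
      rw [upd_upd, upd_self h.1]
      exact h.2.sign_one hs (hε.upd v 1) h.1 (upd_of_rel (P.refl v) ..)
    · intro ε' h
      simp only [Finset.mem_filter, Finset.mem_univ, true_and] at h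
      rw [upd_upd, upd_self h.1.1 h.2]
    · intro ε' h
      simp only [Finset.mem_filter, Finset.mem_univ, true_and] at h
      rw [genMul_single_neg (upd_of_rel (Q.refl v) ..), upd_upd, upd_self h.1]
      exact h.2.sign_one hs (hε.upd v 1) h.1 (upd_of_rel (P.refl v) ..)

theorem compat_const (P : Setoid V) (η : ℤˣ) : Compat P fun _ => η := fun _ _ _ => rfl

theorem edgeMap_unitElt_merge {p q : V} (h : IsMerge P Q p q) :
    edgeMap P Q (unitElt V) = unitElt V := by
  classical
  obtain ⟨hpq, rfl⟩ := h
  rw [unitElt, edgeMap_single]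
  have : (Finset.univ.filter fun ε' : V → ℤˣ =>
      Compat (glue P p q) ε' ∧ Edge P (glue P p q) (fun _ => -1) ε') = {fun _ => -1} := by
    ext ε'
    simp only [Finset.mem_filter, Finset.mem_univ, true_and, Finset.mem_singleton]
    constructor
    · rintro ⟨h1, h2⟩
      obtain ⟨h3, h4⟩ := (edge_merge hpq (compat_const P _) h1).1 h2
      funext v
      by_cases hv : glue P p q v p
      · rw [h1 _ _ hv]
        rcases unit_cases (ε' p) with h5 | h5
        · simp [h5] at h4
        · exact h5
      · exact (h3 v hv).symm
    · rintro rfl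
      exact ⟨compat_const _ _, (edge_merge hpq (compat_const P _) (compat_const _ _)).2
        ⟨fun _ _ => rfl, by simp⟩⟩
  rw [this, Finset.sum_singleton]

/-- The signs at `p` and `q` must add up to `0`, so exactly one of the two new classes carries `1`.
-/
theorem edgeMap_unitElt_split {p q : V} (h : IsMerge Q P p q) :
    edgeMap P Q (unitElt V) = genMul Q p (unitElt V) + genMul Q q (unitElt V) := by
  classical
  obtain ⟨hpq, rfl⟩ := h
  have hqp : ¬ Q q p := fun h => hpq (Q.symm h)
  rw [unitElt, edgeMap_single, genMul_single_neg (ε := fun _ => -1) rfl,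
    genMul_single_neg (ε := fun _ => -1) rfl]
  have hoff : ∀ {u}, ¬ glue Q p q u p → ¬ Q p u ∧ ¬ Q q u := fun hu =>
    ⟨fun h => hu (Or.inl (Q.symm h)), fun h => hu (Or.inr (Or.inr ⟨Q.symm h, Q.refl p⟩))⟩
  have : (Finset.univ.filter fun ε' : V → ℤˣ =>
      Compat Q ε' ∧ Edge (glue Q p q) Q (fun _ => -1) ε') =
        {upd Q p 1 (fun _ => -1), upd Q q 1 (fun _ => -1)} := by
    ext ε'
    simp only [Finset.mem_filter, Finset.mem_univ, true_and, Finset.mem_singleton,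
      Finset.mem_insert]
    constructor
    · rintro ⟨h1, h2⟩
      obtain ⟨h3, h4⟩ := (edge_split hpq (compat_const _ _) h1).1 h2
      have key : ∀ x y : V, (∀ u, glue Q p q u p ↔ Q u x ∨ Q u y) → ¬ Q x y → ε' x = 1 →
          ε' y = -1 → ε' = upd Q x 1 (fun _ => -1) := by
        intro x y hg hxy hx hy
        funext v
        by_cases hv : Q x v
        · rw [upd_of_rel hv, ← h1 _ _ hv, hx]
        · rw [upd_of_not hv]
          by_cases hv' : Q v y
          · rw [h1 _ _ hv', hy]
          · exact (h3 v fun h => ((hg v).1 h).elim (fun h => hv (Q.symm h)) hv').symm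
      have hg : ∀ u, glue Q p q u p ↔ Q u p ∨ Q u q := by
        intro u
        constructor
        · rintro (h | ⟨h, _⟩ | ⟨h, _⟩)
          exacts [Or.inl h, Or.inl h, Or.inr h]
        · rintro (h | h)
          exacts [Or.inl h, Or.inr (Or.inr ⟨h, Q.refl p⟩)]
      rcases unit_cases (ε' p) with h5 | h5 <;> rcases unit_cases (ε' q) with h6 | h6
      · simp [h5, h6] at h4
      · exact Or.inl (key p q hg hpq h5 h6)
      · exact Or.inr (key q p (fun u => (hg u).trans or_comm) hqp h6 h5)
      · simp [h5, h6] at h4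
    · rintro (rfl | rfl)
      · refine ⟨(compat_const _ _).upd _ _, (edge_split hpq (compat_const _ _)
          ((compat_const _ _).upd _ _)).2 ⟨fun u hu => (upd_of_not (hoff hu).1 1 (fun _ => -1)).symm, ?_⟩⟩
        rw [upd_of_rel (Q.refl p), upd_of_not hpq]
        simp
      · refine ⟨(compat_const _ _).upd _ _, (edge_split hpq (compat_const _ _)
          ((compat_const _ _).upd _ _)).2 ⟨fun u hu => (upd_of_not (hoff hu).2 1 (fun _ => -1)).symm, ?_⟩⟩
        rw [upd_of_rel (Q.refl q), upd_of_not hqp]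
        simp
  rw [this, Finset.sum_pair]
  intro h
  have := congrFun h p
  rw [upd_of_rel (Q.refl p), upd_of_not hqp] at this
  exact absurd this (by decide)

/-- Two successive merges lower the number of classes by two, so the other path around the face must
merge twice as well. This excludes the inconsistent combinations in `face_unitElt`. -/
theorem merge_merge {P₀ P₁ P₂ P₃ : Setoid V} {p q r s : V} (h1 : IsMerge P₀ P₁ p q)
    (h2 : IsMerge P₁ P₃ r s) (h3 : IsSaddle P₀ P₂ r s) (h4 : IsSaddle P₂ P₃ p q) :
    IsMerge P₀ P₂ r s ∧ IsMerge P₂ P₃ p q := by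
  have h5 : ¬ P₀ r s := fun h => h2.1 (h1.le h)
  have h6 : IsMerge P₀ P₂ r s := h3.resolve_right fun h => h5 h.pair
  refine ⟨h6, h4.resolve_right fun h => ?_⟩
  have h7 := h.pair
  rw [h6.2] at h7
  have hpq := h1.pair
  rcases h7 with h7 | ⟨h7, h8⟩ | ⟨h7, h8⟩
  · exact h1.1 h7
  · exact h2.1 (P₁.trans (P₁.symm (h1.le h7)) (P₁.trans hpq (h1.le h8)))
  · exact h2.1 (P₁.trans (P₁.symm (h1.le h8)) (P₁.trans (P₁.symm hpq) (h1.le h7)))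

theorem genMul_unitElt_congr {v w : V} (h : P v w) :
    genMul P v (unitElt V) = genMul P w (unitElt V) := genMul_congr h (compat_const _ _)

/-- The faces of the cube of resolutions commute on the unit. -/
theorem face_unitElt {P₀ P₁ P₂ P₃ : Setoid V} {p q r s : V} (h1 : IsSaddle P₀ P₁ p q)
    (h2 : IsSaddle P₁ P₃ r s) (h3 : IsSaddle P₀ P₂ r s) (h4 : IsSaddle P₂ P₃ p q) :
    edgeMap P₁ P₃ (edgeMap P₀ P₁ (unitElt V)) = edgeMap P₂ P₃ (edgeMap P₀ P₂ (unitElt V)) := by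
  have hX1 : ∀ v, edgeMap P₁ P₃ (genMul P₁ v (unitElt V)) =
      genMul P₃ v (edgeMap P₁ P₃ (unitElt V)) := edgeMap_genMul h2 (compat_const _ _)
  have hX2 : ∀ v, edgeMap P₂ P₃ (genMul P₂ v (unitElt V)) =
      genMul P₃ v (edgeMap P₂ P₃ (unitElt V)) := edgeMap_genMul h4 (compat_const _ _)
  have hC : ∀ v w, genMul P₃ v (genMul P₃ w (unitElt V)) = genMul P₃ w (genMul P₃ v (unitElt V)) :=
    fun v w => genMul_comm v w (compat_const _ _)
  rcases h1 with h1 | h1 <;> rcases h2 with h2 | h2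
  · obtain ⟨h5, h6⟩ := merge_merge h1 h2 h3 h4
    rw [edgeMap_unitElt_merge h1, edgeMap_unitElt_merge h2, edgeMap_unitElt_merge h5,
      edgeMap_unitElt_merge h6]
  · rw [edgeMap_unitElt_merge h1, edgeMap_unitElt_split h2]
    rcases h3 with h3 | h3 <;> rcases h4 with h4 | h4
    · have := (merge_merge h3 h4 (Or.inl h1) (Or.inr h2)).2.1
      exact absurd h2.pair this
    · rw [edgeMap_unitElt_merge h3, edgeMap_unitElt_split h4]
      -- In `P₁` the points `p` and `q` are together, and `P₁` unites the classes of `r` and `s` in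
      -- `P₃`. As `p` and `q` are apart in `P₃`, the pairs `p, q` and `r, s` represent the same two
      -- classes there.
      have h7 := h1.pair
      rw [h2.2] at h7
      rcases h7 with h7 | ⟨h7, h8⟩ | ⟨h7, h8⟩
      · exact absurd h7 h4.1
      · rw [genMul_unitElt_congr h7, genMul_unitElt_congr h8]
      · rw [genMul_unitElt_congr h7, genMul_unitElt_congr h8, add_comm]
    · rw [edgeMap_unitElt_split h3, map_add, hX2, hX2, edgeMap_unitElt_merge h4]
    · have := (merge_merge h4 h3 (Or.inl h2) (Or.inr h1)).2
      exact absurd h1.pair this.1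
  · rw [edgeMap_unitElt_split h1, map_add, hX1, hX1, edgeMap_unitElt_merge h2]
    rcases h3 with h3 | h3 <;> rcases h4 with h4 | h4
    · have := (merge_merge h3 h4 (Or.inr h1) (Or.inl h2)).1
      exact absurd h1.pair this.1
    · rw [edgeMap_unitElt_merge h3, edgeMap_unitElt_split h4]
    · rw [edgeMap_unitElt_split h3, map_add, hX2, hX2, edgeMap_unitElt_merge h4]
      have h7 := h4.pair
      rw [h2.2] at h7
      have hrs := h2.pair
      rcases h7 with h7 | ⟨h7, h8⟩ | ⟨h7, h8⟩
      · exact absurd h7 h1.1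
      · rw [genMul_unitElt_congr (h2.le h7), genMul_unitElt_congr (h2.le h8)]
      · rw [genMul_unitElt_congr (h2.le h7), genMul_unitElt_congr (h2.le h8), add_comm]
    · have := (merge_merge h4 h3 (Or.inr h2) (Or.inl h1)).1
      exact absurd h2.pair this.1
  · obtain ⟨h5, h6⟩ := merge_merge h2 h1 h4.symm h3.symm
    rw [edgeMap_unitElt_split h1, edgeMap_unitElt_split h6, map_add, map_add, hX1, hX1, hX2, hX2,
      edgeMap_unitElt_split h2, edgeMap_unitElt_split h5]
    simp only [map_add]
    rw [hC r p, hC s p, hC r q, hC s q]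
    abel

/-- The faces of the cube of resolutions commute. -/
theorem face_comm {P₀ P₁ P₂ P₃ : Setoid V} {p q r s : V} (h1 : IsSaddle P₀ P₁ p q)
    (h2 : IsSaddle P₁ P₃ r s) (h3 : IsSaddle P₀ P₂ r s) (h4 : IsSaddle P₂ P₃ p q)
    {ε : V → ℤˣ} (hε : Compat P₀ ε) :
    edgeMap P₁ P₃ (edgeMap P₀ P₁ (Finsupp.single ε 1)) =
      edgeMap P₂ P₃ (edgeMap P₀ P₂ (Finsupp.single ε 1)) := by
  classical
  have hX : ∀ {Q p q r s} (_ : IsSaddle P₀ Q p q) (_ : IsSaddle Q P₃ r s) {ε : V → ℤˣ}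
      (_ : Compat P₀ ε) (v : V), edgeMap Q P₃ (edgeMap P₀ Q (genMul P₀ v (Finsupp.single ε 1))) =
        genMul P₃ v (edgeMap Q P₃ (edgeMap P₀ Q (Finsupp.single ε 1))) := by
    intro Q p q r s h h' ε hε v
    rw [edgeMap_genMul h hε, edgeMap_single P₀ Q, map_sum, map_sum, map_sum, map_sum]
    refine Finset.sum_congr rfl fun ε' hε' => ?_
    simp only [Finset.mem_filter, Finset.mem_univ, true_and] at hε'
    exact edgeMap_genMul h' hε'.1 v
  -- Induction on the number of points with sign `1`: such a class is written as a generator acting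
  -- on a state with fewer of them, and the generator commutes with both composites. What remains is
  -- the unit.
  induction hn : (Finset.univ.filter fun v => ε v = 1).card using Nat.strong_induction_on
    generalizing ε with
  | _ n ih =>
    by_cases hex : ∃ v, ε v = 1
    · obtain ⟨v, hv⟩ := hex
      have h5 : upd P₀ v (-1) ε v = -1 := upd_of_rel (P₀.refl v) ..
      have h6 : Finsupp.single ε (1 : ℤ) =
          genMul P₀ v (Finsupp.single (upd P₀ v (-1) ε) 1) := by
        rw [genMul_single_neg h5, upd_upd, upd_self hε hv]
      rw [h6, hX h1 h2 (hε.upd v (-1)), hX h3 h4 (hε.upd v (-1)),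
        ih _ ?_ (hε.upd v (-1)) rfl]
      rw [← hn]
      refine Finset.card_lt_card ⟨fun u hu => ?_, fun h => ?_⟩
      · simp only [Finset.mem_filter, Finset.mem_univ, true_and] at hu ⊢
        by_cases hvu : P₀ v u
        · rw [upd_of_rel hvu] at hu
          exact absurd hu (by decide)
        · rwa [upd_of_not hvu] at hu
      · have := h (show v ∈ _ by simpa using hv)
        simp only [Finset.mem_filter, Finset.mem_univ, true_and, h5] at this
        exact absurd this (by decide)
    · have h0 : ε = fun _ => -1 := by
        funext v
        exact (unit_cases (ε v)).resolve_left fun h => hex ⟨v, h⟩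
      rw [h0]
      exact face_unitElt h1 h2 h3 h4

open Classical in
/-- The number of two-step paths between sign functions does not depend on the path around a
face. -/
theorem face_count {P₀ P₁ P₂ P₃ : Setoid V} {p q r s : V} (h1 : IsSaddle P₀ P₁ p q)
    (h2 : IsSaddle P₁ P₃ r s) (h3 : IsSaddle P₀ P₂ r s) (h4 : IsSaddle P₂ P₃ p q)
    {ε ε₃ : V → ℤˣ} (hε : Compat P₀ ε) (hε₃ : Compat P₃ ε₃) :
    (Finset.univ.filter fun ε₁ => Compat P₁ ε₁ ∧ Edge P₀ P₁ ε ε₁ ∧ Edge P₁ P₃ ε₁ ε₃).card =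
      (Finset.univ.filter fun ε₂ => Compat P₂ ε₂ ∧ Edge P₀ P₂ ε ε₂ ∧ Edge P₂ P₃ ε₂ ε₃).card := by
  have key : ∀ Q : Setoid V, edgeMap Q P₃ (edgeMap P₀ Q (Finsupp.single ε 1)) ε₃ =
      (Finset.univ.filter fun ε₁ => Compat Q ε₁ ∧ Edge P₀ Q ε ε₁ ∧ Edge Q P₃ ε₁ ε₃).card := by
    intro Q
    rw [edgeMap_single P₀ Q, map_sum, Finsupp.finsetSum_apply]
    have : ∀ ε₁ : V → ℤˣ, edgeMap Q P₃ (Finsupp.single ε₁ 1) ε₃ =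
        if Edge Q P₃ ε₁ ε₃ then 1 else 0 := by
      intro ε₁
      rw [edgeMap_single, Finsupp.finsetSum_apply]
      simp only [Finsupp.single_apply]
      rw [Finset.sum_ite_eq']
      simp [hε₃]
    simp only [this]
    rw [Finset.sum_ite, Finset.sum_const_zero, add_zero, Finset.sum_const, Finset.filter_filter]
    simp [and_assoc]
  have := congrArg (fun m => m ε₃) (face_comm h1 h2 h3 h4 hε)
  simp only [key] at this
  exact_mod_cast this

end Partition
end Khovanov

namespace Khovanov

/-! ## Cubes of resolutions -/

theorem Label.eq_B_of_ne {l : Label} (h : l ≠ Label.A) : l = Label.B := by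
  cases l
  · exact absurd rfl h
  · rfl

/-- A cube of resolutions: a partition of a set `V` of points for each labelling of the set `X` of
crossings.  Only the crossings in `free` may have the label `B`. -/
structure Cube (V X : Type) where
  part : (X → Label) → Setoid V
  free : Set X

/-- A labelling and a sign function. -/
abbrev State (V X : Type) : Type := (X → Label) × (V → ℤˣ)

noncomputable instance {V X : Type} [Fintype V] [Fintype X] : Fintype (State V X) :=
  Fintype.ofFinite _

open Classical in
/-- The sign of the change of the label of `x` from `A` to `B`. -/
noncomputable def edgeSign {X : Type} [Fintype X] [LinearOrder X] (s : X → Label) (x : X) : ℤ :=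
  (-1) ^ (Finset.univ.filter fun y => x < y ∧ s y = Label.B).card

theorem edgeSign_mul_self {X : Type} [Fintype X] [LinearOrder X] (s : X → Label) (x : X) :
    edgeSign s x * edgeSign s x = 1 := by
  unfold edgeSign
  rw [← mul_pow]; simp

theorem isUnit_edgeSign {X : Type} [Fintype X] [LinearOrder X] (s : X → Label) (x : X) :
    IsUnit (edgeSign s x) := IsUnit.of_mul_eq_one _ (edgeSign_mul_self s x)

theorem edgeSign_update {X : Type} [Fintype X] [LinearOrder X] {s : X → Label} {x : X}
    (hx : s x = Label.A) (y : X) : edgeSign (Function.update s x Label.B) y =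
      if y < x then -edgeSign s y else edgeSign s y := by
  classical
  unfold edgeSign
  split_ifs with h
  · have : (Finset.univ.filter fun z => y < z ∧ Function.update s x Label.B z = Label.B) =
        insert x (Finset.univ.filter fun z => y < z ∧ s z = Label.B) := by
      ext z
      by_cases hz : z = x
      · subst hz; simp [h]
      · simp [hz]
    rw [this, Finset.card_insert_of_notMem (by simp [hx]), pow_succ]
    ring
  · congr 2
    ext z
    by_cases hz : z = x
    · subst hz; simp [h]
    · simp [hz]

/-- The sign at a crossing counts the `B` labels after it. Of two crossings only the earlier one
notices that the later one has been changed, so exactly one of the two products acquires a sign. -/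
theorem edgeSign_anticomm {X : Type} [Fintype X] [LinearOrder X] {s : X → Label} {x y : X}
    (hxy : x ≠ y) (hx : s x = Label.A) (hy : s y = Label.A) :
    edgeSign s x * edgeSign (Function.update s x Label.B) y =
      -(edgeSign s y * edgeSign (Function.update s y Label.B) x) := by
  rw [edgeSign_update hx, edgeSign_update hy]
  rcases lt_or_gt_of_ne hxy with h | h
  · rw [if_neg (not_lt.2 h.le), if_pos h]; ring
  · rw [if_pos h, if_neg (not_lt.2 h.le)]; ring

/-! ### The chain complex of a cube of resolutions -/

namespace Cube

variable {V X : Type} [Fintype V] [Fintype X] [LinearOrder X] (C : Cube V X)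

/-- The crossings which are not free have the label `A`. -/
def Adm (s : X → Label) : Prop := ∀ x ∉ C.free, s x = Label.A

/-- `h` is obtained from `g` by changing the label of `x` from `A` to `B`. -/
def Step (g h : State V X) (x : X) : Prop :=
  g.1 x = Label.A ∧ h.1 = Function.update g.1 x Label.B ∧ Edge (C.part g.1) (C.part h.1) g.2 h.2

open Classical in
/-- The complex of a cube of resolutions. -/
noncomputable def cx : BasedComplex (State V X) where
  T := {g | C.Adm g.1 ∧ Compat (C.part g.1) g.2}
  a g := ∑ x, if x ∈ C.free then (if g.1 x = Label.A then 1 else -1) else 0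
  b g := (∑ x, if x ∈ C.free then (if g.1 x = Label.A then 1 else -1) else 0) +
    2 * tau (C.part g.1) g.2
  c g h := ∑ x, if C.Step g h x then edgeSign g.1 x else 0

variable {C}

open Classical in
theorem a_def (g : State V X) : C.cx.a g =
    ∑ x, if x ∈ C.free then (if g.1 x = Label.A then 1 else -1) else 0 := rfl

theorem b_def (g : State V X) : C.cx.b g = C.cx.a g + 2 * tau (C.part g.1) g.2 := rfl

open Classical in
theorem c_def (g h : State V X) :
    C.cx.c g h = ∑ x, if C.Step g h x then edgeSign g.1 x else 0 := rfl

theorem c_ne_zero {g h : State V X} (hc : C.cx.c g h ≠ 0) : ∃ x, C.Step g h x := by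
  classical
  rw [c_def] at hc
  obtain ⟨x, -, hx⟩ := Finset.exists_ne_zero_of_sum_ne_zero hc
  exact ⟨x, by by_contra h; exact hx (if_neg h)⟩

theorem Step.label_A {g h : State V X} {x : X} (hx : C.Step g h x) : g.1 x = Label.A := hx.1

theorem Step.label_B {g h : State V X} {x : X} (hx : C.Step g h x) : h.1 x = Label.B := by
  rw [hx.2.1, Function.update_self]

theorem Step.label_ne {g h : State V X} {x y : X} (hx : C.Step g h x) (hy : y ≠ x) :
    h.1 y = g.1 y := by
  rw [hx.2.1, Function.update_of_ne hy]

theorem Step.eq {g h : State V X} {x y : X} (hx : C.Step g h x) (hy : g.1 y = Label.A)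
    (hy' : h.1 y = Label.B) : x = y := by
  by_contra hxy
  rw [hx.label_ne (Ne.symm hxy), hy] at hy'
  cases hy'

open Classical in
theorem c_eq {g h : State V X} {x : X} (hx : g.1 x = Label.A)
    (hh : h.1 = Function.update g.1 x Label.B) :
    C.cx.c g h = if Edge (C.part g.1) (C.part h.1) g.2 h.2 then edgeSign g.1 x else 0 := by
  rw [c_def, Finset.sum_eq_single x]
  · simp only [Step, hx, hh, true_and]
  · intro y _ hy
    refine if_neg fun hs => hy (hs.eq hx ?_)
    rw [hh, Function.update_self]
  · simp

theorem Step.c_eq {g h : State V X} {x : X} (hx : C.Step g h x) :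
    C.cx.c g h = edgeSign g.1 x := by
  classical
  rw [Cube.c_eq hx.1 hx.2.1, if_pos hx.2.2]

/-- The crossing whose label changes is free. -/
theorem Step.mem_free {g h : State V X} {x : X} (hx : C.Step g h x) (hh : h ∈ C.cx.T) :
    x ∈ C.free := by
  by_contra hf
  have := hh.1 x hf
  rw [hx.label_B] at this
  cases this

theorem Step.a_eq {g h : State V X} {x : X} (hx : C.Step g h x) (hh : h ∈ C.cx.T) :
    C.cx.a h = C.cx.a g - 2 := by
  classical
  have hf := hx.mem_free hh
  have : C.cx.a g - C.cx.a h = 2 := by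
    rw [a_def, a_def, ← Finset.sum_sub_distrib, Finset.sum_eq_single x]
    · rw [if_pos hf, if_pos hf, if_pos hx.1, if_neg (by rw [hx.label_B]; decide)]
      norm_num
    · intro y _ hy
      rw [hx.label_ne hy, sub_self]
    · simp
  linarith

variable (C) in
/-- The change of the label of a free crossing unites or separates the classes of two points which
depend on the crossing only. -/
def Elementary : Prop := ∀ x ∈ C.free, ∃ p q, ∀ s : X → Label, s x = Label.A →
  IsSaddle (C.part s) (C.part (Function.update s x Label.B)) p q

/-- The terms of the square are grouped by the ordered pair of crossings changed. Exchanging the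
order preserves the number of intermediate sign functions by `face_count` and reverses the sign by
`edgeSign_anticomm`. -/
theorem Elementary.isComplex (hC : C.Elementary) : C.cx.IsComplex := by
  classical
  constructor
  · intro g _ h hh hc
    obtain ⟨x, hx⟩ := c_ne_zero hc
    have h1 := hx.a_eq hh
    refine ⟨h1, ?_⟩
    rw [b_def, b_def, h1, hx.2.2.1]
    ring
  · intro g hg k hk
    -- `F x y` collects the paths from `g` to `k` that change `x` first and `y` second.
    let F : X → X → ℤ := fun x y => ∑ h, C.cx.T.indicator (fun h =>
      (if C.Step g h x then edgeSign g.1 x else 0) *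
        (if C.Step h k y then edgeSign h.1 y else 0)) h
    have e1 : ∑ h, C.cx.T.indicator (fun h => C.cx.c g h * C.cx.c h k) h = ∑ x, ∑ y, F x y := by
      have : ∀ h, C.cx.T.indicator (fun h => C.cx.c g h * C.cx.c h k) h =
          ∑ x, ∑ y, C.cx.T.indicator (fun h =>
            (if C.Step g h x then edgeSign g.1 x else 0) *
              (if C.Step h k y then edgeSign h.1 y else 0)) h := by
        intro h
        by_cases hh : h ∈ C.cx.T
        · simp only [Set.indicator_of_mem hh]
          rw [c_def, c_def, Finset.sum_mul_sum]
        · simp [Set.indicator_of_notMem hh]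
      simp only [this, F]
      rw [Finset.sum_comm]
      exact Finset.sum_congr rfl fun x _ => Finset.sum_comm
    have hF0 : ∀ x y, F x y ≠ 0 → x ≠ y ∧ g.1 x = Label.A ∧ g.1 y = Label.A ∧
        k.1 = Function.update (Function.update g.1 x Label.B) y Label.B := by
      intro x y hxy
      obtain ⟨h, -, hh⟩ := Finset.exists_ne_zero_of_sum_ne_zero hxy
      have hT : h ∈ C.cx.T := by
        by_contra hT; exact hh (Set.indicator_of_notMem hT _)
      rw [Set.indicator_of_mem hT] at hh
      have h1 : C.Step g h x := by
        by_contra h1; simp [h1] at hh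
      have h2 : C.Step h k y := by
        by_contra h2; simp [h2] at hh
      have hne : x ≠ y := by
        rintro rfl
        have := h1.label_B
        rw [h2.label_A] at this
        cases this
      exact ⟨hne, h1.1, by rw [← h1.label_ne hne.symm]; exact h2.1, by rw [h2.2.1, h1.2.1]⟩
    have hF1 : ∀ x y, x ≠ y → g.1 x = Label.A → g.1 y = Label.A →
        k.1 = Function.update (Function.update g.1 x Label.B) y Label.B →
        F x y = (Finset.univ.filter fun ε₁ => Compat (C.part (Function.update g.1 x Label.B)) ε₁ ∧
          Edge (C.part g.1) (C.part (Function.update g.1 x Label.B)) g.2 ε₁ ∧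
          Edge (C.part (Function.update g.1 x Label.B)) (C.part k.1) ε₁ k.2).card *
          (edgeSign g.1 x * edgeSign (Function.update g.1 x Label.B) y) := by
      intro x y hxy hx hy hk'
      have hadm : C.Adm (Function.update g.1 x Label.B) := by
        intro z hz
        have h1 := hk.1 z hz
        rw [hk'] at h1
        by_cases hzy : z = y
        · subst hzy
          rw [Function.update_self] at h1
          cases h1
        · rwa [Function.update_of_ne hzy] at h1
      have h1 : ∀ h : State V X, C.cx.T.indicator (fun h =>
          (if C.Step g h x then edgeSign g.1 x else 0) *
            (if C.Step h k y then edgeSign h.1 y else 0)) h =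
          if h.1 = Function.update g.1 x Label.B ∧
            (Compat (C.part (Function.update g.1 x Label.B)) h.2 ∧
              Edge (C.part g.1) (C.part (Function.update g.1 x Label.B)) g.2 h.2 ∧
              Edge (C.part (Function.update g.1 x Label.B)) (C.part k.1) h.2 k.2)
          then edgeSign g.1 x * edgeSign (Function.update g.1 x Label.B) y else 0 := by
        rintro ⟨s, ε⟩
        by_cases hs : s = Function.update g.1 x Label.B
        · subst hs
          by_cases hc : Compat (C.part (Function.update g.1 x Label.B)) ε
          · rw [Set.indicator_of_mem (show (Function.update g.1 x Label.B, ε) ∈ C.cx.T from ⟨hadm, hc⟩)]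
            have hy' : Function.update g.1 x Label.B y = Label.A := by
              rw [Function.update_of_ne hxy.symm, hy]
            simp only [Step, hx, true_and, hc, hy', ← hk']
            split_ifs <;> simp_all
          · rw [Set.indicator_of_notMem (fun h => hc h.2), if_neg (fun h => hc h.2.1)]
        · have : ¬ C.Step g (s, ε) x := fun h => hs h.2.1
          rw [if_neg (fun h => hs h.1)]
          by_cases hT : (s, ε) ∈ C.cx.T
          · rw [Set.indicator_of_mem hT, if_neg this, zero_mul]
          · rw [Set.indicator_of_notMem hT]
      simp only [F, h1]
      rw [Finset.sum_ite, Finset.sum_const_zero, add_zero, Finset.sum_const, nsmul_eq_mul]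
      congr 2
      refine Finset.card_bij (fun h _ => h.2) ?_ ?_ ?_
      · intro h hh
        simp only [Finset.mem_filter, Finset.mem_univ, true_and] at hh ⊢
        exact hh.2
      · intro h hh h' hh' he
        simp only [Finset.mem_filter, Finset.mem_univ, true_and] at hh hh'
        exact Prod.ext (hh.1.trans hh'.1.symm) he
      · intro ε hε
        simp only [Finset.mem_filter, Finset.mem_univ, true_and] at hε
        exact ⟨(Function.update g.1 x Label.B, ε), by simpa using hε, rfl⟩
    have hF : ∀ x y, F x y = - F y x := by
      intro x y
      by_cases h : x ≠ y ∧ g.1 x = Label.A ∧ g.1 y = Label.A ∧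
        k.1 = Function.update (Function.update g.1 x Label.B) y Label.B
      · obtain ⟨hxy, hx, hy, hk'⟩ := h
        have hk'' : k.1 = Function.update (Function.update g.1 y Label.B) x Label.B := by
          rw [hk', Function.update_comm hxy]
        rw [hF1 x y hxy hx hy hk', hF1 y x hxy.symm hy hx hk'', edgeSign_anticomm hxy hx hy,
          mul_neg]
        congr 3
        have hkx : k.1 x = Label.B := by rw [hk'', Function.update_self]
        have hky : k.1 y = Label.B := by rw [hk', Function.update_self]
        have hxf : x ∈ C.free := by
          by_contra hf; rw [hk.1 x hf] at hkx; cases hkx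
        have hyf : y ∈ C.free := by
          by_contra hf; rw [hk.1 y hf] at hky; cases hky
        -- The points attached to a crossing do not depend on the other labels, so one pair serves
        -- both parallel edges of the face.
        obtain ⟨p, q, hpq⟩ := hC x hxf
        obtain ⟨r, s, hrs⟩ := hC y hyf
        have h1 := hpq g.1 hx
        have h2 := hrs _ (show Function.update g.1 x Label.B y = Label.A by
          rw [Function.update_of_ne hxy.symm, hy])
        have h3 := hrs g.1 hy
        have h4 := hpq _ (show Function.update g.1 y Label.B x = Label.A by
          rw [Function.update_of_ne hxy, hx])
        rw [← hk'] at h2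
        rw [← hk''] at h4
        exact face_count h1 h2 h3 h4 hg.2 hk.2
      · have h1 : F x y = 0 := by
          by_contra h1; exact h (hF0 x y h1)
        have h2 : F y x = 0 := by
          by_contra h2
          obtain ⟨h3, h4, h5, h6⟩ := hF0 y x h2
          exact h ⟨h3.symm, h5, h4, by rw [h6, Function.update_comm h3]⟩
        rw [h1, h2, neg_zero]
    rw [e1]
    -- By antisymmetry the double sum equals its own negative, hence is zero in ℤ.
    have e2 : ∑ x, ∑ y, F x y = - ∑ x, ∑ y, F x y := by
      conv_lhs => rw [Finset.sum_comm]
      rw [← Finset.sum_neg_distrib]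
      refine Finset.sum_congr rfl fun x _ => ?_
      rw [← Finset.sum_neg_distrib]
      exact Finset.sum_congr rfl fun y _ => hF y x
    linarith

end Cube
end Khovanov

namespace Khovanov

/-! ## Isolated circles -/

section Partition

variable {V : Type} [Fintype V]

/-- `O` is the class of `o`. -/
def IsClass (P : Setoid V) (O : Set V) (o : V) : Prop := ∀ v, P o v ↔ v ∈ O

open Classical in
/-- The sign function which is `η` on `O` and equal to `ε` elsewhere. -/
noncomputable def put (O : Set V) (η : ℤˣ) (ε : V → ℤˣ) : V → ℤˣ := fun v => if v ∈ O then η else ε v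

variable {O : Set V} {o q : V} {P Q : Setoid V} {ε ε' : V → ℤˣ}

theorem put_mem {v : V} (h : v ∈ O) (η : ℤˣ) (ε : V → ℤˣ) : put O η ε v = η := if_pos h

theorem put_notMem {v : V} (h : v ∉ O) (η : ℤˣ) (ε : V → ℤˣ) : put O η ε v = ε v := if_neg h

theorem put_put (η η' : ℤˣ) : put O η (put O η' ε) = put O η ε := by
  funext v
  by_cases h : v ∈ O
  · rw [put_mem h, put_mem h]
  · rw [put_notMem h, put_notMem h, put_notMem h]

theorem IsClass.mem (h : IsClass P O o) : o ∈ O := (h o).1 (P.refl o)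

theorem IsClass.not_rel (h : IsClass P O o) (hq : q ∉ O) : ¬ P o q := fun h' => hq ((h q).1 h')

theorem IsClass.mem_iff (h : IsClass P O o) {v w : V} (hvw : P v w) : v ∈ O ↔ w ∈ O := by
  rw [← h v, ← h w]
  exact ⟨fun h' => P.trans h' hvw, fun h' => P.trans h' (P.symm hvw)⟩

theorem IsClass.eq_of_mem (h : IsClass P O o) (hε : Compat P ε) {v : V} (hv : v ∈ O) :
    ε v = ε o := (hε _ _ ((h v).2 hv)).symm

theorem IsClass.put_self (h : IsClass P O o) (hε : Compat P ε) {η : ℤˣ} (hη : ε o = η) :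
    put O η ε = ε := by
  funext v
  by_cases hv : v ∈ O
  · rw [put_mem hv, h.eq_of_mem hε hv, hη]
  · rw [put_notMem hv]

theorem IsClass.compat_put (h : IsClass P O o) (hε : Compat P ε) (η : ℤˣ) :
    Compat P (put O η ε) := by
  intro v w hvw
  by_cases hv : v ∈ O
  · rw [put_mem hv, put_mem ((h.mem_iff hvw).1 hv)]
  · rw [put_notMem hv, put_notMem fun hw => hv ((h.mem_iff hvw).2 hw), hε _ _ hvw]

theorem IsClass.compat_merge (h : IsClass P O o) (hq : q ∉ O) (hε : Compat P ε) :
    Compat (glue P o q) (put O (ε q) ε) :=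
  (h.compat_put hε _).glue (by rw [put_mem h.mem, put_notMem hq])

theorem IsClass.put_eq (h : IsClass P O o) (hε : Compat (glue P o q) ε) : put O (ε q) ε = ε :=
  h.put_self (hε.mono (le_glue _ _ _)) (hε _ _ (glue_pair _ _ _))

theorem IsClass.glue_iff (h : IsClass P O o) (v : V) : glue P o q v o ↔ v ∈ O ∨ P v q := by
  constructor
  · rintro (h1 | ⟨h1, _⟩ | ⟨h1, _⟩)
    · exact Or.inl ((h v).1 (P.symm h1))
    · exact Or.inl ((h v).1 (P.symm h1))
    · exact Or.inr h1
  · rintro (h1 | h1)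
    · exact Or.inl (P.symm ((h v).2 h1))
    · exact Or.inr (Or.inr ⟨h1, P.refl o⟩)

/-- A circle of sign `-1` is the unit, so merging it leaves a single possible outcome: the sign of
the other circle is kept. This makes the merge a bijection of bases. -/
theorem IsClass.edge_merge_iff (h : IsClass P O o) (hq : q ∉ O) (hε : Compat P ε)
    (ho : ε o = -1) (hε' : Compat (glue P o q) ε') :
    Edge P (glue P o q) ε ε' ↔ ε' = put O (ε q) ε := by
  rw [edge_merge (h.not_rel hq) hε hε']
  constructor
  · rintro ⟨h1, h2⟩
    have h3 : ε' o = ε q := Units.ext (by rw [h2, ho]; push_cast; ring)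
    have h4 : ε' q = ε q := by rw [← hε' _ _ (glue_pair P o q), h3]
    funext v
    by_cases hv : v ∈ O
    · rw [put_mem hv, h.eq_of_mem (hε'.mono (le_glue _ _ _)) hv, h3]
    · rw [put_notMem hv]
      by_cases hv' : P v q
      · rw [hε _ _ hv', ← h4]
        exact hε' _ _ (Or.inl hv')
      · exact (h1 v fun h5 => ((h.glue_iff v).1 h5).elim hv hv').symm
  · rintro rfl
    refine ⟨fun v hv => ?_, ?_⟩
    · rw [put_notMem fun h5 => hv ((h.glue_iff v).2 (Or.inl h5))]
    · rw [put_mem h.mem, ho]; push_cast; ring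

/-- Dually, the component of a splitting in which the new circle has sign `1` is a bijection: the
source is recovered by giving the united circle the sign of the remaining one. -/
theorem IsClass.edge_split_iff (h : IsClass P O o) (hq : q ∉ O) (hε : Compat (glue P o q) ε)
    (hε' : Compat P ε') (ho : ε' o = 1) :
    Edge (glue P o q) P ε ε' ↔ ε = put O (ε' q) ε' := by
  rw [edge_split (h.not_rel hq) hε hε']
  constructor
  · rintro ⟨h1, h2⟩
    have h3 : ε o = ε' q := Units.ext (by rw [ho] at h2; push_cast at h2; linarith)
    have h4 : ε q = ε' q := by rw [← hε _ _ (glue_pair P o q), h3]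
    funext v
    by_cases hv : v ∈ O
    · rw [put_mem hv, h.eq_of_mem (hε.mono (le_glue _ _ _)) hv, h3]
    · rw [put_notMem hv]
      by_cases hv' : P v q
      · rw [hε' _ _ hv', ← h4]
        exact hε _ _ (Or.inl hv')
      · exact h1 v fun h5 => ((h.glue_iff v).1 h5).elim hv hv'
  · rintro rfl
    refine ⟨fun v hv => ?_, ?_⟩
    · rw [put_notMem fun h5 => hv ((h.glue_iff v).2 (Or.inl h5))]
    · rw [put_mem h.mem, ho]; push_cast; ring

theorem IsClass.tau_merge (h : IsClass P O o) (hq : q ∉ O) (hε : Compat P ε) :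
    tau P ε = tau (glue P o q) (put O (ε q) ε) + ε o := by
  have := tau_sub_tau (h.not_rel hq) hε (h.compat_merge hq hε) fun v hv => by
    rw [put_notMem fun h5 => hv ((h.glue_iff v).2 (Or.inl h5))]
  rw [put_mem h.mem] at this
  linarith

theorem Edge.sign_eq_of_isClass (he : Edge P Q ε ε') (h : IsClass P O o) (h' : IsClass Q O o) :
    ε o = ε' o := he.2 o fun u => by rw [h u, h' u]

/-- The isolated circle is untouched by the edge and has equal signs at both ends, so its
contribution cancels from the sums of signs. Outside `O` the common classes before and after gluing
are the same, and points of `O` inherit the answer at `q`. -/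
theorem IsClass.edge_glue_iff {q' : V} (h : IsClass P O o) (h' : IsClass Q O o) (hq : q ∉ O)
    (hq' : q' ∉ O) (hqq : q = q') (hε : Compat P ε) (hε' : Compat Q ε') (ho : ε o = ε' o) :
    Edge (glue P o q) (glue Q o q') (put O (ε q) ε) (put O (ε' q') ε') ↔ Edge P Q ε ε' := by
  subst hqq
  unfold Edge
  rw [h.tau_merge hq hε, h'.tau_merge hq hε', ho]
  refine and_congr (by constructor <;> intro <;> linarith) ?_
  have key : ∀ v, v ∉ O → (SameClass (glue P o q) (glue Q o q) v ↔ SameClass P Q v) := by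
    intro v hv
    have e : ∀ {R : Setoid V}, IsClass R O o → ∀ u, glue R o q v u ↔
        R v u ∨ (R v q ∧ u ∈ O) := by
      intro R hR u
      constructor
      · rintro (h1 | ⟨h1, _⟩ | ⟨h1, h2⟩)
        · exact Or.inl h1
        · exact absurd ((hR v).1 (R.symm h1)) hv
        · exact Or.inr ⟨h1, (hR u).1 (R.symm h2)⟩
      · rintro (h1 | ⟨h1, h2⟩)
        · exact Or.inl h1
        · exact Or.inr (Or.inr ⟨h1, R.symm ((hR u).2 h2)⟩)
    have no : ∀ {R : Setoid V}, IsClass R O o → ∀ u ∈ O, ¬ R v u := fun hR u hu h1 =>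
      hv ((hR.mem_iff h1).2 hu)
    constructor
    · intro hs u
      by_cases hu : u ∈ O
      · exact iff_of_false (no h u hu) (no h' u hu)
      · have := hs u
        rw [e h, e h'] at this
        simpa [hu] using this
    · intro hs u
      rw [e h, e h', hs u, hs q]
  constructor
  · intro h1 v hv
    by_cases hvO : v ∈ O
    · rw [h.eq_of_mem hε hvO, h'.eq_of_mem hε' hvO, ho]
    · have := h1 v ((key v hvO).2 hv)
      rwa [put_notMem hvO, put_notMem hvO] at this
  · intro h1 v hv
    by_cases hvO : v ∈ O
    · rw [put_mem hvO, put_mem hvO]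
      refine h1 q ((key q hq).1 fun u => ?_)
      have e1 : glue P o q v q := (glue P o q).trans (Or.inl (P.symm ((h v).2 hvO)))
        (glue_pair P o q)
      have e2 : glue Q o q v q := (glue Q o q).trans (Or.inl (Q.symm ((h' v).2 hvO)))
        (glue_pair Q o q)
      constructor
      · intro h2
        exact (glue Q o q).trans ((glue Q o q).symm e2) ((hv u).1 ((glue P o q).trans e1 h2))
      · intro h2
        exact (glue P o q).trans ((glue P o q).symm e1) ((hv u).2 ((glue Q o q).trans e2 h2))
    · rw [put_notMem hvO, put_notMem hvO]
      exact h1 v ((key v hvO).1 hv)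

end Partition

namespace BasedComplex

variable {G : Type} {K : BasedComplex G}

theorem res_congr {S S' : Set G} (h : ∀ g ∈ K.T, g ∈ S ↔ g ∈ S') : K.res S = K.res S' := by
  have : K.T ∩ S = K.T ∩ S' := by
    ext g
    exact and_congr_right fun hg => h g hg
  simp only [res, this]

theorem res_res (S S' : Set G) : (K.res S).res S' = K.res (S ∩ S') := by
  simp only [res, Set.inter_assoc]

theorem res_eq_self {S : Set G} (h : ∀ g ∈ K.T, g ∈ S) : K.res S = K := by
  have : K.T ∩ S = K.T := Set.inter_eq_left.2 h
  simp only [res, this]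

end BasedComplex

/-! ### Faces of a cube, and isolated circles of fixed sign -/

namespace Cube

variable {V X : Type} [Fintype V] [Fintype X] [LinearOrder X] {C : Cube V X}

variable (C) in
/-- The face of a cube where the crossing `x` has the label `l`. -/
def freeze (x : X) (l : Label) : Cube V X where
  part s := C.part (Function.update s x l)
  free := C.free \ {x}

open Classical in
/-- The sign relating a face to the cube of a diagram with a smoothed crossing. -/
noncomputable def faceSign (l : Label) (x : X) (s : X → Label) : ℤˣ :=
  if l = Label.A then 1 else (-1) ^ (Finset.univ.filter fun z => z < x ∧ s z = Label.B).card

theorem faceSign_A (x : X) (s : X → Label) : faceSign Label.A x s = 1 := if_pos rfl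

open Classical in
theorem faceSign_B (x : X) (s : X → Label) : faceSign Label.B x s =
    (-1) ^ (Finset.univ.filter fun z => z < x ∧ s z = Label.B).card := if_neg (by decide)

/-- A `B` label at `x` is counted by the edge signs of the earlier crossings `z`, but no longer
after smoothing. `faceSign` changes exactly along the edges at such `z` and compensates. -/
theorem edgeSign_face {s : X → Label} {x z : X} (l : Label) (hx : s x = l) (hz : s z = Label.A)
    (hxz : z ≠ x) : edgeSign (Function.update s x Label.A) z =
      faceSign l x s * faceSign l x (Function.update s z Label.B) * edgeSign s z := by
  classical
  by_cases hl : l = Label.A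
  · subst hl
    rw [faceSign_A, faceSign_A, ← hx, Function.update_eq_self]
    simp
  · have hl' := Label.eq_B_of_ne hl
    subst hl'
    have e1 : s = Function.update (Function.update s x Label.A) x Label.B := by
      rw [Function.update_idem, ← hx, Function.update_eq_self]
    have e2 := edgeSign_update (s := Function.update s x Label.A) (x := x)
      (Function.update_self ..) z
    rw [← e1] at e2
    have e3 : faceSign Label.B x (Function.update s z Label.B) =
        if z < x then - faceSign Label.B x s else faceSign Label.B x s := by
      rw [faceSign_B, faceSign_B]
      split_ifs with h
      · have : (Finset.univ.filter fun y => y < x ∧ Function.update s z Label.B y = Label.B) =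
            insert z (Finset.univ.filter fun y => y < x ∧ s y = Label.B) := by
          ext y
          by_cases hy : y = z
          · subst hy; simp [h]
          · simp [hy]
        rw [this, Finset.card_insert_of_notMem (by simp [hz]), pow_succ]
        simp
      · congr 2
        ext y
        by_cases hy : y = z
        · subst hy; simp [h]
        · simp [hy]
    rw [e3, e2]
    have e4 : ((faceSign Label.B x s : ℤˣ) : ℤ) * (faceSign Label.B x s : ℤˣ) = 1 := by
      rw [← Units.val_mul, Int.units_mul_self, Units.val_one]
    split_ifs with h
    · push_cast
      linear_combination (-edgeSign (Function.update s x Label.A) z) * e4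
    · linear_combination (-edgeSign (Function.update s x Label.A) z) * e4

/-- A crossing that is not free must carry the label `A`. So in the frozen cube `x` has the formal
label `A`, whereas the partition is computed with `l`. -/
theorem adm_freeze {x : X} (hx : x ∈ C.free) {l : Label} {s : X → Label} :
    (C.freeze x l).Adm s ↔ s x = Label.A ∧ C.Adm (Function.update s x l) := by
  constructor
  · intro h
    refine ⟨h x fun h => h.2 rfl, fun z hz => ?_⟩
    have hzx : z ≠ x := fun h => hz (h ▸ hx)
    rw [Function.update_of_ne hzx]
    exact h z fun h => hz h.1
  · rintro ⟨h1, h2⟩ z hz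
    by_cases hzx : z = x
    · rw [hzx, h1]
    · have := h2 z fun h => hz ⟨h, hzx⟩
      rwa [Function.update_of_ne hzx] at this

theorem update_update_eq {s : X → Label} {x : X} {l : Label} (h : s x = l) (l' : Label) :
    Function.update (Function.update s x l') x l = s := by
  rw [Function.update_idem, ← h, Function.update_eq_self]

/-- The degree shift for smoothing a crossing. -/
def labelShift : Label → ℤ
  | Label.A => -1
  | Label.B => 1

/-- A face of a cube, as a part of the basis, has the homology of the cube of the smoothed
diagram. -/
theorem freeze_equiv {x : X} (hx : x ∈ C.free) (l : Label) (W : Set (State V X))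
    (hW : ∀ g : State V X, g ∈ W ↔ (Function.update g.1 x Label.A, g.2) ∈ W) (a b : ℤ) :
    Nonempty ((C.cx.res {g | g.1 x = l ∧ g ∈ W}).H a b ≃+
      ((C.freeze x l).cx.res W).H (a + labelShift l) (b + labelShift l)) := by
  classical
  have hpart : ∀ s : X → Label, s x = l →
      (C.freeze x l).part (Function.update s x Label.A) = C.part s := by
    intro s hs
    change C.part _ = _
    rw [update_update_eq hs]
  have ha : ∀ g : State V X, g.1 x = l → (C.freeze x l).cx.a (Function.update g.1 x Label.A, g.2) =
      C.cx.a g + labelShift l := by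
    intro g hg
    have : (C.freeze x l).cx.a (Function.update g.1 x Label.A, g.2) - C.cx.a g = labelShift l := by
      rw [a_def, a_def, ← Finset.sum_sub_distrib, Finset.sum_eq_single x]
      · rw [if_neg (fun h : x ∈ (C.freeze x l).free => h.2 rfl), if_pos hx, hg]
        cases l <;> simp [labelShift]
      · intro y _ hy
        have : y ∈ (C.freeze x l).free ↔ y ∈ C.free := ⟨fun h => h.1, fun h => ⟨h, hy⟩⟩
        simp only [this, Function.update_of_ne hy, sub_self]
      · simp
    linarith
  refine BasedComplex.nonempty_equiv_of_bijOn
    (fun g => (Function.update g.1 x Label.A, g.2)) ⟨?_, ?_, ?_⟩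
    (fun g => faceSign l x g.1) _ _ ?_ ?_ ?_ a b
  · rintro g ⟨⟨h1, h2⟩, h3, h4⟩
    refine ⟨⟨(adm_freeze hx).2 ⟨Function.update_self .., ?_⟩, ?_⟩, (hW g).1 h4⟩
    · rwa [update_update_eq h3]
    · change Compat ((C.freeze x l).part _) g.2
      rwa [hpart _ h3]
  · rintro g ⟨_, h3, _⟩ g' ⟨_, h3', _⟩ h
    obtain ⟨h5, h6⟩ := Prod.mk.inj h
    refine Prod.ext ?_ h6
    have := congrArg (fun s => Function.update s x l) h5
    rwa [update_update_eq h3, update_update_eq h3'] at this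
  · rintro g ⟨⟨h1, h2⟩, h4⟩
    obtain ⟨h5, h6⟩ := (adm_freeze hx).1 h1
    have e : Function.update (Function.update g.1 x l) x Label.A = g.1 := update_update_eq h5 l
    refine ⟨(Function.update g.1 x l, g.2), ⟨⟨h6, h2⟩, Function.update_self .., ?_⟩, ?_⟩
    · rw [hW]
      change (Function.update (Function.update g.1 x l) x Label.A, g.2) ∈ W
      rwa [e]
    · exact Prod.ext e rfl
  · rintro g ⟨_, h3, _⟩
    exact ha g h3
  · rintro g ⟨_, h3, _⟩
    change (C.freeze x l).cx.b _ = C.cx.b g + _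
    rw [b_def, b_def, ha g h3]
    change _ + 2 * tau ((C.freeze x l).part (Function.update g.1 x Label.A)) g.2 = _
    rw [hpart _ h3]
    ring
  · rintro g ⟨hgT, h3, _⟩ h ⟨hhT, h3', _⟩
    change (C.freeze x l).cx.c _ _ = _ * C.cx.c g h
    have step : ∀ z, z ≠ x → (C.Step g h z ↔ (C.freeze x l).Step
        (Function.update g.1 x Label.A, g.2) (Function.update h.1 x Label.A, h.2) z) := by
      intro z hz
      unfold Step
      simp only [hpart _ h3, hpart _ h3', Function.update_of_ne hz]
      refine and_congr_right fun _ => and_congr_left fun _ => ?_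
      rw [Function.update_comm hz.symm]
      constructor
      · intro h; rw [h, Function.update_comm hz]
      · intro h
        have := congrArg (fun s => Function.update s x l) h
        rw [update_update_eq h3'] at this
        rw [this, update_update_eq]
        rw [Function.update_of_ne hz.symm, h3]
    by_cases hs : ∃ z, C.Step g h z
    · obtain ⟨z, hz⟩ := hs
      have hzx : z ≠ x := by
        rintro rfl
        have := hz.label_B
        rw [h3', ← h3, hz.label_A] at this
        cases this
      rw [hz.c_eq, ((step z hzx).1 hz).c_eq]
      change edgeSign (Function.update g.1 x Label.A) z = _
      rw [edgeSign_face l h3 hz.1 hzx, hz.2.1]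
    · have h1 : C.cx.c g h = 0 := by
        by_contra h0; exact hs (c_ne_zero h0)
      have h2 : (C.freeze x l).cx.c (Function.update g.1 x Label.A, g.2)
          (Function.update h.1 x Label.A, h.2) = 0 := by
        by_contra h0
        obtain ⟨z, hz⟩ := c_ne_zero h0
        have hzx : z ≠ x := by
          rintro rfl
          have := hz.label_B
          simp at this
        exact hs ⟨z, (step z hzx).2 hz⟩
      rw [h1, h2, mul_zero]

/-- An isolated circle with a fixed sign may be united with another circle. -/
theorem blob_equiv {C C' : Cube V X} (hfree : C.free = C'.free) {O : Set V} {o q : V} (hq : q ∉ O)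
    (hO : ∀ s, C.Adm s → IsClass (C.part s) O o)
    (hglue : ∀ s, C.Adm s → C'.part s = glue (C.part s) o q) (η : ℤˣ) (a b : ℤ) :
    Nonempty ((C.cx.res {g | g.2 o = η}).H a b ≃+ C'.cx.H a (b - 2 * η)) := by
  classical
  have hadm : ∀ s, C'.Adm s ↔ C.Adm s := fun s => by unfold Adm; rw [hfree]
  have := BasedComplex.nonempty_equiv_of_bijOn (K := C.cx.res {g | g.2 o = η}) (K' := C'.cx)
    (fun g => (g.1, put O (g.2 q) g.2)) ⟨?_, ?_, ?_⟩ (fun _ => 1) 0 (-(2 * η)) ?_ ?_ ?_ a b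
  · rwa [add_zero, ← sub_eq_add_neg] at this
  · rintro g ⟨⟨h1, h2⟩, h3⟩
    refine ⟨(hadm _).2 h1, ?_⟩
    change Compat (C'.part g.1) _
    rw [hglue _ h1]
    exact (hO _ h1).compat_merge hq h2
  · rintro ⟨s, ε⟩ ⟨⟨h1, h2⟩, h3⟩ ⟨s', ε'⟩ ⟨⟨h1', h2'⟩, h3'⟩ h
    obtain ⟨rfl, h⟩ := Prod.mk.inj h
    refine Prod.ext rfl ?_
    have := congrArg (put O η) h
    simp only [put_put] at this
    rwa [(hO _ h1).put_self h2 h3, (hO _ h1).put_self h2' h3'] at this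
  · rintro ⟨s, ε⟩ ⟨h1, h2⟩
    have h1' := (hadm _).1 h1
    change Compat (C'.part s) ε at h2
    rw [hglue _ h1'] at h2
    refine ⟨(s, put O η ε), ⟨⟨h1', (hO _ h1').compat_put (h2.mono (le_glue _ _ _)) _⟩,
      put_mem (hO _ h1').mem ..⟩, ?_⟩
    refine Prod.ext rfl ?_
    change put O (put O η ε q) (put O η ε) = ε
    rw [put_put, put_notMem hq, (hO _ h1').put_eq h2]
  · intro g _
    change C'.cx.a _ = C.cx.a g + 0
    rw [a_def, a_def, hfree, add_zero]
  · rintro g ⟨⟨h1, h2⟩, h3⟩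
    change C'.cx.b _ = C.cx.b g + _
    rw [b_def, b_def, a_def, a_def, hfree, (hO _ h1).tau_merge hq h2]
    change _ + 2 * tau (C'.part g.1) _ = _
    rw [hglue _ h1, show g.2 o = η from h3]
    ring
  · rintro g ⟨⟨h1, h2⟩, h3⟩ h ⟨⟨h1', h2'⟩, h3'⟩
    change C'.cx.c _ _ = _ * C.cx.c g h
    rw [c_def, c_def]
    have : ∀ x, C'.Step (g.1, put O (g.2 q) g.2) (h.1, put O (h.2 q) h.2) x ↔ C.Step g h x := by
      intro x
      unfold Step
      refine and_congr Iff.rfl (and_congr Iff.rfl ?_)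
      change Edge (C'.part g.1) (C'.part h.1) _ _ ↔ _
      rw [hglue _ h1, hglue _ h1', IsClass.edge_glue_iff (hO _ h1) (hO _ h1') hq hq rfl h2 h2'
        (h3.trans h3'.symm)]
    simp only [this]
    simp

end Cube
end Khovanov

namespace Khovanov
-- Cancellation of acyclic pieces: kinks and the second Reidemeister move
namespace Cube

variable {V X : Type} [Fintype V] [Fintype X] [LinearOrder X] {C : Cube V X}

theorem Adm.update_free {x : X} (hx : x ∈ C.free) {s : X → Label} (hs : C.Adm s) (l : Label) :
    C.Adm (Function.update s x l) := by
  intro z hz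
  rw [Function.update_of_ne fun h => hz (by rw [h]; exact hx)]
  exact hs z hz

/-- Uniting an isolated circle of sign `-1` with another circle gives an acyclic complex. -/
theorem exactAt_merge {R : Set (State V X)} (hK : (C.cx.res R).IsComplex) {x : X} (hx : x ∈ C.free)
    (cond : Set (X → Label)) (hcond : ∀ s l, Function.update s x l ∈ cond ↔ s ∈ cond)
    {O : Set V} {o q : V} (hq : q ∉ O)
    (hR : ∀ g : State V X, g ∈ R ↔ g.1 ∈ cond ∧ (g.1 x = Label.A → g.2 o = -1))
    (hO : ∀ s ∈ cond, C.Adm s → s x = Label.A → IsClass (C.part s) O o)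
    (hglue : ∀ s ∈ cond, C.Adm s → s x = Label.A →
      C.part (Function.update s x Label.B) = glue (C.part s) o q)
    (a b : ℤ) : (C.cx.res R).ExactAt a b := by
  classical
  -- The isolated circle carries the unit, so the change at `x` has exactly one target. This is the
  -- matching that makes the complex acyclic.
  have hedge : ∀ g ∈ (C.cx.res R).T, g.1 x = Label.A → ∀ h ∈ (C.cx.res R).T,
      h.1 = Function.update g.1 x Label.B → (Edge (C.part g.1) (C.part h.1) g.2 h.2 ↔
        h.2 = put O (g.2 q) g.2) := by
    rintro g ⟨⟨h1, h2⟩, h3⟩ hA h ⟨⟨h1', h2'⟩, h3'⟩ hh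
    obtain ⟨h4, h5⟩ := (hR g).1 h3
    rw [hh, hglue _ h4 h1 hA] at h2' ⊢
    exact (hO _ h4 h1 hA).edge_merge_iff hq h2 (h5 hA) h2'
  have hmaps : ∀ g ∈ (C.cx.res R).T, g.1 x = Label.A →
      (Function.update g.1 x Label.B, put O (g.2 q) g.2) ∈ (C.cx.res R).T := by
    rintro g ⟨⟨h1, h2⟩, h3⟩ hA
    obtain ⟨h4, h5⟩ := (hR g).1 h3
    refine ⟨⟨h1.update_free hx _, ?_⟩, (hR _).2 ⟨(hcond _ _).2 h4, fun h => ?_⟩⟩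
    · change Compat (C.part (Function.update g.1 x Label.B)) _
      rw [hglue _ h4 h1 hA]
      exact (hO _ h4 h1 hA).compat_merge hq h2
    · simp at h
  refine BasedComplex.exactAt_of_matching hK {g | g.1 x = Label.A}
    (fun g => (Function.update g.1 x Label.B, put O (g.2 q) g.2)) ⟨?_, ?_, ?_⟩ ?_ ?_ a b
  · rintro g ⟨h1, h2⟩
    refine ⟨hmaps g h1 h2, ?_⟩
    simp
  · rintro g ⟨⟨⟨h1, h2⟩, h3⟩, hA⟩ g' ⟨⟨⟨h1', h2'⟩, h3'⟩, hA'⟩ he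
    obtain ⟨h4, h5⟩ := (hR g).1 h3
    obtain ⟨h4', h5'⟩ := (hR g').1 h3'
    obtain ⟨e1, e2⟩ := Prod.mk.inj he
    have e3 := congrArg (fun s => Function.update s x Label.A) e1
    simp only [update_update_eq (show g.1 x = Label.A from hA),
      update_update_eq (show g'.1 x = Label.A from hA')] at e3
    have e4 := congrArg (put O (-1)) e2
    rw [put_put, put_put, (hO _ h4 h1 hA).put_self h2 (h5 hA),
      (hO _ h4' h1' hA').put_self h2' (h5' hA')] at e4
    exact Prod.ext e3 e4
  · rintro ⟨s, ε⟩ ⟨⟨⟨h1, h2⟩, h3⟩, hB⟩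
    have hB' : s x = Label.B := Label.eq_B_of_ne hB
    obtain ⟨h4, -⟩ := (hR _).1 h3
    have c1 : Function.update s x Label.A ∈ cond := (hcond _ _).2 h4
    have c2 : C.Adm (Function.update s x Label.A) := Adm.update_free hx h1 _
    have hA : Function.update s x Label.A x = Label.A := Function.update_self ..
    have hO' := hO _ c1 c2 hA
    have hg := hglue _ c1 c2 hA
    rw [update_update_eq hB'] at hg
    change Compat (C.part s) ε at h2
    rw [hg] at h2
    refine ⟨(Function.update s x Label.A, put O (-1) ε), ⟨⟨⟨c2,
      hO'.compat_put (h2.mono (le_glue _ _ _)) _⟩, (hR _).2 ⟨c1, fun _ => put_mem hO'.mem ..⟩⟩,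
      hA⟩, ?_⟩
    refine Prod.ext (update_update_eq hB' _) ?_
    change put O (put O (-1) ε q) (put O (-1) ε) = ε
    rw [put_put, put_notMem hq, hO'.put_eq h2]
  · intro g hg hA
    change IsUnit (C.cx.c _ _)
    rw [c_eq hA rfl, if_pos ((hedge g hg hA _ (hmaps g hg hA) rfl).2 rfl)]
    exact isUnit_edgeSign _ _
  · intro g hg hA h hh hB hne
    by_contra h0
    obtain ⟨z, hz⟩ := c_ne_zero h0
    have := hz.eq hA (Label.eq_B_of_ne hB)
    subst this
    exact hne (Prod.ext hz.2.1 ((hedge g hg hA h hh hz.2.1).1 hz.2.2))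

/-- Separating an isolated circle of sign `1` from another circle gives an acyclic complex. -/
theorem exactAt_split {R : Set (State V X)} (hK : (C.cx.res R).IsComplex) {x : X} (hx : x ∈ C.free)
    (cond : Set (X → Label)) (hcond : ∀ s l, Function.update s x l ∈ cond ↔ s ∈ cond)
    {O : Set V} {o q : V} (hq : q ∉ O)
    (hR : ∀ g : State V X, g ∈ R ↔ g.1 ∈ cond ∧ (g.1 x = Label.B → g.2 o = 1))
    (hO : ∀ s ∈ cond, C.Adm s → s x = Label.B → IsClass (C.part s) O o)
    (hglue : ∀ s ∈ cond, C.Adm s → s x = Label.A →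
      C.part s = glue (C.part (Function.update s x Label.B)) o q)
    (a b : ℤ) : (C.cx.res R).ExactAt a b := by
  classical
  have hO' : ∀ s ∈ cond, C.Adm s → s x = Label.A →
      IsClass (C.part (Function.update s x Label.B)) O o := fun s hs h1 _ =>
    hO _ ((hcond _ _).2 hs) (h1.update_free hx _) (Function.update_self ..)
  -- Only the summand with sign `1` on the new circle is present, so each state with label `B` at
  -- `x` has exactly one source along `x`.
  have hedge : ∀ g ∈ (C.cx.res R).T, g.1 x = Label.A → ∀ h ∈ (C.cx.res R).T,
      h.1 = Function.update g.1 x Label.B → (Edge (C.part g.1) (C.part h.1) g.2 h.2 ↔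
        g.2 = put O (h.2 q) h.2) := by
    rintro g ⟨⟨h1, h2⟩, h3⟩ hA h ⟨⟨h1', h2'⟩, h3'⟩ hh
    obtain ⟨h4, h5⟩ := (hR g).1 h3
    obtain ⟨h4', h5'⟩ := (hR h).1 h3'
    have hB : h.1 x = Label.B := by rw [hh, Function.update_self]
    rw [hglue _ h4 h1 hA, ← hh] at h2 ⊢
    exact (hO _ h4' h1' hB).edge_split_iff hq h2 h2' (h5' hB)
  have hmaps : ∀ g ∈ (C.cx.res R).T, g.1 x = Label.A →
      (Function.update g.1 x Label.B, put O 1 g.2) ∈ (C.cx.res R).T := by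
    rintro g ⟨⟨h1, h2⟩, h3⟩ hA
    obtain ⟨h4, h5⟩ := (hR g).1 h3
    have h6 := hO' _ h4 h1 hA
    rw [hglue _ h4 h1 hA] at h2
    exact ⟨⟨h1.update_free hx _, h6.compat_put (h2.mono (le_glue _ _ _)) _⟩,
      (hR _).2 ⟨(hcond _ _).2 h4, fun _ => put_mem h6.mem ..⟩⟩
  have hput : ∀ g ∈ (C.cx.res R).T, g.1 x = Label.A → put O (put O 1 g.2 q) (put O 1 g.2) = g.2 := by
    rintro g ⟨⟨h1, h2⟩, h3⟩ hA
    obtain ⟨h4, h5⟩ := (hR g).1 h3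
    rw [hglue _ h4 h1 hA] at h2
    rw [put_put, put_notMem hq, (hO' _ h4 h1 hA).put_eq h2]
  refine BasedComplex.exactAt_of_matching hK {g | g.1 x = Label.A}
    (fun g => (Function.update g.1 x Label.B, put O 1 g.2)) ⟨?_, ?_, ?_⟩ ?_ ?_ a b
  · rintro g ⟨h1, h2⟩
    refine ⟨hmaps g h1 h2, ?_⟩
    simp
  · rintro g ⟨h1, hA⟩ g' ⟨h1', hA'⟩ he
    obtain ⟨e1, e2⟩ := Prod.mk.inj he
    have e3 := congrArg (fun s => Function.update s x Label.A) e1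
    simp only [update_update_eq (show g.1 x = Label.A from hA),
      update_update_eq (show g'.1 x = Label.A from hA')] at e3
    refine Prod.ext e3 ?_
    rw [← hput g h1 hA, ← hput g' h1' hA', e2]
  · rintro ⟨s, ε⟩ ⟨⟨⟨h1, h2⟩, h3⟩, hB⟩
    have hB' : s x = Label.B := Label.eq_B_of_ne hB
    obtain ⟨h4, h5⟩ := (hR _).1 h3
    have c1 : Function.update s x Label.A ∈ cond := (hcond _ _).2 h4
    have c2 : C.Adm (Function.update s x Label.A) := Adm.update_free hx h1 _
    have hA : Function.update s x Label.A x = Label.A := Function.update_self ..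
    have h6 := hO _ h4 h1 hB'
    have hg := hglue _ c1 c2 hA
    rw [update_update_eq hB'] at hg
    refine ⟨(Function.update s x Label.A, put O (ε q) ε), ⟨⟨⟨c2, ?_⟩, (hR _).2 ⟨c1, fun h => ?_⟩⟩,
      hA⟩, ?_⟩
    · change Compat (C.part (Function.update s x Label.A)) _
      rw [hg]
      exact h6.compat_merge hq h2
    · simp at h
    · refine Prod.ext (update_update_eq hB' _) ?_
      change put O 1 (put O (ε q) ε) = ε
      rw [put_put, h6.put_self h2 (h5 hB')]
  · intro g hg hA
    change IsUnit (C.cx.c _ _)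
    rw [c_eq hA rfl, if_pos ((hedge g hg hA _ (hmaps g hg hA) rfl).2 (hput g hg hA).symm)]
    exact isUnit_edgeSign _ _
  · intro g hg hA h hh hB hne
    by_contra h0
    obtain ⟨z, hz⟩ := c_ne_zero h0
    have hB' : h.1 x = Label.B := Label.eq_B_of_ne hB
    have := hz.eq hA hB'
    subst this
    refine hne (Prod.ext hz.2.1 ?_)
    have h1 := (hedge g hg hA h hh hz.2.1).1 hz.2.2
    obtain ⟨h4, h5⟩ := (hR _).1 hh.2
    change h.2 = put O 1 g.2
    rw [h1, put_put, (hO _ h4 hh.1.1 hB').put_self hh.1.2 (h5 hB')]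

/-- A kink whose `B`-smoothing splits off a circle. -/
theorem kink_split (hC : C.Elementary) {x : X} (hx : x ∈ C.free) {O : Set V} {o q : V} (hq : q ∉ O)
    (hO : ∀ s, C.Adm s → s x = Label.B → IsClass (C.part s) O o)
    (hglue : ∀ s, C.Adm s → s x = Label.A →
      C.part s = glue (C.part (Function.update s x Label.B)) o q) (a b : ℤ) :
    Nonempty (C.cx.H a b ≃+ (C.freeze x Label.A).cx.H (a + 1) (b + 3)) := by
  have hK := hC.isComplex
  -- `S` is the half of the `B` face in which the split circle has sign `-1`. Its complement, the
  -- `A` face with the other half, is acyclic because splitting off X is a bijection.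
  set S : Set (State V X) := {g | g.1 x = Label.B ∧ g ∈ {g : State V X | g.2 o = -1}} with hS
  have hcl : C.cx.ClosedIn S := by
    rintro g hg ⟨h1, h2⟩ h hh hc
    obtain ⟨z, hz⟩ := c_ne_zero hc
    have hzx : z ≠ x := by
      rintro rfl; rw [hz.label_A] at h1; cases h1
    have h3 : h.1 x = Label.B := by rw [hz.label_ne hzx.symm, h1]
    refine ⟨h3, ?_⟩
    change h.2 o = -1
    rw [← hz.2.2.sign_eq_of_isClass (hO _ hg.1 h1) (hO _ hh.1 h3)]
    exact h2
  have hex : ∀ a b, (C.cx.res Sᶜ).ExactAt a b := by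
    refine exactAt_split (hK.res_quo hcl) hx Set.univ (by simp) hq ?_ (fun s _ => hO s)
      fun s _ => hglue s
    intro g
    simp only [hS, Set.mem_compl_iff, Set.mem_ofPred_eq, not_and, Set.mem_univ, true_and]
    refine forall_congr' fun _ => ?_
    rcases unit_cases (g.2 o) with h | h <;> simp [h]
  obtain ⟨e1⟩ := BasedComplex.nonempty_equiv_sub hK hcl (hex a b) (hex (a + 2) b)
  obtain ⟨e2⟩ := freeze_equiv hx Label.B {g : State V X | g.2 o = -1} (fun _ => Iff.rfl) a b
  obtain ⟨e3⟩ := blob_equiv (C := C.freeze x Label.B) (C' := C.freeze x Label.A) rfl hq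
    (fun s hs => hO _ ((adm_freeze hx).1 hs).2 (Function.update_self ..)) (fun s hs => by
      obtain ⟨h1, h2⟩ := (adm_freeze hx).1 hs
      have := hglue (Function.update s x Label.A) (by
        have := h2.update_free hx Label.A
        rwa [Function.update_idem] at this) (Function.update_self ..)
      rwa [Function.update_idem] at this) (-1) (a + 1) (b + 1)
  -- Smoothing shifts both degrees by `1`. Absorbing a circle of sign `-1` raises `b` by a further
  -- `2`.
  have e4 : b + 1 - 2 * ((-1 : ℤˣ) : ℤ) = b + 3 := by push_cast; ring
  rw [e4] at e3
  exact ⟨(e1.symm.trans e2).trans e3⟩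

/-- A kink whose `A`-smoothing splits off a circle. -/
theorem kink_merge (hC : C.Elementary) {x : X} (hx : x ∈ C.free) {O : Set V} {o q : V} (hq : q ∉ O)
    (hO : ∀ s, C.Adm s → s x = Label.A → IsClass (C.part s) O o)
    (hglue : ∀ s, C.Adm s → s x = Label.A →
      C.part (Function.update s x Label.B) = glue (C.part s) o q) (a b : ℤ) :
    Nonempty (C.cx.H a b ≃+ (C.freeze x Label.B).cx.H (a - 1) (b - 3)) := by
  have hK := hC.isComplex
  -- `S` consists of the `B` face and the half of the `A` face in which the isolated circle is the
  -- unit. These cancel, and the states with label `A` and sign `1` remain.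
  set S : Set (State V X) := {g | g.1 x = Label.A → g.2 o = -1} with hS
  have hcl : C.cx.ClosedIn S := by
    rintro g hg h2 h hh hc h1
    obtain ⟨z, hz⟩ := c_ne_zero hc
    have hzx : z ≠ x := by
      rintro rfl; rw [hz.label_B] at h1; cases h1
    have h3 : g.1 x = Label.A := by rw [← hz.label_ne hzx.symm, h1]
    rw [← hz.2.2.sign_eq_of_isClass (hO _ hg.1 h3) (hO _ hh.1 h1)]
    exact h2 h3
  have hex : ∀ a b, (C.cx.res S).ExactAt a b :=
    exactAt_merge (hK.res_sub hcl) hx Set.univ (by simp) hq (fun g => by simp [hS])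
      (fun s _ => hO s) fun s _ => hglue s
  obtain ⟨e1⟩ := BasedComplex.nonempty_equiv_quo hK hcl (hex a b) (hex (a - 2) b)
  have hSc : C.cx.res Sᶜ = C.cx.res {g | g.1 x = Label.A ∧ g ∈ {g : State V X | g.2 o = 1}} := by
    refine BasedComplex.res_congr fun g _ => ?_
    simp only [hS, Set.mem_compl_iff, Set.mem_ofPred_eq, Classical.not_imp]
    refine and_congr_right fun _ => ?_
    rcases unit_cases (g.2 o) with h | h <;> simp [h]
  rw [hSc] at e1
  obtain ⟨e2⟩ := freeze_equiv hx Label.A {g : State V X | g.2 o = 1} (fun _ => Iff.rfl) a b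
  obtain ⟨e3⟩ := blob_equiv (C := C.freeze x Label.A) (C' := C.freeze x Label.B) rfl hq
    (fun s hs => hO _ ((adm_freeze hx).1 hs).2 (Function.update_self ..)) (fun s hs => by
      obtain ⟨h1, h2⟩ := (adm_freeze hx).1 hs
      have := hglue _ h2 (Function.update_self ..)
      rwa [Function.update_idem] at this) 1 (a + -1) (b + -1)
  have e4 : b + -1 - 2 * ((1 : ℤˣ) : ℤ) = b - 3 := by push_cast; ring
  rw [e4, ← sub_eq_add_neg] at e3
  exact ⟨(e1.trans e2).trans e3⟩

/-- The second Reidemeister move: two crossings `x`, `y` such that a circle splits off when they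
have the labels `A`, `B`. -/
theorem reidemeister_two (hC : C.Elementary) {x y : X} (hxy : x ≠ y) (hx : x ∈ C.free)
    (hy : y ∈ C.free) {O : Set V} {o q q' : V} (hq : q ∉ O) (hq' : q' ∉ O)
    (hO : ∀ s, C.Adm s → s x = Label.A → s y = Label.B → IsClass (C.part s) O o)
    (hglue : ∀ s, C.Adm s → s x = Label.A → s y = Label.B →
      C.part (Function.update s x Label.B) = glue (C.part s) o q)
    (hglue' : ∀ s, C.Adm s → s x = Label.A → s y = Label.A →
      C.part s = glue (C.part (Function.update s y Label.B)) o q') (a b : ℤ) :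
    Nonempty (C.cx.H a b ≃+ ((C.freeze x Label.B).freeze y Label.A).cx.H a b) := by
  have hK := hC.isComplex
  -- First cancellation: among states with label `B` at `y`, merging the isolated circle with sign
  -- `-1` at `x` is a bijection, so `S` is acyclic.
  set S : Set (State V X) := {g | g.1 y = Label.B ∧ (g.1 x = Label.A → g.2 o = -1)} with hS
  have hcl : C.cx.ClosedIn S := by
    rintro g hg ⟨h1, h2⟩ h hh hc
    obtain ⟨z, hz⟩ := c_ne_zero hc
    have hzy : z ≠ y := by
      rintro rfl; rw [hz.label_A] at h1; cases h1
    have h1' : h.1 y = Label.B := by rw [hz.label_ne hzy.symm, h1]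
    refine ⟨h1', fun h3 => ?_⟩
    have hzx : z ≠ x := by
      rintro rfl; rw [hz.label_B] at h3; cases h3
    have h3' : g.1 x = Label.A := by rw [← hz.label_ne hzx.symm, h3]
    rw [← hz.2.2.sign_eq_of_isClass (hO _ hg.1 h3' h1) (hO _ hh.1 h3 h1')]
    exact h2 h3'
  have hex : ∀ a b, (C.cx.res S).ExactAt a b :=
    exactAt_merge (hK.res_sub hcl) hx {s | s y = Label.B}
      (fun s l => by simp [Function.update_of_ne hxy.symm]) hq (fun g => Iff.rfl)
      (fun s h1 h2 h3 => hO s h2 h3 h1) fun s h1 h2 h3 => hglue s h2 h3 h1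
  obtain ⟨e1⟩ := BasedComplex.nonempty_equiv_quo hK hcl (hex a b) (hex (a - 2) b)
  have hK1 := hK.res_quo hcl
  -- Second cancellation: in the quotient nothing remains with both labels `B`, so the face `B`, `A`
  -- is a subcomplex. Its complement has label `A` at `x` and cancels along `y` by splitting off a
  -- circle of sign `1`.
  set S' : Set (State V X) := {g | g.1 x = Label.B ∧ g ∈ {g : State V X | g.1 y = Label.A}} with hS'
  have hcl' : (C.cx.res Sᶜ).ClosedIn S' := by
    rintro g hg ⟨h1, h2⟩ h ⟨hh, hhS⟩ hc
    obtain ⟨z, hz⟩ := c_ne_zero (show C.cx.c g h ≠ 0 from hc)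
    have hzx : z ≠ x := by
      rintro rfl; rw [hz.label_A] at h1; cases h1
    have h1' : h.1 x = Label.B := by rw [hz.label_ne hzx.symm, h1]
    refine ⟨h1', ?_⟩
    by_contra h3
    refine hhS ⟨Label.eq_B_of_ne h3, fun h4 => ?_⟩
    rw [h1'] at h4; cases h4
  have hset : ∀ g ∈ C.cx.T, g ∈ Sᶜ ∩ S'ᶜ ↔
      g.1 ∈ {s : X → Label | s x = Label.A} ∧ (g.1 y = Label.B → g.2 o = 1) := by
    intro g hg
    simp only [hS, hS', Set.mem_inter_iff, Set.mem_compl_iff, Set.mem_ofPred_eq]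
    rcases hgx : g.1 x <;> rcases hgy : g.1 y <;> rcases unit_cases (g.2 o) with h | h <;> simp [h]
  have hres : (C.cx.res Sᶜ).res S'ᶜ =
      C.cx.res {g | g.1 ∈ {s : X → Label | s x = Label.A} ∧ (g.1 y = Label.B → g.2 o = 1)} := by
    rw [BasedComplex.res_res]
    exact BasedComplex.res_congr hset
  have hex' : ∀ a b, ((C.cx.res Sᶜ).res S'ᶜ).ExactAt a b := by
    have h1 := hK1.res_quo hcl'
    rw [hres] at h1 ⊢
    exact exactAt_split h1 hy {s | s x = Label.A}
      (fun s l => by simp [Function.update_of_ne hxy]) hq' (fun g => Iff.rfl)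
      (fun s h1 h2 h3 => hO s h2 h1 h3) fun s h1 h2 h3 => hglue' s h2 h1 h3
  obtain ⟨e2⟩ := BasedComplex.nonempty_equiv_sub hK1 hcl' (hex' a b) (hex' (a + 2) b)
  have hres2 : (C.cx.res Sᶜ).res S' = C.cx.res S' := by
    rw [BasedComplex.res_res]
    refine BasedComplex.res_congr fun g _ => ?_
    simp only [hS, hS', Set.mem_inter_iff, Set.mem_compl_iff, Set.mem_ofPred_eq]
    rcases hgx : g.1 x <;> rcases hgy : g.1 y <;> simp
  rw [hres2] at e2
  obtain ⟨e3⟩ := freeze_equiv hx Label.B {g : State V X | g.1 y = Label.A}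
    (fun g => by simp [Function.update_of_ne hxy.symm]) a b
  have hy' : y ∈ (C.freeze x Label.B).free := ⟨hy, hxy.symm⟩
  obtain ⟨e4⟩ := freeze_equiv hy' Label.A Set.univ (fun g => by simp) (a + 1) (b + 1)
  have hres3 : (C.freeze x Label.B).cx.res {g : State V X | g.1 y = Label.A} =
      (C.freeze x Label.B).cx.res {g : State V X | g.1 y = Label.A ∧ g ∈ Set.univ} := by
    simp
  have hres4 : ((C.freeze x Label.B).freeze y Label.A).cx.res Set.univ =
      ((C.freeze x Label.B).freeze y Label.A).cx := BasedComplex.res_eq_self fun _ _ => trivial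
  rw [← hres3, hres4] at e4
  have e5 : ∀ a : ℤ, a + 1 + labelShift Label.A = a := fun a => by simp [labelShift]
  rw [e5, e5] at e4
  exact ⟨(e1.trans e2.symm).trans (e3.trans e4)⟩

/-- The long exact sequence of a crossing: the part of the basis with label `B`. -/
theorem closedIn_label_B (x : X) : C.cx.ClosedIn {g : State V X | g.1 x = Label.B} := by
  rintro g hg h1 h hh hc
  obtain ⟨z, hz⟩ := c_ne_zero hc
  have hzx : z ≠ x := by
    rintro rfl; rw [Set.mem_ofPred_eq, hz.label_A] at h1; cases h1
  change h.1 x = _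
  rw [hz.label_ne hzx.symm]
  exact h1

theorem face_equiv {x : X} (hx : x ∈ C.free) (l : Label) (a b : ℤ) :
    Nonempty ((C.cx.res {g | g.1 x = l}).H a b ≃+
      (C.freeze x l).cx.H (a + labelShift l) (b + labelShift l)) := by
  have := freeze_equiv hx l Set.univ (fun g => by simp) a b
  rw [BasedComplex.res_eq_self (K := (C.freeze x l).cx) (S := Set.univ) (fun _ _ => trivial)] at this
  rwa [BasedComplex.res_congr (S' := {g | g.1 x = l}) fun g _ => by simp] at this

end Cube
end Khovanov

namespace Khovanov

/-! ## Change of points and crossings -/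

section Partition

variable {V V' : Type} {P Q : Setoid V} {P' Q' : Setoid V'} {f : V' → V}

theorem Compat.comp (hP : ∀ v w, P' v w ↔ P (f v) (f w)) {ε : V → ℤˣ} (hε : Compat P ε) :
    Compat P' (ε ∘ f) := fun _ _ h => hε _ _ ((hP _ _).1 h)

theorem tau_comp [Fintype V] [Fintype V'] (hP : ∀ v w, P' v w ↔ P (f v) (f w))
    (hit : ∀ v, ∃ v', P v (f v')) {ε : V → ℤˣ} (hε : Compat P ε) :
    tau P' (ε ∘ f) = tau P ε := by
  classical
  unfold tau
  refine Finset.sum_bij (fun c _ => Quotient.mk P (f c.out)) (fun _ _ => Finset.mem_univ _)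
    ?_ ?_ ?_
  · intro c _ c' _ h
    have := (hP _ _).2 (Quotient.exact h)
    rw [← Quotient.out_eq c, ← Quotient.out_eq c']
    exact Quotient.sound this
  · intro c _
    obtain ⟨v', hv'⟩ := hit c.out
    refine ⟨Quotient.mk P' v', Finset.mem_univ _, ?_⟩
    rw [← Quotient.out_eq c]
    refine Quotient.sound (P.trans ?_ (P.symm hv'))
    exact (hP _ _).1 (Quotient.mk_out v')
  · intro c _
    rw [Function.comp_apply, hε]
    exact P.symm (Quotient.mk_out (f c.out))

/-- A representative of `u` for the finer of the two partitions also represents it for the coarser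
one. This is why comparability is required. -/
theorem sameClass_comp (hP : ∀ v w, P' v w ↔ P (f v) (f w)) (hQ : ∀ v w, Q' v w ↔ Q (f v) (f w))
    (hitP : ∀ v, ∃ v', P v (f v')) (hitQ : ∀ v, ∃ v', Q v (f v')) (hPQ : P ≤ Q ∨ Q ≤ P) (v : V') :
    SameClass P' Q' v ↔ SameClass P Q (f v) := by
  constructor
  · intro h u
    rcases hPQ with hPQ | hPQ
    · refine ⟨fun h' => hPQ h', fun h' => ?_⟩
      obtain ⟨u', hu'⟩ := hitP u
      have h1 : Q (f v) (f u') := Q.trans h' (hPQ hu')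
      exact P.trans ((hP _ _).1 ((h u').2 ((hQ _ _).2 h1))) (P.symm hu')
    · refine ⟨fun h' => ?_, fun h' => hPQ h'⟩
      obtain ⟨u', hu'⟩ := hitQ u
      have h1 : P (f v) (f u') := P.trans h' (hPQ hu')
      exact Q.trans ((hQ _ _).1 ((h u').1 ((hP _ _).2 h1))) (Q.symm hu')
  · intro h u
    rw [hP, hQ]
    exact h _

theorem edge_comp [Fintype V] [Fintype V'] (hP : ∀ v w, P' v w ↔ P (f v) (f w))
    (hQ : ∀ v w, Q' v w ↔ Q (f v) (f w))
    (hitP : ∀ v, ∃ v', P v (f v')) (hitQ : ∀ v, ∃ v', Q v (f v')) (hPQ : P ≤ Q ∨ Q ≤ P)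
    {ε ε' : V → ℤˣ} (hε : Compat P ε) (hε' : Compat Q ε') :
    Edge P' Q' (ε ∘ f) (ε' ∘ f) ↔ Edge P Q ε ε' := by
  unfold Edge
  rw [tau_comp hP hitP hε, tau_comp hQ hitQ hε']
  refine and_congr_right fun _ => ?_
  simp only [sameClass_comp hP hQ hitP hitQ hPQ]
  constructor
  · intro h v hv
    obtain ⟨v', hv'⟩ := hitP v
    have h1 : SameClass P Q (f v') := by
      intro u
      constructor
      · intro h2
        exact Q.trans (Q.symm ((hv _).1 hv')) ((hv u).1 (P.trans hv' h2))
      · intro h2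
        exact P.trans (P.symm hv') ((hv u).2 (Q.trans ((hv _).1 hv') h2))
    rw [hε _ _ hv', hε' _ _ ((hv _).1 hv')]
    exact h v' h1
  · intro h v hv
    exact h _ hv

theorem IsSaddle.comparable [Fintype V] {p q : V} (h : IsSaddle P Q p q) : P ≤ Q ∨ Q ≤ P :=
  h.imp IsMerge.le IsMerge.le

end Partition

/-! ### Dependence of the signs on the order of the crossings -/

section Sign

variable {X X' : Type} [Fintype X] [LinearOrder X] [Fintype X'] [LinearOrder X']

open Classical in
theorem edgeSign_eq_prod (s : X → Label) (x : X) :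
    edgeSign s x = ((∏ y, if x < y ∧ s y = Label.B then -1 else 1 : ℤˣ) : ℤ) := by
  unfold edgeSign
  rw [Finset.prod_ite, Finset.prod_const_one, mul_one, Finset.prod_const]
  push_cast
  rfl

open Classical in
/-- The sign of the change of the order of the crossings. -/
noncomputable def orderSign (ι : X' → X) (s : X' → Label) : ℤˣ :=
  ∏ x, ∏ y, if x < y ∧ ι y < ι x ∧ s x = Label.B ∧ s y = Label.B then -1 else 1

/-- The two edge signs differ by the `B`-labelled crossings that form an inversion of `ι` with `z`.
`orderSign` counts all inversions among `B` labels, so its quotient along the edge counts exactly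
these. -/
theorem edgeSign_comp {ι : X' → X} (hι : Function.Injective ι) {s : X → Label}
    (hs : ∀ x, s x = Label.B → x ∈ Set.range ι) {z : X'} (hz : s (ι z) = Label.A) :
    edgeSign (s ∘ ι) z = orderSign ι (s ∘ ι) * orderSign ι (Function.update (s ∘ ι) z Label.B) *
      edgeSign s (ι z) := by
  classical
  have e1 : edgeSign s (ι z) =
      ((∏ y, if ι z < ι y ∧ (s ∘ ι) y = Label.B then -1 else 1 : ℤˣ) : ℤ) := by
    rw [edgeSign_eq_prod]
    congr 1
    refine (Finset.prod_of_injOn ι hι.injOn (by simp) ?_ (fun _ _ => rfl)).symm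
    intro x _ hx
    refine if_neg fun h => hx ?_
    obtain ⟨y, rfl⟩ := hs x h.2
    simp
  set t := s ∘ ι with ht
  have hzt : t z = Label.A := hz
  have e2 : orderSign ι (Function.update t z Label.B) = orderSign ι t *
      ((∏ y, if z < y ∧ ι y < ι z ∧ t y = Label.B then -1 else 1) *
        ∏ x, if x < z ∧ ι z < ι x ∧ t x = Label.B then -1 else 1) := by
    unfold orderSign
    have : ∀ x y, (if x < y ∧ ι y < ι x ∧ Function.update t z Label.B x = Label.B ∧
        Function.update t z Label.B y = Label.B then -1 else 1 : ℤˣ) =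
        (if x < y ∧ ι y < ι x ∧ t x = Label.B ∧ t y = Label.B then -1 else 1) *
        ((if x = z then (if z < y ∧ ι y < ι z ∧ t y = Label.B then -1 else 1) else 1) *
        (if y = z then (if x < z ∧ ι z < ι x ∧ t x = Label.B then -1 else 1) else 1)) := by
      intro x y
      by_cases hx : x = z
      · subst hx
        by_cases hy : y = x
        · subst hy; simp
        · simp [hy, hzt]
      · by_cases hy : y = z
        · subst hy; simp [hx, hzt]
        · simp [hx, hy]
    simp only [this, Finset.prod_mul_distrib]
    congr 2
    · rw [Finset.prod_comm]
      exact Finset.prod_congr rfl fun y _ => by rw [Finset.prod_ite_eq']; simp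
    · exact Finset.prod_congr rfl fun x _ => by rw [Finset.prod_ite_eq']; simp
  rw [e1, edgeSign_eq_prod, ← Units.val_mul, ← Units.val_mul, e2, ← mul_assoc, ← mul_assoc,
    Int.units_mul_self, one_mul, ← Finset.prod_mul_distrib, ← Finset.prod_mul_distrib]
  congr 1
  refine Finset.prod_congr rfl fun y _ => ?_
  by_cases hB : t y = Label.B
  · have hyz : y ≠ z := by
      rintro rfl; rw [hzt] at hB; cases hB
    have hιyz : ι y ≠ ι z := fun h => hyz (hι h)
    rcases lt_or_gt_of_ne hyz with h | h <;> rcases lt_or_gt_of_ne hιyz with h' | h' <;>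
      simp [hB, h, h', not_lt.2 h.le, not_lt.2 h'.le]
  · simp [hB]

end Sign

namespace Cube

variable {V X V' X' : Type} [Fintype V] [Fintype X] [LinearOrder X] [Fintype V'] [Fintype X']
  [LinearOrder X'] {C : Cube V X} {C' : Cube V' X'}

/-- Only the partition of sampled points matters: if every class meets the image of `f`, sign
functions on the classes correspond to each other. The crossings may be reordered, at the price of
the sign `orderSign`. -/
theorem compare (hC : C.Elementary) (ι : X' → X) (hι : Function.Injective ι)
    (hfree : ∀ x, x ∈ C'.free ↔ ι x ∈ C.free) (hrange : ∀ x ∈ C.free, x ∈ Set.range ι)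
    (f : V' → V) (hP : ∀ s, C.Adm s → ∀ v w, C'.part (s ∘ ι) v w ↔ C.part s (f v) (f w))
    (hit : ∀ s, C.Adm s → ∀ v, ∃ v', C.part s v (f v')) (a b : ℤ) :
    Nonempty (C.cx.H a b ≃+ C'.cx.H a b) := by
  classical
  have hB : ∀ s, C.Adm s → ∀ x, s x = Label.B → x ∈ Set.range ι := by
    intro s hs x hx
    refine hrange x ?_
    by_contra h
    rw [hs x h] at hx; cases hx
  have hadm : ∀ s, C.Adm s → C'.Adm (s ∘ ι) := fun s hs x hx => hs _ fun h => hx ((hfree x).2 h)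
  have ha : ∀ g : State V X, C'.cx.a (g.1 ∘ ι, g.2 ∘ f) = C.cx.a g := by
    intro g
    rw [a_def, a_def]
    refine Finset.sum_of_injOn ι hι.injOn (by simp) ?_ ?_
    · intro x _ hx
      refine if_neg fun h => hx ?_
      obtain ⟨y, rfl⟩ := hrange x h
      simp
    · intro x _
      simp only [hfree, Function.comp_apply]
  have := BasedComplex.nonempty_equiv_of_bijOn (K := C.cx) (K' := C'.cx)
    (fun g => (g.1 ∘ ι, g.2 ∘ f)) ⟨?_, ?_, ?_⟩ (fun g => orderSign ι (g.1 ∘ ι)) 0 0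
    (fun g _ => by rw [add_zero]; exact ha g) ?_ ?_ a b
  · rwa [add_zero, add_zero] at this
  · rintro g ⟨h1, h2⟩
    exact ⟨hadm _ h1, h2.comp (hP _ h1)⟩
  · rintro ⟨s, ε⟩ ⟨h1, h2⟩ ⟨s', ε'⟩ ⟨h1', h2'⟩ h
    obtain ⟨e1, e2⟩ := Prod.mk.inj h
    have hs : s = s' := by
      funext x
      by_cases hx : x ∈ C.free
      · obtain ⟨y, rfl⟩ := hrange x hx
        exact congrFun e1 y
      · exact (h1 x hx).trans (h1' x hx).symm
    subst hs
    refine Prod.ext rfl (funext fun v => ?_)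
    obtain ⟨v', hv'⟩ := hit s h1 v
    change ε v = ε' v
    exact (h2 _ _ hv').trans ((congrFun e2 v').trans (h2' _ _ hv').symm)
  · rintro ⟨s', ε'⟩ ⟨h1, h2⟩
    -- Crossings outside the range of `ι` are not free, so the label `A` is forced there.
    let s : X → Label := fun x => if h : ∃ y, ι y = x then s' h.choose else Label.A
    have hs : s ∘ ι = s' := by
      funext y
      have h : ∃ y', ι y' = ι y := ⟨y, rfl⟩
      have : s (ι y) = s' h.choose := dif_pos h
      rw [Function.comp_apply, this, hι h.choose_spec]
    have hsA : C.Adm s := by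
      intro x hx
      by_cases h : ∃ y, ι y = x
      · obtain ⟨y, rfl⟩ := h
        have : s (ι y) = s' y := congrFun hs y
        rw [this]
        exact h1 y fun h => hx ((hfree y).1 h)
      · exact dif_neg h
    choose v' hv' using hit s hsA
    change Compat (C'.part s') ε' at h2
    rw [← hs] at h2
    refine ⟨(s, fun v => ε' (v' v)), ⟨hsA, fun v w hvw => ?_⟩, ?_⟩
    · refine h2 _ _ ((hP s hsA _ _).2 ?_)
      exact (C.part s).trans ((C.part s).symm (hv' v)) ((C.part s).trans hvw (hv' w))
    · refine Prod.ext hs (funext fun v => ?_)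
      exact h2 _ _ ((hP s hsA _ _).2 ((C.part s).symm (hv' (f v))))
  · rintro g ⟨h1, h2⟩
    rw [b_def, b_def, ha, add_zero]
    change _ + 2 * tau (C'.part (g.1 ∘ ι)) (g.2 ∘ f) = _
    rw [tau_comp (hP _ h1) (hit _ h1) h2]
  · rintro g ⟨h1, h2⟩ h ⟨h1', h2'⟩
    have step : ∀ z, ι z ∈ C.free → (C'.Step (g.1 ∘ ι, g.2 ∘ f) (h.1 ∘ ι, h.2 ∘ f) z ↔
        C.Step g h (ι z)) := by
      intro z hz
      unfold Step
      refine and_congr_right fun hA => ?_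
      have hA' : g.1 (ι z) = Label.A := hA
      have e1 : h.1 ∘ ι = Function.update (g.1 ∘ ι) z Label.B ↔
          h.1 = Function.update g.1 (ι z) Label.B := by
        constructor
        · intro he
          funext x
          by_cases hx : x ∈ C.free
          · obtain ⟨y, rfl⟩ := hrange x hx
            have := congrFun he y
            by_cases hyz : y = z
            · subst hyz
              rw [Function.update_self] at this ⊢
              exact this
            · rw [Function.update_of_ne hyz] at this
              rw [Function.update_of_ne fun h => hyz (hι h)]
              exact this
          · rw [Function.update_of_ne (fun h => hx (by rw [h]; exact hz)), h1 x hx, h1' x hx]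
        · intro he
          rw [he]
          funext y
          by_cases hyz : y = z
          · subst hyz
            simp
          · simp [hyz, hι.eq_iff]
      rw [e1]
      refine and_congr_right fun he => ?_
      refine edge_comp (hP _ h1) (hP _ h1') (hit _ h1) (hit _ h1') ?_ h2 h2'
      obtain ⟨p, q, hpq⟩ := hC _ hz
      rw [he]
      exact (hpq _ hA').comparable
    by_cases hs : ∃ x, C.Step g h x
    · obtain ⟨x, hx⟩ := hs
      have hxf := hx.mem_free ⟨h1', h2'⟩
      obtain ⟨z, rfl⟩ := hrange x hxf
      have hz := (step z hxf).2 hx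
      rw [hx.c_eq, hz.c_eq]
      change edgeSign (g.1 ∘ ι) z = _
      rw [edgeSign_comp hι (hB _ h1) hx.1, ← show h.1 ∘ ι = _ from hz.2.1]
    · have e1 : C.cx.c g h = 0 := by
        by_contra h0; exact hs (c_ne_zero h0)
      have e2 : C'.cx.c (g.1 ∘ ι, g.2 ∘ f) (h.1 ∘ ι, h.2 ∘ f) = 0 := by
        by_contra h0
        obtain ⟨z, hz⟩ := c_ne_zero h0
        have hzf : z ∈ C'.free := hz.mem_free ⟨hadm _ h1', h2'.comp (hP _ h1')⟩
        exact hs ⟨ι z, (step z ((hfree z).1 hzf)).1 hz⟩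
      rw [e1, e2, mul_zero]

end Cube
end Khovanov

namespace Khovanov

/-! ## Orbits of permutations -/

section Orbits

variable {V : Type} [Fintype V] [DecidableEq V]

/-- The partition into orbits of a permutation. -/
def orbits (π : Equiv.Perm V) : Setoid V := Equiv.Perm.SameCycle.setoid π

theorem orbits_apply (π : Equiv.Perm V) (v : V) : orbits π v (π v) :=
  Equiv.Perm.sameCycle_apply_right.2 (Equiv.Perm.SameCycle.refl π v)

theorem orbits_le {π : Equiv.Perm V} {S : Setoid V} (h : ∀ v, S v (π v)) : orbits π ≤ S := by
  intro v w hvw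
  obtain ⟨n, rfl⟩ := Equiv.Perm.SameCycle.exists_nat_pow_eq (show π.SameCycle v w from hvw)
  induction n with
  | zero => exact S.refl v
  | succ n ih =>
    rw [pow_succ', Equiv.Perm.mul_apply]
    exact S.trans (ih ⟨n, by simp⟩) (h _)

theorem orbits_mul_swap_le (π : Equiv.Perm V) (p q : V) :
    orbits (π * Equiv.swap p q) ≤ glue (orbits π) p q := by
  refine orbits_le fun v => ?_
  have hg := glue_pair (orbits π) p q
  rw [Equiv.Perm.mul_apply]
  by_cases hp : v = p
  · subst hp
    rw [Equiv.swap_apply_left]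
    exact Setoid.trans' _ hg (Or.inl (orbits_apply π q))
  · by_cases hq : v = q
    · subst hq
      rw [Equiv.swap_apply_right]
      exact Setoid.trans' _ (Setoid.symm' _ hg) (Or.inl (orbits_apply π p))
    · rw [Equiv.swap_apply_of_ne_of_ne hp hq]
      exact Or.inl (orbits_apply π v)

theorem le_orbits_mul_swap (π : Equiv.Perm V) (p q : V) :
    orbits π ≤ glue (orbits (π * Equiv.swap p q)) p q := by
  have := orbits_mul_swap_le (π * Equiv.swap p q) p q
  rwa [mul_assoc, Equiv.swap_mul_self, mul_one] at this

/-- Multiplication by a transposition joins or cuts cycles. -/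
theorem orbits_mul_swap_iff (π : Equiv.Perm V) {p q : V} (hpq : p ≠ q) :
    orbits (π * Equiv.swap p q) p q ↔ ¬ orbits π p q := by
  set π' := π * Equiv.swap p q with hπ'
  have hq' : π' q = π p := by rw [hπ', Equiv.Perm.mul_apply, Equiv.swap_apply_right]
  have hne : ∀ v, v ≠ p → v ≠ q → π' v = π v := fun v h1 h2 => by
    rw [hπ', Equiv.Perm.mul_apply, Equiv.swap_apply_of_ne_of_ne h1 h2]
  -- Follow `p` under `π` until it first returns to `p` or `q`, after `k` steps. Up to then `π'`
  -- moves `q` along the same points. A return at `p` means that `q` was on another cycle and is now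
  -- joined to `p`; a return at `q` means that the common cycle has been cut.
  have hex : ∃ k, 0 < k ∧ ((π ^ k) p = p ∨ (π ^ k) p = q) :=
    ⟨orderOf π, orderOf_pos π, Or.inl (by rw [pow_orderOf_eq_one]; rfl)⟩
  classical
  set k := Nat.find hex with hk
  obtain ⟨hk0, hkpq⟩ := Nat.find_spec hex
  have hmin : ∀ j, 0 < j → j < k → (π ^ j) p ≠ p ∧ (π ^ j) p ≠ q := by
    intro j h0 hj
    have := Nat.find_min hex hj
    push Not at this
    exact this h0
  have hpow : ∀ j, 0 < j → j ≤ k → (π' ^ j) q = (π ^ j) p := by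
    intro j
    induction j with
    | zero => intro h; exact absurd h (lt_irrefl 0)
    | succ j ih =>
      intro _ hj
      rcases Nat.eq_zero_or_pos j with rfl | hj0
      · simpa using hq'
      · rw [pow_succ', pow_succ', Equiv.Perm.mul_apply, Equiv.Perm.mul_apply, ih hj0 (by omega)]
        exact hne _ (hmin j hj0 (by omega)).1 (hmin j hj0 (by omega)).2
  have hkk := hpow k hk0 le_rfl
  rcases hkpq with h | h
  · refine iff_of_true ?_ ?_
    · refine Setoid.symm' _ ?_
      exact ⟨k, by rw [zpow_natCast, hkk]; exact h⟩
    · intro hc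
      obtain ⟨n, hn⟩ := Equiv.Perm.SameCycle.exists_nat_pow_eq (show π.SameCycle p q from hc)
      have hmod : (π ^ (n % k)) p = q := by
        have h1 : ∀ l, (π ^ (k * l)) p = p := by
          intro l
          induction l with
          | zero => simp
          | succ l ih =>
            rw [Nat.mul_succ, pow_add, Equiv.Perm.mul_apply]
            have h' : (π ^ k) p = p := h
            rw [h', ih]
        have h2 : n = n % k + k * (n / k) := (Nat.mod_add_div n k).symm
        rw [h2, pow_add, Equiv.Perm.mul_apply, h1] at hn
        exact hn
      rcases Nat.eq_zero_or_pos (n % k) with h0 | h0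
      · rw [h0] at hmod
        exact hpq hmod
      · exact (hmin _ h0 (Nat.mod_lt _ hk0)).2 hmod
  · refine iff_of_false ?_ (not_not.2 ⟨k, by rw [zpow_natCast]; exact h⟩)
    intro hc
    obtain ⟨n, hn⟩ := Equiv.Perm.SameCycle.exists_nat_pow_eq
      (show π'.SameCycle q p from Setoid.symm' _ hc)
    have hmod : (π' ^ (n % k)) q = p := by
      have h' : (π' ^ k) q = q := hkk.trans h
      have h1 : ∀ l, (π' ^ (k * l)) q = q := by
        intro l
        induction l with
        | zero => simp
        | succ l ih => rw [Nat.mul_succ, pow_add, Equiv.Perm.mul_apply, h', ih]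
      have h2 : n = n % k + k * (n / k) := (Nat.mod_add_div n k).symm
      rw [h2, pow_add, Equiv.Perm.mul_apply, h1] at hn
      exact hn
    rcases Nat.eq_zero_or_pos (n % k) with h0 | h0
    · rw [h0] at hmod
      exact hpq hmod.symm
    · have hlt := Nat.mod_lt n hk0
      rw [hpow _ h0 hlt.le] at hmod
      exact (hmin _ h0 hlt).1 hmod

/-- Each of the two partitions is contained in the other one glued at `p, q`. By
`orbits_mul_swap_iff` the points are together in exactly one of them, and that one is the glued
partition. -/
theorem isSaddle_orbits (π : Equiv.Perm V) {p q : V} (hpq : p ≠ q) :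
    IsSaddle (orbits π) (orbits (π * Equiv.swap p q)) p q := by
  have h := orbits_mul_swap_iff π hpq
  by_cases h1 : orbits π p q
  · refine Or.inr ⟨fun h2 => h.1 h2 h1, le_antisymm (le_orbits_mul_swap π p q) ?_⟩
    exact glue_le ((orbits_mul_swap_le π p q).trans (glue_le le_rfl h1)) h1
  · refine Or.inl ⟨h1, le_antisymm (orbits_mul_swap_le π p q) ?_⟩
    exact glue_le ((le_orbits_mul_swap π p q).trans (glue_le le_rfl (h.2 h1))) (h.2 h1)

end Orbits

/-! ## Closed crossingless tangle words -/

/-- A pair of strands of opposite parities. -/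
structure Site (m : ℕ) where
  a : Fin m
  b : Fin m
  parity : a.val % 2 ≠ b.val % 2

/-- The cyclic successor of a height. -/
def nxt {N : ℕ} (t : Fin N) : Fin N :=
  ⟨if t.val + 1 = N then 0 else t.val + 1, by have := t.isLt; split_ifs <;> omega⟩

theorem nxt_val {N : ℕ} (t : Fin N) : (nxt t).val = if t.val + 1 = N then 0 else t.val + 1 := rfl

theorem nxt_injective {N : ℕ} : Function.Injective (nxt : Fin N → Fin N) := by
  intro t u h
  have := congrArg Fin.val h
  rw [nxt_val, nxt_val] at this
  ext
  split_ifs at this <;> omega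

/-- The cyclic rotation of the heights. -/
noncomputable def rot (N : ℕ) : Equiv.Perm (Fin N) :=
  Equiv.ofBijective nxt (Finite.injective_iff_bijective.1 nxt_injective)

theorem rot_apply {N : ℕ} (t : Fin N) : rot N t = nxt t := rfl

theorem rot_symm_nxt {N : ℕ} (t : Fin N) : (rot N).symm (nxt t) = t := (rot N).symm_apply_apply t

theorem nxt_rot_symm {N : ℕ} (t : Fin N) : nxt ((rot N).symm t) = t := (rot N).apply_symm_apply t

variable {m N : ℕ}

/-- The pieces of the closure of a word in cup-caps and identities. -/
inductive TLRel (f : Fin N → Option (Site m)) : Fin m × Fin N → Fin m × Fin N → Prop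
  | straight (p : Fin m) (t : Fin N) :
      (∀ S, f t = some S → p ≠ S.a ∧ p ≠ S.b) → TLRel f (p, t) (p, nxt t)
  | bot (t : Fin N) (S : Site m) : f t = some S → TLRel f (S.a, t) (S.b, t)
  | top (t : Fin N) (S : Site m) : f t = some S → TLRel f (S.a, nxt t) (S.b, nxt t)

/-- The circles of the closure of a word in cup-caps and identities. -/
def tl (f : Fin N → Option (Site m)) : Setoid (Fin m × Fin N) := Relation.EqvGen.setoid (TLRel f)

theorem tl_of_rel {f : Fin N → Option (Site m)} {v w : Fin m × Fin N} (h : TLRel f v w) :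
    tl f v w := Relation.EqvGen.rel _ _ h

theorem tl_le {f : Fin N → Option (Site m)} {S : Setoid (Fin m × Fin N)}
    (h : ∀ v w, TLRel f v w → S v w) : tl f ≤ S := by
  intro v w hvw
  induction hvw with
  | rel v w h' => exact h v w h'
  | refl v => exact S.refl v
  | symm v w _ ih => exact S.symm ih
  | trans u v w _ _ ih1 ih2 => exact S.trans ih1 ih2

/-- The strand of even position. -/
def Site.ev (S : Site m) : Fin m := if S.a.val % 2 = 0 then S.a else S.b

/-- The strand of odd position. -/
def Site.od (S : Site m) : Fin m := if S.a.val % 2 = 0 then S.b else S.a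

theorem Site.ev_even (S : Site m) : S.ev.val % 2 = 0 := by
  have := S.parity
  unfold Site.ev
  split_ifs <;> omega

theorem Site.od_odd (S : Site m) : S.od.val % 2 ≠ 0 := by
  have := S.parity
  unfold Site.od
  split_ifs <;> omega

theorem Site.cases (S : Site m) : (S.ev = S.a ∧ S.od = S.b) ∨ (S.ev = S.b ∧ S.od = S.a) := by
  unfold Site.ev Site.od
  split_ifs <;> simp

/-- The switch at the cup-caps: the even strand at the bottom and the odd strand at the top. -/
noncomputable def switch (f : Fin N → Option (Site m)) (v : Fin m × Fin N) : Fin m × Fin N :=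
  if v.1.val % 2 = 0 then
    match f v.2 with
    | none => v
    | some S => if v.1 = S.ev then (S.od, nxt v.2) else v
  else
    match f ((rot N).symm v.2) with
    | none => v
    | some S => if v.1 = S.od then (S.ev, (rot N).symm v.2) else v

theorem switch_ev {f : Fin N → Option (Site m)} {t : Fin N} {S : Site m} (h : f t = some S) :
    switch f (S.ev, t) = (S.od, nxt t) := by
  unfold switch
  simp [S.ev_even, h]

theorem switch_od {f : Fin N → Option (Site m)} {t : Fin N} {S : Site m} (h : f t = some S) :
    switch f (S.od, nxt t) = (S.ev, t) := by
  unfold switch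
  simp [S.od_odd, rot_symm_nxt, h]

theorem switch_even {f : Fin N → Option (Site m)} {t : Fin N} {p : Fin m} (hp : p.val % 2 = 0)
    (h : ∀ S, f t = some S → p ≠ S.ev) : switch f (p, t) = (p, t) := by
  unfold switch
  simp only [hp, if_true]
  cases hf : f t with
  | none => rfl
  | some S => simp [h S hf]

theorem switch_odd {f : Fin N → Option (Site m)} {t : Fin N} {p : Fin m} (hp : p.val % 2 ≠ 0)
    (h : ∀ S, f t = some S → p ≠ S.od) : switch f (p, nxt t) = (p, nxt t) := by
  unfold switch
  simp only [hp, if_false, rot_symm_nxt]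
  cases hf : f t with
  | none => rfl
  | some S => simp [h S hf]

/-- The points at which the switch acts. -/
theorem switch_cases (f : Fin N → Option (Site m)) (v : Fin m × Fin N) :
    (∃ t S, f t = some S ∧ v = (S.ev, t)) ∨ (∃ t S, f t = some S ∧ v = (S.od, nxt t)) ∨
    (∃ p t, p.val % 2 = 0 ∧ v = (p, t) ∧ ∀ S, f t = some S → p ≠ S.ev) ∨
    (∃ p t, p.val % 2 ≠ 0 ∧ v = (p, nxt t) ∧ ∀ S, f t = some S → p ≠ S.od) := by
  obtain ⟨p, t⟩ := v
  by_cases hp : p.val % 2 = 0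
  · by_cases h : ∃ S, f t = some S ∧ p = S.ev
    · obtain ⟨S, h1, rfl⟩ := h
      exact Or.inl ⟨t, S, h1, rfl⟩
    · push Not at h
      exact Or.inr (Or.inr (Or.inl ⟨p, t, hp, rfl, h⟩))
  · obtain ⟨t, rfl⟩ : ∃ u, t = nxt u := ⟨_, (nxt_rot_symm t).symm⟩
    by_cases h : ∃ S, f t = some S ∧ p = S.od
    · obtain ⟨S, h1, rfl⟩ := h
      exact Or.inr (Or.inl ⟨t, S, h1, rfl⟩)
    · push Not at h
      exact Or.inr (Or.inr (Or.inr ⟨p, t, hp, rfl, h⟩))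

theorem switch_involutive (f : Fin N → Option (Site m)) : Function.Involutive (switch f) := by
  intro v
  rcases switch_cases f v with ⟨t, S, h, rfl⟩ | ⟨t, S, h, rfl⟩ | ⟨p, t, hp, rfl, h⟩ |
    ⟨p, t, hp, rfl, h⟩
  · rw [switch_ev h, switch_od h]
  · rw [switch_od h, switch_ev h]
  · rw [switch_even hp h, switch_even hp h]
  · rw [switch_odd hp h, switch_odd hp h]

open Classical in
/-- Even strands run upwards and odd strands run downwards. -/
noncomputable def flow (m N : ℕ) : Equiv.Perm (Fin m × Fin N) where
  toFun v := (v.1, if v.1.val % 2 = 0 then nxt v.2 else (rot N).symm v.2)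
  invFun v := (v.1, if v.1.val % 2 = 0 then (rot N).symm v.2 else nxt v.2)
  left_inv v := by
    by_cases h : v.1.val % 2 = 0 <;> simp [h, rot_symm_nxt, nxt_rot_symm]
  right_inv v := by
    by_cases h : v.1.val % 2 = 0 <;> simp [h, rot_symm_nxt, nxt_rot_symm]

theorem flow_even {p : Fin m} (hp : p.val % 2 = 0) (t : Fin N) : flow m N (p, t) = (p, nxt t) := by
  simp [flow, hp]

theorem flow_odd {p : Fin m} (hp : p.val % 2 ≠ 0) (t : Fin N) : flow m N (p, nxt t) = (p, t) := by
  simp [flow, hp, rot_symm_nxt]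

/-- The permutation whose cycles are the circles of the closure. -/
noncomputable def tlPerm (f : Fin N → Option (Site m)) : Equiv.Perm (Fin m × Fin N) :=
  flow m N * (switch_involutive f).toPerm

theorem tlPerm_apply (f : Fin N → Option (Site m)) (v : Fin m × Fin N) :
    tlPerm f v = flow m N (switch f v) := rfl

theorem tl_bot {f : Fin N → Option (Site m)} {t : Fin N} {S : Site m} (h : f t = some S) :
    tl f (S.ev, t) (S.od, t) := by
  rcases S.cases with ⟨h1, h2⟩ | ⟨h1, h2⟩ <;> rw [h1, h2]
  · exact tl_of_rel (.bot t S h)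
  · exact (tl f).symm (tl_of_rel (.bot t S h))

theorem tl_top {f : Fin N → Option (Site m)} {t : Fin N} {S : Site m} (h : f t = some S) :
    tl f (S.ev, nxt t) (S.od, nxt t) := by
  rcases S.cases with ⟨h1, h2⟩ | ⟨h1, h2⟩ <;> rw [h1, h2]
  · exact tl_of_rel (.top t S h)
  · exact (tl f).symm (tl_of_rel (.top t S h))

/-- A cup-cap joins strands of opposite parity, so turning there exchanges up and down: every circle
is coherently oriented by even strands up and odd strands down. One step of `tlPerm` follows this
orientation along a piece of the circle. -/
theorem tl_eq_orbits (f : Fin N → Option (Site m)) : tl f = orbits (tlPerm f) := by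
  apply le_antisymm
  · refine tl_le ?_
    have key : ∀ v, orbits (tlPerm f) v (flow m N (switch f v)) := fun v => orbits_apply _ v
    have hbot : ∀ t S, f t = some S → orbits (tlPerm f) (S.ev, t) (S.od, t) := by
      intro t S h
      have := key (S.ev, t)
      rwa [switch_ev h, flow_odd S.od_odd] at this
    have htop : ∀ t S, f t = some S → orbits (tlPerm f) (S.ev, nxt t) (S.od, nxt t) := by
      intro t S h
      have := key (S.od, nxt t)
      rw [switch_od h, flow_even S.ev_even] at this
      exact Setoid.symm' _ this
    rintro _ _ (⟨p, t, h⟩ | ⟨t, S, h⟩ | ⟨t, S, h⟩)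
    · by_cases hp : p.val % 2 = 0
      · have := key (p, t)
        rwa [switch_even hp, flow_even hp] at this
        intro S hS
        rcases S.cases with ⟨h1, h2⟩ | ⟨h1, h2⟩ <;> rw [h1]
        exacts [(h S hS).1, (h S hS).2]
      · have := key (p, nxt t)
        rw [switch_odd hp, flow_odd hp] at this
        · exact Setoid.symm' _ this
        intro S hS
        rcases S.cases with ⟨h1, h2⟩ | ⟨h1, h2⟩ <;> rw [h2]
        exacts [(h S hS).2, (h S hS).1]
    · have := hbot t S h
      rcases S.cases with ⟨h1, h2⟩ | ⟨h1, h2⟩ <;> rw [h1, h2] at this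
      exacts [this, Setoid.symm' _ this]
    · have := htop t S h
      rcases S.cases with ⟨h1, h2⟩ | ⟨h1, h2⟩ <;> rw [h1, h2] at this
      exacts [this, Setoid.symm' _ this]
  · refine orbits_le fun v => ?_
    rw [tlPerm_apply]
    rcases switch_cases f v with ⟨t, S, h, rfl⟩ | ⟨t, S, h, rfl⟩ | ⟨p, t, hp, rfl, h⟩ |
      ⟨p, t, hp, rfl, h⟩
    · rw [switch_ev h, flow_odd S.od_odd]
      exact tl_bot h
    · rw [switch_od h, flow_even S.ev_even]
      exact (tl f).symm (tl_top h)
    · rw [switch_even hp h, flow_even hp]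
      refine tl_of_rel (.straight p t fun S hS => ?_)
      have h1 := h S hS
      have h2 : p ≠ S.od := fun h' => S.od_odd (h' ▸ hp)
      rcases S.cases with ⟨h3, h4⟩ | ⟨h3, h4⟩ <;> rw [h3] at h1 <;> rw [h4] at h2
      exacts [⟨h1, h2⟩, ⟨h2, h1⟩]
    · rw [switch_odd hp h, flow_odd hp]
      refine (tl f).symm (tl_of_rel (.straight p t fun S hS => ?_))
      have h1 := h S hS
      have h2 : p ≠ S.ev := fun h' => hp (h' ▸ S.ev_even)
      rcases S.cases with ⟨h3, h4⟩ | ⟨h3, h4⟩ <;> rw [h4] at h1 <;> rw [h3] at h2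
      exacts [⟨h2, h1⟩, ⟨h1, h2⟩]

theorem switch_update {f : Fin N → Option (Site m)} {t : Fin N} (ht : f t = none) (S : Site m)
    (v : Fin m × Fin N) : switch (Function.update f t (some S)) v =
      switch f (Equiv.swap (S.ev, t) (S.od, nxt t) v) := by
  have ht' : Function.update f t (some S) t = some S := Function.update_self ..
  have hno : ∀ S', f t ≠ some S' := fun S' h => by rw [ht] at h; cases h
  by_cases h1 : v = (S.ev, t)
  · subst h1
    rw [switch_ev ht', Equiv.swap_apply_left, switch_odd S.od_odd fun S' h => absurd h (hno S')]
  by_cases h2 : v = (S.od, nxt t)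
  · subst h2
    rw [switch_od ht', Equiv.swap_apply_right, switch_even S.ev_even fun S' h => absurd h (hno S')]
  rw [Equiv.swap_apply_of_ne_of_ne h1 h2]
  rcases switch_cases f v with ⟨u, S', h, rfl⟩ | ⟨u, S', h, rfl⟩ | ⟨p, u, hp, rfl, h⟩ |
    ⟨p, u, hp, rfl, h⟩
  · have hut : u ≠ t := by rintro rfl; exact hno S' h
    rw [switch_ev h, switch_ev (by rw [Function.update_of_ne hut, h])]
  · have hut : u ≠ t := by rintro rfl; exact hno S' h
    rw [switch_od h, switch_od (by rw [Function.update_of_ne hut, h])]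
  · rw [switch_even hp h, switch_even hp]
    intro S' h'
    by_cases hut : u = t
    · subst hut
      rw [ht'] at h'
      cases h'
      rintro rfl
      exact h1 rfl
    · rw [Function.update_of_ne hut] at h'
      exact h S' h'
  · rw [switch_odd hp h, switch_odd hp]
    intro S' h'
    by_cases hut : u = t
    · subst hut
      rw [ht'] at h'
      cases h'
      rintro rfl
      exact h2 rfl
    · rw [Function.update_of_ne hut] at h'
      exact h S' h'

/-- Inserting a cup-cap composes the switch with one transposition. Parity replaces planarity here:
a change of smoothing that neither merges nor splits cannot occur. -/
theorem isSaddle_tl {f : Fin N → Option (Site m)} {t : Fin N} (ht : f t = none) (S : Site m) :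
    IsSaddle (tl f) (tl (Function.update f t (some S))) (S.ev, t) (S.od, nxt t) := by
  rw [tl_eq_orbits, tl_eq_orbits]
  have : tlPerm (Function.update f t (some S)) =
      tlPerm f * Equiv.swap (S.ev, t) (S.od, nxt t) := by
    ext1 v
    rw [tlPerm_apply, switch_update ht, Equiv.Perm.mul_apply, tlPerm_apply]
  rw [this]
  refine isSaddle_orbits _ fun h => S.od_odd ?_
  rw [← (Prod.mk.inj h).1]
  exact S.ev_even

/-! ## Tangle words -/

/-- The letters of tangle words: the identity, a cup-cap, a positive or a negative crossing. -/
inductive Letter (m : ℕ)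
  | one : Letter m
  | cup (S : Site m) : Letter m
  | pos (S : Site m) : Letter m
  | neg (S : Site m) : Letter m

/-- The smoothings of a letter. -/
def Letter.smooth : Letter m → Label → Option (Site m)
  | .one, _ => none
  | .cup S, _ => some S
  | .pos _, .A => none
  | .pos S, .B => some S
  | .neg S, .A => some S
  | .neg _, .B => none

/-- The letter is a crossing. -/
def Letter.IsCrossing : Letter m → Prop
  | .one => False
  | .cup _ => False
  | .pos _ => True
  | .neg _ => True

/-- The letter obtained by smoothing. -/
def Letter.frozen (x : Letter m) (l : Label) : Letter m :=
  match x.smooth l with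
  | none => .one
  | some S => .cup S

theorem Letter.smooth_frozen (x : Letter m) (l l' : Label) :
    (x.frozen l).smooth l' = x.smooth l := by
  unfold Letter.frozen
  cases x.smooth l <;> rfl

theorem Letter.not_isCrossing_frozen (x : Letter m) (l : Label) : ¬ (x.frozen l).IsCrossing := by
  unfold Letter.frozen
  cases x.smooth l <;> exact fun h => h

/-- The cube of resolutions of the closure of a word, the letters being given as a function of the
heights. -/
def wordCube (w : Fin N → Letter m) : Cube (Fin m × Fin N) (Fin N) where
  part s := tl fun t => (w t).smooth (s t)
  free := {t | (w t).IsCrossing}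

theorem wordCube_part (w : Fin N → Letter m) (s : Fin N → Label) :
    (wordCube w).part s = tl fun t => (w t).smooth (s t) := rfl

theorem smooth_update (w : Fin N → Letter m) (s : Fin N → Label) (x : Fin N) (l : Label) :
    (fun t => (w t).smooth (Function.update s x l t)) =
      Function.update (fun t => (w t).smooth (s t)) x ((w x).smooth l) := by
  funext t
  by_cases h : t = x
  · subst h; simp
  · simp [h]

/-- For a positive letter the change from `A` to `B` inserts a cup-cap; for a negative one it
removes it, which is the same saddle read backwards. -/
theorem wordCube_elementary (w : Fin N → Letter m) : (wordCube w).Elementary := by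
  intro x hx
  have hx' : (w x).IsCrossing := hx
  cases hw : w x with
  | one => rw [hw] at hx'; exact hx'.elim
  | cup S => rw [hw] at hx'; exact hx'.elim
  | pos S =>
    refine ⟨(S.ev, x), (S.od, nxt x), fun s hs => ?_⟩
    rw [wordCube_part, wordCube_part, smooth_update, hw]
    exact isSaddle_tl (by rw [hw, hs]; rfl) S
  | neg S =>
    refine ⟨(S.ev, x), (S.od, nxt x), fun s hs => ?_⟩
    rw [wordCube_part, wordCube_part, smooth_update, hw]
    have h1 : (fun t => (w t).smooth (s t)) = Function.update
        (Function.update (fun t => (w t).smooth (s t)) x ((Letter.neg S).smooth Label.B)) x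
          (some S) := by
      rw [Function.update_idem]
      refine (Function.update_eq_self_iff.2 ?_).symm
      rw [hw, hs]; rfl
    have h2 := isSaddle_tl (f := Function.update (fun t => (w t).smooth (s t)) x
      ((Letter.neg S).smooth Label.B)) (t := x) (Function.update_self ..) S
    rw [← h1] at h2
    exact h2.symm

theorem freeze_wordCube (w : Fin N → Letter m) (x : Fin N) (l : Label) :
    (wordCube w).freeze x l = wordCube (Function.update w x ((w x).frozen l)) := by
  unfold Cube.freeze wordCube
  congr 1
  · funext s
    change tl (fun t => (w t).smooth (Function.update s x l t)) = tl _
    congr 1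
    funext t
    by_cases h : t = x
    · subst h
      simp [Letter.smooth_frozen]
    · simp [h]
  · ext t
    by_cases h : t = x
    · subst h
      simp [Letter.not_isCrossing_frozen]
    · simp [h]

end Khovanov

namespace Khovanov

variable {m N : ℕ}

/-! ## Local moves -/

/-- The strand belongs to the site. -/
def Site.Mem (S : Site m) (p : Fin m) : Prop := p = S.a ∨ p = S.b

/-- The two strands are the strands of the site. -/
def Site.Joins (S : Site m) (p q : Fin m) : Prop := (p = S.a ∧ q = S.b) ∨ (p = S.b ∧ q = S.a)

theorem Site.joins_self (S : Site m) : S.Joins S.a S.b := Or.inl ⟨rfl, rfl⟩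

theorem Site.Joins.symm {S : Site m} {p q : Fin m} (h : S.Joins p q) : S.Joins q p := by
  rcases h with ⟨rfl, rfl⟩ | ⟨rfl, rfl⟩
  exacts [Or.inr ⟨rfl, rfl⟩, Or.inl ⟨rfl, rfl⟩]

theorem Site.Joins.mem_iff {S : Site m} {p q r : Fin m} (h : S.Joins p q) :
    S.Mem r ↔ r = p ∨ r = q := by
  rcases h with ⟨rfl, rfl⟩ | ⟨rfl, rfl⟩
  exacts [Iff.rfl, or_comm]

theorem Site.Joins.rel {S : Site m} {p q : Fin m} (h : S.Joins p q) {R : Setoid (Fin m × Fin N)}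
    {t : Fin N} : R (S.a, t) (S.b, t) ↔ R (p, t) (q, t) := by
  rcases h with ⟨rfl, rfl⟩ | ⟨rfl, rfl⟩
  exacts [Iff.rfl, ⟨fun h => R.symm h, fun h => R.symm h⟩]

section tl

variable {f : Fin N → Option (Site m)}

theorem tl_straight {t : Fin N} {p : Fin m} (h : ∀ S, f t = some S → ¬ S.Mem p) :
    tl f (p, t) (p, nxt t) :=
  tl_of_rel (.straight p t fun S hS => not_or.1 (h S hS))

theorem tl_straight_none {t : Fin N} (h : f t = none) (p : Fin m) : tl f (p, t) (p, nxt t) :=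
  tl_straight fun S hS => by rw [h] at hS; cases hS

theorem tl_joins {t : Fin N} {S : Site m} (h : f t = some S) {p q : Fin m} (hS : S.Joins p q) :
    tl f (p, t) (q, t) := hS.rel.1 (tl_of_rel (.bot t S h))

theorem tl_joins_nxt {t : Fin N} {S : Site m} (h : f t = some S) {p q : Fin m} (hS : S.Joins p q) :
    tl f (p, nxt t) (q, nxt t) := hS.rel.1 (tl_of_rel (.top t S h))

/-- This is the universal property of the generated partition. It reduces comparisons of circles to
a check letter by letter. -/
theorem tl_le_iff {R : Setoid (Fin m × Fin N)} : tl f ≤ R ↔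
    (∀ t p, (∀ S, f t = some S → ¬ S.Mem p) → R (p, t) (p, nxt t)) ∧
    ∀ t S, f t = some S → R (S.a, t) (S.b, t) ∧ R (S.a, nxt t) (S.b, nxt t) := by
  refine ⟨fun h => ⟨fun t p hp => h (tl_straight hp), fun t S hS =>
    ⟨h (tl_joins hS S.joins_self), h (tl_joins_nxt hS S.joins_self)⟩⟩, fun h => tl_le ?_⟩
  rintro _ _ (⟨p, t, hp⟩ | ⟨t, S, hS⟩ | ⟨t, S, hS⟩)
  exacts [h.1 t p fun S hS => not_or.2 (hp S hS), (h.2 t S hS).1, (h.2 t S hS).2]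

theorem tl_le_update {t : Fin N} {c : Option (Site m)} {R : Setoid (Fin m × Fin N)}
    (h : tl f ≤ R)
    (h1 : ∀ p, (∀ S, c = some S → ¬ S.Mem p) → R (p, t) (p, nxt t))
    (h2 : ∀ S, c = some S → R (S.a, t) (S.b, t) ∧ R (S.a, nxt t) (S.b, nxt t)) :
    tl (Function.update f t c) ≤ R := by
  rw [tl_le_iff] at h ⊢
  constructor
  · intro u
    by_cases hu : u = t
    · subst hu
      rw [Function.update_self]
      exact h1
    · rw [Function.update_of_ne hu]
      exact h.1 u
  · intro u
    by_cases hu : u = t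
    · subst hu
      rw [Function.update_self]
      exact h2
    · rw [Function.update_of_ne hu]
      exact h.2 u

end tl

theorem nxt_ne (hN : 3 ≤ N) (t : Fin N) : nxt t ≠ t := by
  intro h
  have := congrArg Fin.val h
  rw [nxt_val] at this
  split_ifs at this <;> omega

theorem nxt_nxt_ne (hN : 3 ≤ N) (t : Fin N) : nxt (nxt t) ≠ t := by
  intro h
  have := congrArg Fin.val h
  rw [nxt_val, nxt_val] at this
  split_ifs at this <;> omega

/-- The points enclosed between two cup-caps at the heights before and after `nxt t`. -/
def pocket (S : Site m) (t : Fin N) : Set (Fin m × Fin N) :=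
  {v | S.Mem v.1 ∧ (v.2 = nxt t ∨ v.2 = nxt (nxt t))}

variable {f : Fin N → Option (Site m)} {t : Fin N} {S S' : Site m} {p q r : Fin m}

/-- Membership in the pocket is invariant under every piece of the curve: the pieces that would
leave it are blocked by the cup-caps below and above. The pocket itself is connected by the upper
arc of the lower cup-cap and the two straight strands. -/
theorem isClass_pocket (hN : 3 ≤ N) (h0 : f t = some S) (h1 : f (nxt t) = none)
    (h2 : f (nxt (nxt t)) = some S) (hS : S.Joins p q) :
    IsClass (tl f) (pocket S t) (p, nxt t) := by
  have hp : S.Mem p := hS.mem_iff.2 (Or.inl rfl)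
  have hmem : (p, nxt t) ∈ pocket S t := ⟨hp, Or.inl rfl⟩
  have hle : tl f ≤ Setoid.ker (fun v => v ∈ pocket S t) := by
    rw [tl_le_iff]
    constructor
    · intro u r hr
      refine propext (and_congr_right fun hm => ?_)
      change u = _ ∨ u = _ ↔ nxt u = _ ∨ nxt u = _
      rw [nxt_injective.eq_iff, nxt_injective.eq_iff]
      have hu0 : u ≠ t := by rintro rfl; exact hr S h0 hm
      have hu2 : u ≠ nxt (nxt t) := by rintro rfl; exact hr S h2 hm
      tauto
    · intro u S' hS'
      have hu1 : u ≠ nxt t := by rintro rfl; rw [h1] at hS'; cases hS'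
      constructor
      · refine propext (and_congr_left ?_)
        rintro (h | h)
        · exact absurd h hu1
        · change u = _ at h
          subst h
          rw [h2] at hS'
          cases hS'
          exact iff_of_true (Or.inl rfl) (Or.inr rfl)
      · refine propext (and_congr_left ?_)
        rintro (h | h)
        · obtain rfl := nxt_injective h
          rw [h0] at hS'
          cases hS'
          exact iff_of_true (Or.inl rfl) (Or.inr rfl)
        · exact absurd (nxt_injective h) hu1
  intro v
  constructor
  · intro h
    exact cast (hle h : ((p, nxt t) ∈ pocket S t) = (v ∈ pocket S t)) hmem
  · obtain ⟨r, u⟩ := v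
    rintro ⟨h3, h4⟩
    have key : tl f (p, nxt t) (r, nxt t) := by
      rcases hS.mem_iff.1 h3 with h | h <;> change r = _ at h <;> subst h
      exacts [(tl f).refl _, tl_joins_nxt h0 hS]
    rcases h4 with h | h <;> change u = _ at h <;> subst h
    exacts [key, (tl f).trans key (tl_straight_none h1 _)]

/-- A second cup-cap above the first splits off the pocket. Conversely, opening it joins the pocket
to the circle through the next height. -/
theorem tl_eq_glue_top (h0 : f t = some S) (h1 : f (nxt t) = none)
    (h2 : f (nxt (nxt t)) = none) (hS : S.Joins p q) :
    tl f = glue (tl (Function.update f (nxt (nxt t)) (some S))) (p, nxt t)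
      (p, nxt (nxt (nxt t))) := by
  set f' := Function.update f (nxt (nxt t)) (some S) with hf'
  have e : f = Function.update f' (nxt (nxt t)) none := by
    rw [hf', Function.update_idem, Function.update_eq_self_iff.2 h2.symm]
  have h2' : f' (nxt (nxt t)) = some S := Function.update_self ..
  have h0' : f' t = some S := by
    by_cases h : t = nxt (nxt t)
    · rw [← h] at h2'; exact h2'
    · rw [hf', Function.update_of_ne h, h0]
  have h1' : f' (nxt t) = none := by
    rw [hf', Function.update_of_ne, h1]
    intro h
    rw [nxt_injective h, h1] at h0
    cases h0
  set R := glue (tl f') (p, nxt t) (p, nxt (nxt (nxt t))) with hR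
  have hle : tl f' ≤ R := le_glue _ _ _
  have hpq := glue_pair (tl f') (p, nxt t) (p, nxt (nxt (nxt t)))
  apply le_antisymm
  · rw [e]
    refine tl_le_update hle (fun r _ => ?_) fun S hS => by cases hS
    by_cases hr : S.Mem r
    · have hb : R (r, nxt (nxt t)) (p, nxt t) := by
        refine R.trans (R.symm (hle (tl_straight_none h1' r))) ?_
        rcases hS.mem_iff.1 hr with rfl | rfl
        exacts [R.refl _, hle (tl_joins_nxt h0' hS.symm)]
      have ht : R (p, nxt (nxt (nxt t))) (r, nxt (nxt (nxt t))) := by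
        rcases hS.mem_iff.1 hr with rfl | rfl
        exacts [R.refl _, hle (tl_joins_nxt h2' hS)]
      exact R.trans hb (R.trans hpq ht)
    · refine hle (tl_straight fun S' hS' => ?_)
      rw [h2'] at hS'
      cases hS'
      exact hr
  · have hb : ∀ r, S.Mem r → tl f (p, nxt t) (r, nxt (nxt t)) := by
      intro r hr
      refine (tl f).trans ?_ (tl_straight_none h1 r)
      rcases hS.mem_iff.1 hr with rfl | rfl
      exacts [(tl f).refl _, tl_joins_nxt h0 hS]
    have ht := tl_straight_none h2
    have hab : tl f (S.a, nxt (nxt t)) (S.b, nxt (nxt t)) :=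
      (tl f).trans ((tl f).symm (hb _ (Or.inl rfl))) (hb _ (Or.inr rfl))
    refine glue_le (tl_le_update le_rfl ?_ ?_) ?_
    · exact fun r _ => ht r
    · intro S' hS'
      cases hS'
      exact ⟨hab, (tl f).trans ((tl f).symm (ht _)) ((tl f).trans hab (ht _))⟩
    · exact (tl f).trans (hb p (hS.mem_iff.2 (Or.inl rfl))) (ht p)

/-- The cup-cap inside the pocket shares the strand `q` with it and reaches the strand `r` outside,
so it joins the pocket to the circle through `r`. -/
theorem tl_update_eq_glue (hN : 3 ≤ N) (h0 : f t = some S) (h1 : f (nxt t) = none)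
    (h2 : f (nxt (nxt t)) = some S) (hS : S.Joins p q) (hS' : S'.Joins q r) (hpr : p ≠ r)
    (hpq : p ≠ q) (hqr : q ≠ r) :
    tl (Function.update f (nxt t) (some S')) = glue (tl f) (p, nxt t) (r, nxt t) := by
  set f' := Function.update f (nxt t) (some S') with hf'
  have e : f = Function.update f' (nxt t) none := by
    rw [hf', Function.update_idem, Function.update_eq_self_iff.2 h1.symm]
  have h0' : f' t = some S := by rw [hf', Function.update_of_ne (nxt_ne hN t).symm, h0]
  have h1' : f' (nxt t) = some S' := Function.update_self ..
  have h2' : f' (nxt (nxt t)) = some S := by rw [hf', Function.update_of_ne (nxt_ne hN _), h2]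
  set R := glue (tl f) (p, nxt t) (r, nxt t) with hR
  have hle : tl f ≤ R := le_glue _ _ _
  have hg : R (p, nxt t) (r, nxt t) := glue_pair _ _ _
  apply le_antisymm
  · have hb : R (q, nxt t) (r, nxt t) := R.trans (hle (tl_joins_nxt h0 hS.symm)) hg
    refine tl_le_update hle ?_ ?_
    · exact fun p _ => hle (tl_straight_none h1 p)
    · intro S'' h
      cases h
      refine ⟨hS'.rel.2 hb, hS'.rel.2 ?_⟩
      have := fun p => hle (tl_straight_none h1 p)
      exact R.trans (R.symm (this q)) (R.trans hb (this r))
  · have hqr' := tl_joins h1' hS'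
    have hqr2 := tl_joins_nxt h1' hS'
    have hpq1 := tl_joins_nxt h0' hS
    have hpq2 := tl_joins h2' hS
    have hp : tl f' (p, nxt t) (p, nxt (nxt t)) := by
      refine tl_straight fun S'' h => ?_
      rw [h1'] at h
      cases h
      rw [hS'.mem_iff]
      exact not_or.2 ⟨hpq, hpr⟩
    have hq : tl f' (q, nxt t) (q, nxt (nxt t)) :=
      (tl f').trans ((tl f').symm hpq1) ((tl f').trans hp hpq2)
    have hr : tl f' (r, nxt t) (r, nxt (nxt t)) :=
      (tl f').trans ((tl f').symm hqr') ((tl f').trans hq hqr2)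
    refine glue_le ?_ ((tl f').trans hpq1 hqr')
    rw [e]
    refine tl_le_update le_rfl (fun u _ => ?_) fun _ h => by cases h
    by_cases hu : S'.Mem u
    · rcases hS'.mem_iff.1 hu with rfl | rfl
      exacts [hq, hr]
    · refine tl_straight fun S'' h => ?_
      rw [h1'] at h
      cases h
      exact hu

theorem notMem_pocket (hN : 3 ≤ N) (S : Site m) (t : Fin N) (p : Fin m) :
    (p, nxt (nxt (nxt t))) ∉ pocket S t := by
  rintro ⟨-, h | h⟩
  · exact nxt_nxt_ne hN _ h
  · exact nxt_ne hN _ h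

theorem notMem_pocket_of_not_mem {S : Site m} {p : Fin m} (h : ¬ S.Mem p) (t u : Fin N) :
    (p, u) ∉ pocket S t := fun h' => h h'.1

/-! ## Moves of words -/

variable {w : Fin N → Letter m}

/-- The label `B` at the crossing closes the pocket above the cup-cap, and the label `A` opens it.
-/
theorem wordCube_kink_pos (hN : 3 ≤ N) (h0 : w t = .cup S) (h1 : w (nxt t) = .one)
    (h2 : w (nxt (nxt t)) = .pos S) (a b : ℤ) :
    Nonempty ((wordCube w).cx.H a b ≃+
      (wordCube (Function.update w (nxt (nxt t)) .one)).cx.H (a + 1) (b + 3)) := by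
  have hx : nxt (nxt t) ∈ (wordCube w).free := by
    change (w _).IsCrossing
    rw [h2]; trivial
  have := Cube.kink_split (wordCube_elementary w) hx (notMem_pocket hN S t S.a)
    (O := pocket S t) (o := (S.a, nxt t)) (fun s _ hs => ?_) (fun s _ hs => ?_) a b
  · rwa [freeze_wordCube, h2] at this
  · exact isClass_pocket hN (by rw [h0]; rfl) (by rw [h1]; rfl) (by rw [h2, hs]; rfl) S.joins_self
  · rw [wordCube_part, wordCube_part, smooth_update, h2]
    exact tl_eq_glue_top (by rw [h0]; rfl) (by rw [h1]; rfl) (by rw [h2, hs]; rfl) S.joins_self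

theorem wordCube_kink_neg (hN : 3 ≤ N) (h0 : w t = .cup S) (h1 : w (nxt t) = .one)
    (h2 : w (nxt (nxt t)) = .neg S) (a b : ℤ) :
    Nonempty ((wordCube w).cx.H a b ≃+
      (wordCube (Function.update w (nxt (nxt t)) .one)).cx.H (a - 1) (b - 3)) := by
  have hx : nxt (nxt t) ∈ (wordCube w).free := by
    change (w _).IsCrossing
    rw [h2]; trivial
  have := Cube.kink_merge (wordCube_elementary w) hx (notMem_pocket hN S t S.a)
    (O := pocket S t) (o := (S.a, nxt t)) (fun s _ hs => ?_) (fun s _ hs => ?_) a b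
  · rwa [freeze_wordCube, h2] at this
  · exact isClass_pocket hN (by rw [h0]; rfl) (by rw [h1]; rfl) (by rw [h2, hs]; rfl) S.joins_self
  · rw [wordCube_part, wordCube_part, smooth_update, h2]
    have e : (fun u => (w u).smooth (s u)) = Function.update (Function.update
        (fun u => (w u).smooth (s u)) (nxt (nxt t)) none) (nxt (nxt t)) (some S) := by
      rw [Function.update_idem]
      refine (Function.update_eq_self_iff.2 ?_).symm
      rw [h2, hs]; rfl
    conv_rhs => rw [e]
    refine tl_eq_glue_top ?_ ?_ (Function.update_self ..) S.joins_self
    · rw [Function.update_of_ne (nxt_nxt_ne hN t).symm, h0]; rfl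
    · rw [Function.update_of_ne (nxt_ne hN _).symm, h1]; rfl

/-- The pocket is closed exactly when the middle crossing has label `A` and the last one label `B`.
What survives is the opposite pair of labels: a cup-cap at `S'` followed by the identity. -/
theorem wordCube_reidemeister_two (hN : 3 ≤ N) (h0 : w t = .cup S) (h1 : w (nxt t) = .pos S')
    (h2 : w (nxt (nxt t)) = .pos S) (hS : S.Joins p q) (hS' : S'.Joins q r) (hpr : p ≠ r)
    (hpq : p ≠ q) (hqr : q ≠ r) (a b : ℤ) :
    Nonempty ((wordCube w).cx.H a b ≃+ (wordCube (Function.update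
      (Function.update w (nxt t) (.cup S')) (nxt (nxt t)) .one)).cx.H a b) := by
  have hne : nxt (nxt t) ≠ nxt t := nxt_ne hN _
  have hx : nxt t ∈ (wordCube w).free := by
    change (w _).IsCrossing
    rw [h1]; trivial
  have hy : nxt (nxt t) ∈ (wordCube w).free := by
    change (w _).IsCrossing
    rw [h2]; trivial
  have hr : ¬ S.Mem r := by
    rw [hS.mem_iff]
    exact not_or.2 ⟨hpr.symm, hqr.symm⟩
  have := Cube.reidemeister_two (wordCube_elementary w) hne.symm hx hy
    (notMem_pocket_of_not_mem hr t (nxt t)) (notMem_pocket hN S t p)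
    (O := pocket S t) (o := (p, nxt t)) (fun s _ hs hs' => ?_) (fun s _ hs hs' => ?_)
    (fun s _ hs hs' => ?_) a b
  · rw [freeze_wordCube, freeze_wordCube, Function.update_of_ne hne, h1, h2] at this
    exact this
  · exact isClass_pocket hN (by rw [h0]; rfl) (by rw [h1, hs]; rfl) (by rw [h2, hs']; rfl) hS
  · rw [wordCube_part, wordCube_part, smooth_update, h1]
    exact tl_update_eq_glue hN (by rw [h0]; rfl) (by rw [h1, hs]; rfl) (by rw [h2, hs']; rfl)
      hS hS' hpr hpq hqr
  · rw [wordCube_part, wordCube_part, smooth_update, h2]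
    exact tl_eq_glue_top (by rw [h0]; rfl) (by rw [h1, hs]; rfl) (by rw [h2, hs']; rfl) hS

/-- Both diagrams arise from `w₀`, where the pocket is an isolated circle, by uniting the pocket
with another circle: through `r` in one case, through the strand above in the other. So both are
compared with the states of `w₀` having sign `1` on the pocket. -/
theorem wordCube_isotopy (hN : 3 ≤ N) (h0 : w t = .cup S) (h1 : w (nxt t) = .cup S')
    (h2 : w (nxt (nxt t)) = .cup S) (hS : S.Joins p q) (hS' : S'.Joins q r) (hpr : p ≠ r)
    (hpq : p ≠ q) (hqr : q ≠ r) (a b : ℤ) :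
    Nonempty ((wordCube w).cx.H a b ≃+ (wordCube (Function.update
      (Function.update w (nxt t) .one) (nxt (nxt t)) .one)).cx.H a b) := by
  have hne : nxt (nxt t) ≠ nxt t := nxt_ne hN _
  have hr : ¬ S.Mem r := by
    rw [hS.mem_iff]
    exact not_or.2 ⟨hpr.symm, hqr.symm⟩
  set w₀ := Function.update w (nxt t) .one with hw₀
  have h0' : w₀ t = .cup S := by rw [hw₀, Function.update_of_ne (nxt_ne hN t).symm, h0]
  have h1' : w₀ (nxt t) = .one := Function.update_self ..
  have h2' : w₀ (nxt (nxt t)) = .cup S := by rw [hw₀, Function.update_of_ne hne, h2]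
  have hO : ∀ s, (wordCube w₀).Adm s → IsClass ((wordCube w₀).part s) (pocket S t) (p, nxt t) :=
    fun s _ => isClass_pocket hN (by rw [h0']; rfl) (by rw [h1']; rfl) (by rw [h2']; rfl) hS
  have hfree : ∀ {u : Fin N → Letter m} {x : Fin N} {l : Letter m}, ¬ (u x).IsCrossing →
      ¬ l.IsCrossing → (wordCube u).free = (wordCube (Function.update u x l)).free := by
    intro u x l hu hl
    ext y
    change (u y).IsCrossing ↔ (Function.update u x l y).IsCrossing
    by_cases hy : y = x
    · subst hy
      rw [Function.update_self]
      exact iff_of_false hu hl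
    · rw [Function.update_of_ne hy]
  have hpart : ∀ (u : Fin N → Letter m) (x : Fin N) (l : Letter m) (s : Fin N → Label),
      (wordCube (Function.update u x l)).part s =
        tl (Function.update (fun y => (u y).smooth (s y)) x (l.smooth (s x))) := by
    intro u x l s
    rw [wordCube_part]
    congr 1
    funext y
    by_cases hy : y = x
    · subst hy; simp
    · simp [hy]
  obtain ⟨e1⟩ := Cube.blob_equiv (C := wordCube w₀) (C' := wordCube w)
    (by rw [hw₀]; exact (hfree (by rw [h1]; exact id) id).symm)
    (notMem_pocket_of_not_mem hr t (nxt t)) hO (fun s _ => by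
      have e : w = Function.update w₀ (nxt t) (.cup S') := by
        rw [hw₀, Function.update_idem, Function.update_eq_self_iff.2 h1.symm]
      rw [e, hpart]
      exact tl_update_eq_glue hN (by rw [h0']; rfl) (by rw [h1']; rfl) (by rw [h2']; rfl) hS hS'
        hpr hpq hqr) 1 a (b + 2)
  obtain ⟨e2⟩ := Cube.blob_equiv (C := wordCube w₀)
    (C' := wordCube (Function.update w₀ (nxt (nxt t)) .one))
    (hfree (by rw [h2']; exact id) id) (notMem_pocket hN S t p) hO (fun s _ => by
      rw [hpart]
      have := tl_eq_glue_top (f := Function.update (fun y => (w₀ y).smooth (s y)) (nxt (nxt t))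
        none) (t := t) (S := S) ?_ ?_ (Function.update_self ..) hS
      · rw [Function.update_idem, (Function.update_eq_self_iff (a := nxt (nxt t))
          (f := fun y => (w₀ y).smooth (s y)) (b := some S)).2] at this
        · exact this
        · rw [h2']; rfl
      · rw [Function.update_of_ne (nxt_nxt_ne hN t).symm, h0']; rfl
      · rw [Function.update_of_ne hne.symm, h1']; rfl) 1 a (b + 2)
  have e3 : b + 2 - 2 * ((1 : ℤˣ) : ℤ) = b := by push_cast; ring
  rw [e3] at e1 e2
  exact ⟨e1.symm.trans e2⟩

end Khovanov

namespace Khovanov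

/-! ## Comparison of words -/

section compare

variable {m N N' : ℕ}

/-- The maps `g` and `h` of points need to be inverse to each other only up to circles of the
smoothings. This allows heights to be dropped or merged. -/
theorem wordCube_compare {w : Fin N → Letter m} {w' : Fin N' → Letter m} (ι : Fin N' → Fin N)
    (hι : Function.Injective ι) (hw : ∀ t, w' t = w (ι t))
    (hrange : ∀ t, (w t).IsCrossing → t ∈ Set.range ι)
    (g : Fin m × Fin N' → Fin m × Fin N) (h : Fin m × Fin N → Fin m × Fin N')
    (key : ∀ s : Fin N → Label, ∀ f : Fin N → Option (Site m), (∀ t, f t = (w t).smooth (s t)) →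
      tl (f ∘ ι) ≤ (tl f).comap g ∧ tl f ≤ (tl (f ∘ ι)).comap h ∧ (∀ v, tl f v (g (h v))) ∧
        ∀ v, tl (f ∘ ι) v (h (g v))) (a b : ℤ) :
    Nonempty ((wordCube w).cx.H a b ≃+ (wordCube w').cx.H a b) := by
  have e : ∀ s : Fin N → Label, (wordCube w').part (s ∘ ι) =
      tl ((fun t => (w t).smooth (s t)) ∘ ι) := fun s => by
    rw [wordCube_part]
    congr 1
    funext t
    rw [hw]
    rfl
  refine Cube.compare (wordCube_elementary w) ι hι (fun t => ?_) hrange g (fun s _ v v' => ?_)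
    (fun s _ v => ⟨h v, ((key s _ fun t => rfl).2.2.1 v)⟩) a b
  · change (w' t).IsCrossing ↔ (w (ι t)).IsCrossing
    rw [hw]
  · obtain ⟨h1, h2, h3, h4⟩ := key s _ fun t => rfl
    rw [e]
    refine ⟨fun hv => h1 hv, fun hv => ?_⟩
    exact Setoid.trans' _ (h4 v) (Setoid.trans' _ (h2 hv) (Setoid.symm' _ (h4 v')))

theorem tl_comp_equiv {e : Fin N' ≃ Fin N} (he : ∀ t, nxt (e t) = e (nxt t))
    (f : Fin N → Option (Site m)) : tl (f ∘ e) ≤ (tl f).comap (Prod.map id e) := by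
  rw [tl_le_iff]
  refine ⟨fun t p hp => ?_, fun t S hS => ⟨tl_joins (f := f) hS S.joins_self, ?_⟩⟩
  · change tl f (p, e t) (p, e (nxt t))
    rw [← he]
    exact tl_straight hp
  · change tl f (S.a, e (nxt t)) (S.b, e (nxt t))
    rw [← he]
    exact tl_joins_nxt (f := f) hS S.joins_self

/-- A rotation of the heights. -/
theorem wordCube_equiv {w : Fin N → Letter m} {w' : Fin N' → Letter m} (e : Fin N' ≃ Fin N)
    (he : ∀ t, nxt (e t) = e (nxt t)) (hw : ∀ t, w' t = w (e t)) (a b : ℤ) :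
    Nonempty ((wordCube w).cx.H a b ≃+ (wordCube w').cx.H a b) := by
  refine wordCube_compare e e.injective hw (fun t _ => e.surjective t) (Prod.map id e)
    (Prod.map id e.symm) (fun s f _ => ⟨tl_comp_equiv he f, ?_, fun v => ?_, fun v => ?_⟩) a b
  · have := tl_comp_equiv (e := e.symm) (fun t => by
      rw [Equiv.eq_symm_apply, ← he, Equiv.apply_symm_apply]) (f ∘ e)
    rwa [Function.comp_assoc, Equiv.self_comp_symm, Function.comp_id] at this
  · simp [Prod.map]
  · simp [Prod.map]

/-- Reflection exchanges the bottom and the top of a letter, so the height `t` corresponds to the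
top `nxt (e t)` of the corresponding letter. -/
theorem tl_comp_rev {e : Fin N' ≃ Fin N} (he : ∀ t, nxt (e (nxt t)) = e t)
    (f : Fin N → Option (Site m)) : tl (f ∘ e) ≤ (tl f).comap (Prod.map id fun t => nxt (e t)) := by
  rw [tl_le_iff]
  refine ⟨fun t p hp => ?_, fun t S hS => ⟨tl_joins_nxt (f := f) hS S.joins_self, ?_⟩⟩
  · change tl f (p, nxt (e t)) (p, nxt (e (nxt t)))
    rw [he]
    exact (tl f).symm (tl_straight hp)
  · change tl f (S.a, nxt (e (nxt t))) (S.b, nxt (e (nxt t)))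
    rw [he]
    exact tl_joins (f := f) hS S.joins_self

/-- A reflection of the heights. -/
theorem wordCube_rev {w : Fin N → Letter m} {w' : Fin N' → Letter m} (e : Fin N' ≃ Fin N)
    (he : ∀ t, nxt (e (nxt t)) = e t) (hw : ∀ t, w' t = w (e t)) (a b : ℤ) :
    Nonempty ((wordCube w).cx.H a b ≃+ (wordCube w').cx.H a b) := by
  have he' : ∀ t, nxt (e.symm (nxt t)) = e.symm t := by
    intro t
    rw [Equiv.eq_symm_apply]
    apply nxt_injective
    rw [he, Equiv.apply_symm_apply]
  refine wordCube_compare e e.injective hw (fun t _ => e.surjective t)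
    (Prod.map id fun t => nxt (e t)) (Prod.map id fun t => nxt (e.symm t))
    (fun s f _ => ⟨tl_comp_rev he f, ?_, fun v => ?_, fun v => ?_⟩) a b
  · have := tl_comp_rev (e := e.symm) he' (f ∘ e)
    rwa [Function.comp_assoc, Equiv.self_comp_symm, Function.comp_id] at this
  · simp [Prod.map, he]
  · simp [Prod.map, he']

end compare

/-! ### Closed words: rotation, reversal and deletion of an identity letter -/

variable {m : ℕ}

/-- The framed homology of the closure of a word. -/
abbrev wordH (w : List (Letter m)) (a b : ℤ) : Type := (wordCube w.get).cx.H a b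

theorem nonempty_wordH {N : ℕ} {w : List (Letter m)} {u : Fin N → Letter m} (hN : w.length = N)
    (h : ∀ t : Fin w.length, w.get t = u (t.cast hN)) (a b : ℤ) :
    Nonempty (wordH w a b ≃+ (wordCube u).cx.H a b) := by
  subst hN
  have : w.get = u := funext h
  rw [← this]
  exact ⟨AddEquiv.refl _⟩

theorem wordH_rotate (x : Letter m) (r : List (Letter m)) (a b : ℤ) :
    Nonempty (wordH (x :: r) a b ≃+ wordH (r ++ [x]) a b) := by
  have hl : (r ++ [x]).length = (x :: r).length := by simp
  refine wordCube_equiv ((finCongr hl).trans (rot _)) (fun t => ?_) (fun t => ?_) a b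
  · rw [Equiv.trans_apply, Equiv.trans_apply, rot_apply, rot_apply]
    congr 1
    ext
    simp only [finCongr_apply, nxt_val, Fin.val_cast, hl]
  · rw [Equiv.trans_apply, rot_apply, List.get_eq_getElem, List.get_eq_getElem]
    obtain ⟨t, ht⟩ := t
    simp only [nxt_val, finCongr_apply, Fin.val_cast, List.length_cons]
    rw [List.length_append, List.length_singleton] at ht
    rcases Nat.lt_or_ge t r.length with h | h
    · simp [h.ne, List.getElem_append_left h]
    · obtain rfl : t = r.length := by omega
      simp

theorem wordH_reverse (w : List (Letter m)) (a b : ℤ) :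
    Nonempty (wordH w a b ≃+ wordH w.reverse a b) := by
  have hl : w.reverse.length = w.length := by simp
  refine wordCube_rev ((finCongr hl).trans Fin.revPerm) (fun t => ?_) (fun t => ?_) a b
  · rw [Equiv.trans_apply, Equiv.trans_apply]
    ext
    simp only [Fin.revPerm_apply, nxt_val, Fin.val_rev, finCongr_apply, Fin.val_cast, hl]
    have : t.val < w.length := hl ▸ t.isLt
    split_ifs <;> omega
  · rw [Equiv.trans_apply, List.get_eq_getElem, List.get_eq_getElem, List.getElem_reverse]
    congr 1
    simp only [Fin.revPerm_apply, Fin.val_rev, finCongr_apply, Fin.val_cast]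
    omega

theorem wordH_one {r : List (Letter m)} (hr : r ≠ []) (a b : ℤ) :
    Nonempty (wordH (.one :: r) a b ≃+ wordH r a b) := by
  have hpos : 0 < r.length := List.length_pos_iff.2 hr
  have hsucc : ∀ t : Fin r.length, nxt t.succ = if t.val + 1 = r.length then 0 else (nxt t).succ := by
    intro t
    ext
    rw [nxt_val, Fin.val_succ]
    split_ifs <;> simp_all [nxt_val]
  -- Truncated subtraction sends both `0` and `1` to `0`, which contracts the identity letter at
  -- height `0`.
  let back : Fin (r.length + 1) → Fin r.length := fun t => ⟨t.val - 1, by omega⟩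
  refine wordCube_compare (N := r.length + 1) (N' := r.length) Fin.succ (Fin.succ_injective _)
    (fun t => rfl) (fun t => ?_) (Prod.map id Fin.succ) (Prod.map id back)
    (fun s f hf => ?_) a b
  · refine Fin.cases (fun h => ?_) (fun t _ => ⟨t, rfl⟩) t
    exact absurd h id
  · have h0 : f 0 = none := hf 0
    have hn0 : nxt (0 : Fin (r.length + 1)) = (⟨0, hpos⟩ : Fin r.length).succ := by
      ext
      rw [nxt_val]
      simpa using hr
    have hlast : ∀ t : Fin r.length, t.val + 1 = r.length → nxt t = ⟨0, hpos⟩ := fun t ht => by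
      ext
      rw [nxt_val, if_pos ht]
    have h01 : ∀ p, tl f (p, 0) (p, (⟨0, hpos⟩ : Fin r.length).succ) := fun p => by
      rw [← hn0]
      exact tl_straight_none h0 p
    have hnn : ∀ t p, tl f (p, nxt t.succ) (p, (nxt t).succ) := by
      intro t p
      rw [hsucc]
      split_ifs with h
      · rw [hlast t h]
        exact h01 p
      · exact (tl f).refl _
    have hb0 : back 0 = ⟨0, hpos⟩ := rfl
    have hbs : ∀ t : Fin r.length, back t.succ = t := fun t => by ext; simp [back]
    have hbn : ∀ t : Fin r.length, back (nxt t.succ) = nxt t := by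
      intro t
      rw [hsucc]
      split_ifs with h
      · rw [hlast t h]; rfl
      · exact hbs _
    refine ⟨?_, ?_, ?_, ?_⟩
    · rw [tl_le_iff]
      refine ⟨fun t p hp => ?_, fun t S hS => ⟨tl_joins (f := f) hS S.joins_self, ?_⟩⟩
      · exact (tl f).trans (tl_straight (f := f) (t := t.succ) hp) (hnn t p)
      · exact (tl f).trans ((tl f).symm (hnn t _)) ((tl f).trans
          (tl_joins_nxt (f := f) (t := t.succ) hS S.joins_self) (hnn t _))
    · rw [tl_le_iff]
      constructor
      · intro t p
        refine Fin.cases (fun _ => ?_) (fun t hp => ?_) t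
        · change tl _ (p, back 0) (p, back (nxt 0))
          rw [hn0, hbs]
          exact (tl _).refl _
        · change tl _ (p, back t.succ) (p, back (nxt t.succ))
          rw [hbn, hbs]
          exact tl_straight hp
      · intro t S
        refine Fin.cases (fun hS => ?_) (fun t hS => ?_) t
        · rw [h0] at hS; cases hS
        · change tl _ (S.a, back t.succ) (S.b, back t.succ) ∧
            tl _ (S.a, back (nxt t.succ)) (S.b, back (nxt t.succ))
          rw [hbn, hbs]
          exact ⟨tl_joins (f := f ∘ Fin.succ) (t := t) hS S.joins_self,
            tl_joins_nxt (f := f ∘ Fin.succ) (t := t) hS S.joins_self⟩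
    · rintro ⟨p, t⟩
      refine Fin.cases ?_ (fun t => ?_) t
      · exact h01 p
      · change tl f _ (p, (back t.succ).succ)
        rw [hbs]
    · rintro ⟨p, t⟩
      change tl _ _ (p, back t.succ)
      rw [hbs]

/-! ### Far commutation -/

/-- The strands moved by a letter. -/
def Letter.Meets (x : Letter m) (p : Fin m) : Prop := ∃ l S, x.smooth l = some S ∧ S.Mem p

open Classical in
/-- The points at the middle height of two commuting letters are moved to the other heights. -/
noncomputable def slide {N : ℕ} (hN : 3 ≤ N) (y : Letter m) (v : Fin m × Fin N) : Fin m × Fin N :=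
  if v.2.val = 1 then (if y.Meets v.1 then (v.1, ⟨2, by omega⟩) else (v.1, ⟨0, by omega⟩)) else v

/-- A point between the two letters is pushed past whichever letter does not touch its strand in the
old order. On strands met by `y` this is upwards, on all others downwards. -/
theorem tl_slide {N : ℕ} (hN : 3 ≤ N) {x y : Letter m} (hxy : ∀ p, x.Meets p → ¬ y.Meets p)
    {f f' : Fin N → Option (Site m)} (h0 : f ⟨0, by omega⟩ = f' ⟨1, by omega⟩)
    (h1 : f ⟨1, by omega⟩ = f' ⟨0, by omega⟩) (h2 : ∀ t : Fin N, 2 ≤ t.val → f t = f' t)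
    (hx : ∃ l, f ⟨0, by omega⟩ = x.smooth l) (hy : ∃ l, f ⟨1, by omega⟩ = y.smooth l) :
    tl f' ≤ (tl f).comap (slide hN y) := by
  obtain ⟨l, hx⟩ := hx
  obtain ⟨l', hy⟩ := hy
  have hX : ∀ S p, f ⟨0, by omega⟩ = some S → S.Mem p → x.Meets p := fun S p h hp =>
    ⟨l, S, hx ▸ h, hp⟩
  have hY : ∀ S p, f ⟨1, by omega⟩ = some S → S.Mem p → y.Meets p := fun S p h hp =>
    ⟨l', S, hy ▸ h, hp⟩
  have hz : 0 < N := by omega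
  have ho : 1 < N := by omega
  have n0 : nxt (⟨0, hz⟩ : Fin N) = ⟨1, ho⟩ := by
    ext; rw [nxt_val]; exact if_neg (by change ¬ 0 + 1 = N; omega)
  have n1 : nxt (⟨1, ho⟩ : Fin N) = ⟨2, by omega⟩ := by
    ext; rw [nxt_val]; exact if_neg (by change ¬ 1 + 1 = N; omega)
  have s0 : ∀ t : Fin N, t.val ≠ 1 → ∀ p, slide hN y (p, t) = (p, t) := fun t ht p => if_neg ht
  have s1 : ∀ p, y.Meets p → slide hN y (p, ⟨1, by omega⟩) = (p, ⟨2, by omega⟩) := fun p hp => by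
    unfold slide; simp [hp]
  have s1' : ∀ p, ¬ y.Meets p → slide hN y (p, ⟨1, by omega⟩) = (p, ⟨0, by omega⟩) :=
    fun p hp => by unfold slide; simp [hp]
  have hstr : ∀ p, ¬ x.Meets p → tl f (p, ⟨0, by omega⟩) (p, ⟨1, by omega⟩) := fun p hp => by
    have := tl_straight (f := f) (t := ⟨0, by omega⟩) (p := p) fun S hS hm => hp (hX S p hS hm)
    rwa [n0] at this
  have hstr' : ∀ p, ¬ y.Meets p → tl f (p, ⟨1, by omega⟩) (p, ⟨2, by omega⟩) := fun p hp => by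
    have := tl_straight (f := f) (t := ⟨1, by omega⟩) (p := p) fun S hS hm => hp (hY S p hS hm)
    rwa [n1] at this
  rw [tl_le_iff]
  constructor
  · intro t p hp
    change tl f (slide hN y _) (slide hN y _)
    rcases Nat.lt_or_ge t.val 2 with ht | ht
    · obtain ht | ht : t = ⟨0, hz⟩ ∨ t = ⟨1, ho⟩ := by
        rcases (by omega : t.val = 0 ∨ t.val = 1) with h | h
        exacts [Or.inl (Fin.ext h), Or.inr (Fin.ext h)]
      · subst ht
        rw [n0, s0 _ (by simp)]
        by_cases hm : y.Meets p
        · rw [s1 p hm]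
          refine (tl f).trans (hstr p fun h => hxy p h hm) ?_
          have := tl_straight (f := f) (t := ⟨1, by omega⟩) (p := p) (by rw [h1]; exact hp)
          rwa [n1] at this
        · rw [s1' p hm]
      · subst ht
        rw [n1, s0 ⟨2, by omega⟩ (by simp)]
        by_cases hm : y.Meets p
        · rw [s1 p hm]
        · rw [s1' p hm]
          refine (tl f).trans ?_ (hstr' p hm)
          have := tl_straight (f := f) (t := ⟨0, by omega⟩) (p := p) (by rw [h0]; exact hp)
          rwa [n0] at this
    · rw [s0 _ (by omega), s0 _ (by rw [nxt_val]; split_ifs <;> omega)]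
      exact tl_straight (by rw [h2 t ht]; exact hp)
  · intro t S hS
    change tl f (slide hN y _) (slide hN y _) ∧ tl f (slide hN y _) (slide hN y _)
    rcases Nat.lt_or_ge t.val 2 with ht | ht
    · obtain ht | ht : t = ⟨0, hz⟩ ∨ t = ⟨1, ho⟩ := by
        rcases (by omega : t.val = 0 ∨ t.val = 1) with h | h
        exacts [Or.inl (Fin.ext h), Or.inr (Fin.ext h)]
      · subst ht
        rw [← h1] at hS
        have hma := hY S S.a hS (Or.inl rfl)
        have hmb := hY S S.b hS (Or.inr rfl)
        rw [n0, s0 _ (by simp), s0 _ (by simp), s1 _ hma, s1 _ hmb]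
        constructor
        · refine (tl f).trans (hstr _ fun h => hxy _ h hma) ((tl f).trans
            (tl_joins hS S.joins_self) ((tl f).symm (hstr _ fun h => hxy _ h hmb)))
        · have := tl_joins_nxt hS S.joins_self
          rwa [n1] at this
      · subst ht
        rw [← h0] at hS
        have hma := hxy _ (hX S S.a hS (Or.inl rfl))
        have hmb := hxy _ (hX S S.b hS (Or.inr rfl))
        rw [n1, s0 ⟨2, by omega⟩ (by simp), s0 ⟨2, by omega⟩ (by simp), s1' _ hma, s1' _ hmb]
        constructor
        · exact tl_joins hS S.joins_self
        · have := tl_joins_nxt hS S.joins_self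
          rw [n0] at this
          exact (tl f).trans ((tl f).symm (hstr' _ hma)) ((tl f).trans this (hstr' _ hmb))
    · rw [← h2 t ht] at hS
      have h3 : (nxt t).val ≠ 1 := by rw [nxt_val]; split_ifs <;> omega
      rw [s0 _ (by omega), s0 _ (by omega), s0 _ h3, s0 _ h3]
      exact ⟨tl_joins hS S.joins_self, tl_joins_nxt hS S.joins_self⟩

theorem tl_slide_slide {N : ℕ} (hN : 3 ≤ N) {x y : Letter m} (hxy : ∀ p, x.Meets p → ¬ y.Meets p)
    {f : Fin N → Option (Site m)}
    (hx : ∃ l, f ⟨0, by omega⟩ = x.smooth l) (hy : ∃ l, f ⟨1, by omega⟩ = y.smooth l)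
    (v : Fin m × Fin N) : tl f v (slide hN y (slide hN x v)) := by
  obtain ⟨l, hx⟩ := hx
  obtain ⟨l', hy⟩ := hy
  obtain ⟨p, t⟩ := v
  have hz : 0 < N := by omega
  have ho : 1 < N := by omega
  have n0 : nxt (⟨0, hz⟩ : Fin N) = ⟨1, ho⟩ := by
    ext; rw [nxt_val]; exact if_neg (by change ¬ 0 + 1 = N; omega)
  have n1 : nxt (⟨1, ho⟩ : Fin N) = ⟨2, by omega⟩ := by
    ext; rw [nxt_val]; exact if_neg (by change ¬ 1 + 1 = N; omega)
  by_cases ht : t.val = 1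
  · obtain rfl : t = ⟨1, ho⟩ := Fin.ext ht
    by_cases hm : x.Meets p
    · have : slide hN y (slide hN x (p, ⟨1, by omega⟩)) = (p, ⟨2, by omega⟩) := by
        unfold slide; simp [hm]
      rw [this, ← n1]
      exact tl_straight fun S hS hp => hxy p hm ⟨l', S, hy ▸ hS, hp⟩
    · have : slide hN y (slide hN x (p, ⟨1, by omega⟩)) = (p, ⟨0, by omega⟩) := by
        unfold slide; simp [hm]
      rw [this, ← n0]
      exact (tl f).symm (tl_straight fun S hS hp => hm ⟨l, S, hx ▸ hS, hp⟩)
  · have : slide hN y (slide hN x (p, t)) = (p, t) := by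
      unfold slide; simp [ht]
    rw [this]

theorem wordH_comm {x y : Letter m} (hxy : ∀ p, x.Meets p → ¬ y.Meets p) {r : List (Letter m)}
    (hr : r ≠ []) (a b : ℤ) : Nonempty (wordH (x :: y :: r) a b ≃+ wordH (y :: x :: r) a b) := by
  have hpos : 0 < r.length := List.length_pos_iff.2 hr
  have hN : 3 ≤ r.length + 1 + 1 := by omega
  have hyx : ∀ p, y.Meets p → ¬ x.Meets p := fun p h h' => hxy p h' h
  let ι : Equiv.Perm (Fin (r.length + 1 + 1)) := Equiv.swap 0 1
  have i0 : ι 0 = 1 := Equiv.swap_apply_left _ _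
  have i1 : ι 1 = 0 := Equiv.swap_apply_right _ _
  have i2 : ∀ t : Fin (r.length + 1 + 1), 2 ≤ t.val → ι t = t := fun t ht =>
    Equiv.swap_apply_of_ne_of_ne (fun h => by rw [h] at ht; simp at ht)
      (fun h => by rw [h] at ht; simp at ht)
  have z : (⟨0, by omega⟩ : Fin (r.length + 1 + 1)) = 0 := rfl
  have o : (⟨1, by omega⟩ : Fin (r.length + 1 + 1)) = 1 := rfl
  refine wordCube_compare (N := r.length + 1 + 1) (N' := r.length + 1 + 1) ι ι.injective
    (fun t => ?_) (fun t _ => ι.surjective t) (slide hN y) (slide hN x) (fun s f hf => ?_) a b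
  · refine Fin.cases ?_ (fun t => Fin.cases ?_ (fun t => ?_) t) t
    · rw [i0]; rfl
    · rw [show (Fin.succ 0 : Fin (r.length + 1 + 1)) = 1 from rfl, i1]; rfl
    · rw [i2 _ (by simp)]; rfl
  · have hx : f 0 = x.smooth (s 0) := hf 0
    have hy : f 1 = y.smooth (s 1) := hf 1
    have hx' : (f ∘ ι) 1 = x.smooth (s 0) := by rw [Function.comp_apply, i1, hx]
    have hy' : (f ∘ ι) 0 = y.smooth (s 1) := by rw [Function.comp_apply, i0, hy]
    refine ⟨tl_slide hN hxy ?_ ?_ ?_ ⟨_, hx⟩ ⟨_, hy⟩, tl_slide hN hyx ?_ ?_ ?_ ⟨_, hy'⟩ ⟨_, hx'⟩,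
      tl_slide_slide hN hxy ⟨_, hx⟩ ⟨_, hy⟩, tl_slide_slide hN hyx ⟨_, hy'⟩ ⟨_, hx'⟩⟩
    · rw [z, o, hx, hx']
    · rw [z, o, hy, hy']
    · intro t ht; rw [Function.comp_apply, i2 t ht]
    · rw [z, o, hy, hy']
    · rw [z, o, hx, hx']
    · intro t ht; rw [Function.comp_apply, i2 t ht]

end Khovanov

namespace Khovanov

/-! ## Turnback relations -/

section Turnback

variable {M : Type*} [Monoid M]

/-- The product `f (j + k - 1) * ⋯ * f (j + 1) * f j`. -/
def desc (f : ℕ → M) (j : ℕ) : ℕ → M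
  | 0 => 1
  | k + 1 => f (j + k) * desc f j k

theorem desc_zero (f : ℕ → M) (j : ℕ) : desc f j 0 = 1 := rfl

theorem desc_succ (f : ℕ → M) (j k : ℕ) : desc f j (k + 1) = f (j + k) * desc f j k := rfl

theorem desc_add (f : ℕ → M) (j k l : ℕ) : desc f j (k + l) = desc f (j + k) l * desc f j k := by
  induction l with
  | zero => simp [desc]
  | succ l ih => rw [← add_assoc, desc_succ, ih, desc_succ, mul_assoc, add_assoc]

theorem desc_comm {f : ℕ → M} {x : M} {j k : ℕ} (h : ∀ i, j ≤ i → i < j + k → x * f i = f i * x) :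
    x * desc f j k = desc f j k * x := by
  induction k with
  | zero => simp [desc]
  | succ k ih =>
    rw [desc_succ, ← mul_assoc, h _ (by omega) (by omega), mul_assoc,
      ih fun i h1 h2 => h i h1 (by omega), mul_assoc]

/-- The relations between crossings `s i`, cup-caps `e i` and the framing change `κ` which do not
involve the third Reidemeister move. -/
structure TurnbackRelations (n : ℕ) (κ : M) (s e : ℕ → M) : Prop where
  central : ∀ x, κ * x = x * κ
  kink : ∀ i < n, e i * s i = κ * e i
  turn_up : ∀ i, i + 1 < n → e i * s (i + 1) * s i = e i * e (i + 1)
  turn_down : ∀ i, i + 1 < n → e (i + 1) * s i * s (i + 1) = e (i + 1) * e i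
  turn_back : ∀ i, i + 1 < n → s (i + 1) * s i * e (i + 1) = e i * e (i + 1)
  zigzag : ∀ i, i + 1 < n → e (i + 1) * e i * e (i + 1) = e (i + 1)
  far_ss : ∀ i j, i + 1 < j → j < n → s i * s j = s j * s i
  far_es : ∀ i j, i + 1 < j → j < n → e i * s j = s j * e i
  far_se : ∀ i j, i + 1 < j → j < n → e j * s i = s i * e j

namespace TurnbackRelations

variable {n : ℕ} {κ : M} {s e : ℕ → M} (R : TurnbackRelations n κ s e)
include R

theorem central_pow (k : ℕ) (x : M) : κ ^ k * x = x * κ ^ k :=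
  ((show Commute κ x from R.central x).pow_left k).eq

/-- A cup-cap passes through a full row of crossings. -/
theorem cup_mul_row {i l : ℕ} (hi : i + 1 < l) (hl : l ≤ n) :
    e i * desc s 0 l = desc s 0 l * e (i + 1) := by
  obtain ⟨k, rfl⟩ : ∃ k, l = i + 2 + k := ⟨l - (i + 2), by omega⟩
  rw [desc_add, zero_add, ← mul_assoc, desc_comm (x := e i) (fun j h1 h2 =>
    R.far_es i j (by omega) (by omega)), mul_assoc, mul_assoc]
  congr 1
  rw [show i + 2 = (i + 1) + 1 from rfl, desc_succ, desc_succ, zero_add, zero_add, mul_assoc,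
    mul_assoc, ← desc_comm (x := e (i + 1)) (fun j h1 h2 => R.far_se j (i + 1) (by omega) (by omega))]
  -- Both `e i * s (i+1) * s i` and `s (i+1) * s i * e (i+1)` are equal to `e i * e (i+1)`.
  rw [← mul_assoc, ← mul_assoc, R.turn_up i (by omega), ← R.turn_back i (by omega)]
  simp only [mul_assoc]

/-- Each row moves the cup-cap one strand further, so after `k` rows `e 0` has become `e k`. -/
theorem cup_mul_rows_pow {l : ℕ} (hl : l ≤ n) (k : ℕ) (hk : k < l) :
    e 0 * desc s 0 l ^ k = desc s 0 l ^ k * e k := by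
  induction k with
  | zero => simp
  | succ k ih =>
    rw [pow_succ, ← mul_assoc, ih (by omega), mul_assoc, R.cup_mul_row hk hl, mul_assoc]

/-- The strand turned back by the cup-cap is pulled out of both rows one position at a time by
`turn_down`, each time leaving a cup-cap. The last position is a kink and gives the factor `κ`. -/
theorem cup_mul_two_rows {l : ℕ} (hl : l < n) :
    e l * desc s 0 l * desc s 0 (l + 1) = κ * desc e 0 (l + 1) := by
  induction l with
  | zero => simp [desc, R.kink 0 hl]
  | succ l ih =>
    have h1 : s (l + 1) * desc s 0 l = desc s 0 l * s (l + 1) :=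
      desc_comm fun j _ h => (R.far_ss j (l + 1) (by omega) hl).symm
    have h2 := R.turn_down l hl
    calc e (l + 1) * desc s 0 (l + 1) * desc s 0 (l + 1 + 1)
        = e (l + 1) * s l * (desc s 0 l * s (l + 1)) * desc s 0 (l + 1) := by
          rw [desc_succ s 0 (l + 1), desc_succ s 0 l]; simp only [zero_add, mul_assoc]
      _ = e (l + 1) * s l * s (l + 1) * desc s 0 l * desc s 0 (l + 1) := by
          rw [← h1]; simp only [mul_assoc]
      _ = e (l + 1) * (e l * desc s 0 l * desc s 0 (l + 1)) := by
          rw [h2]; simp only [mul_assoc]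
      _ = κ * desc e 0 (l + 1 + 1) := by
          rw [ih (by omega), ← mul_assoc, ← R.central, mul_assoc, desc_succ e 0 (l + 1), zero_add]

/-- The first crossing next to the cup-cap is a kink; the rest is `cup_mul_two_rows` with its second
kink. -/
theorem cup_mul_row_sq {l : ℕ} (hl : l < n) :
    e l * desc s 0 (l + 1) ^ 2 = κ ^ 2 * desc e 0 (l + 1) := by
  calc e l * desc s 0 (l + 1) ^ 2 = e l * s l * desc s 0 l * desc s 0 (l + 1) := by
        rw [sq, desc_succ s 0 l, zero_add]; simp only [mul_assoc]
    _ = κ * (e l * desc s 0 l * desc s 0 (l + 1)) := by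
        rw [R.kink l hl]; simp only [mul_assoc]
    _ = _ := by rw [R.cup_mul_two_rows hl, sq, mul_assoc]

theorem cup_mul_turn {i : ℕ} (hi : i + 1 < n) : e (i + 1) * s (i + 1) * s i * e (i + 1) = e (i + 1) := by
  have h1 := R.turn_back i hi
  have h2 := R.zigzag i hi
  calc _ = e (i + 1) * (s (i + 1) * s i * e (i + 1)) := by simp only [mul_assoc]
    _ = _ := by rw [h1, ← mul_assoc, h2]

theorem cups_mul_row_of_lt {l j k : ℕ} (hl : l ≤ n) (hjk : j + k < l) :
    desc e j k * desc s 0 l = desc s 0 l * desc e (j + 1) k := by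
  induction k with
  | zero => simp [desc]
  | succ k ih =>
    rw [desc_succ, mul_assoc, ih (by omega), ← mul_assoc, R.cup_mul_row (by omega) hl, mul_assoc,
      desc_succ, show j + 1 + k = j + k + 1 by omega]

/-- A chain of cup-caps reaching the last strand absorbs two crossings. -/
theorem cups_mul_row {j k : ℕ} (hl : j + k + 2 ≤ n) :
    desc e j (k + 2) * desc s 0 (j + k + 2) = desc s 0 (j + k) * desc e (j + 1) (k + 1) := by
  have h1 : ∀ l, l ≤ j + k → e (j + k + 1) * desc s 0 l = desc s 0 l * e (j + k + 1) := fun l hl' =>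
    desc_comm fun i _ h => R.far_se i (j + k + 1) (by omega) (by omega)
  calc desc e j (k + 2) * desc s 0 (j + k + 2)
      = e (j + k + 1) * (desc s 0 (j + k + 2) * desc e (j + 1) (k + 1)) := by
        rw [← R.cups_mul_row_of_lt hl (by omega), desc_succ e j (k + 1)]
        simp only [mul_assoc, add_assoc]
    _ = e (j + k + 1) * s (j + k + 1) * s (j + k) * (desc s 0 (j + k) * e (j + k + 1)) *
          desc e (j + 1) k := by
        rw [desc_succ e (j + 1) k, desc_succ s 0 (j + k + 1), desc_succ s 0 (j + k), zero_add,
          zero_add, show j + 1 + k = j + k + 1 by omega]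
        simp only [mul_assoc]
    _ = e (j + k + 1) * s (j + k + 1) * s (j + k) * e (j + k + 1) * desc s 0 (j + k) *
          desc e (j + 1) k := by
        rw [← h1 _ le_rfl]; simp only [mul_assoc]
    _ = desc s 0 (j + k) * desc e (j + 1) (k + 1) := by
        rw [R.cup_mul_turn (by omega), h1 _ le_rfl, mul_assoc, desc_succ e (j + 1) k,
          show j + 1 + k = j + k + 1 by omega]

/-- Each row loses two crossings and the chain loses its lowest cup-cap. -/
theorem cups_mul_row_pow {l : ℕ} (hl : l + 2 ≤ n) {i : ℕ} (hi : i ≤ l + 1) :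
    desc e 0 (l + 2) * desc s 0 (l + 2) ^ i = desc s 0 l ^ i * desc e i (l + 2 - i) := by
  induction i with
  | zero => simp
  | succ i ih =>
    obtain ⟨k, rfl⟩ : ∃ k, l = i + k := ⟨l - i, by omega⟩
    have := R.cups_mul_row hl
    rw [pow_succ, ← mul_assoc, ih (by omega), mul_assoc, show i + k + 2 - i = k + 2 by omega,
      this, show i + k + 2 - (i + 1) = k + 1 by omega, pow_succ, mul_assoc]

/-- After `l + 1` rows only the top cup-cap `e (l + 1)` is left. The last two rows turn it into the
full chain again, at the price of `κ ^ 2`. -/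
theorem cups_mul_full {l : ℕ} (hl : l + 2 ≤ n) :
    desc e 0 (l + 2) * desc s 0 (l + 2) ^ (l + 3) =
      κ ^ 2 * (desc s 0 l ^ (l + 1) * desc e 0 (l + 2)) := by
  rw [show l + 3 = l + 1 + 2 by omega, pow_add, ← mul_assoc, R.cups_mul_row_pow hl le_rfl,
    show l + 2 - (l + 1) = 1 by omega, mul_assoc, desc_succ, desc_zero, mul_one, add_zero,
    R.cup_mul_row_sq (l := l + 1) (by omega), ← mul_assoc, ← R.central_pow, mul_assoc]

variable {Q : Type*} {T : M → Q} (hT : ∀ x y, T (x * y) = T (y * x))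
include hT

/-- Induction on the width in steps of two. `cups_mul_full` narrows the rows, and the cyclic
property brings them back to the other side of the chain. -/
theorem trace_cups (l : ℕ) (hl : l ≤ n) (k : ℕ) :
    T (κ ^ k * (desc e 0 n * desc s 0 l ^ (l + 1))) =
      T (κ ^ (k + 2 * ((l + 1) / 2)) * desc e 0 n) := by
  induction l using Nat.twoStepInduction generalizing k with
  | zero => simp [desc]
  | one =>
    obtain ⟨n, rfl⟩ : ∃ n', n = 1 + n' := ⟨n - 1, by omega⟩
    have := R.cup_mul_row_sq (l := 0) (by omega)
    rw [zero_add] at this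
    have h1 : desc e 0 1 = e 0 := by simp [desc]
    rw [h1] at this
    rw [desc_add, mul_assoc, h1, this, ← mul_assoc (desc e _ n), ← R.central_pow, mul_assoc,
      ← mul_assoc, ← pow_add]
  | more l ih _ =>
    obtain ⟨n, rfl⟩ : ∃ n', n = l + 2 + n' := ⟨n - (l + 2), by omega⟩
    -- The narrow rows avoid the strands of the upper cup-caps, so they can be moved to the outside
    -- before the trace is rotated.
    have h1 : desc e (0 + (l + 2)) n * desc s 0 l ^ (l + 1) =
        desc s 0 l ^ (l + 1) * desc e (0 + (l + 2)) n := by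
      refine Commute.eq (Commute.pow_right ?_ _)
      refine desc_comm fun i _ h2 => (desc_comm fun j h3 h4 => ?_).symm
      exact (R.far_se i j (by omega) (by omega)).symm
    rw [desc_add, mul_assoc, R.cups_mul_full hl, ← mul_assoc (desc e _ n), ← R.central_pow,
      mul_assoc, ← mul_assoc, ← pow_add, ← mul_assoc (desc e _ n), h1, mul_assoc, ← desc_add,
      ← mul_assoc, R.central_pow, mul_assoc, hT, mul_assoc, ih (by omega)]
    congr 3
    omega

/-- The closure of `n + 3` rows and a cup-cap. -/
theorem trace_rows (hn : 0 < n) (k : ℕ) : T (κ ^ k * (desc s 0 n ^ (n + 3) * e 0)) =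
    T (κ ^ (k + 2 + 2 * ((n + 1) / 2)) * desc e 0 n) := by
  obtain ⟨n, rfl⟩ : ∃ n', n = n' + 1 := ⟨n - 1, by omega⟩
  set G := desc s 0 (n + 1) with hG
  -- The cup-cap `e 0` is rotated to the front and passes as many rows as are needed to reach the
  -- last strand. The rows passed are rotated to the back.
  have h1 : T (κ ^ k * (G ^ (n + 1 + 3) * e 0)) = T (κ ^ k * (e n * G ^ (n + 1 + 3))) := by
    rw [← mul_assoc, hT, ← mul_assoc, ← R.central_pow, mul_assoc,
      show n + 1 + 3 = n + 4 by omega, pow_add, ← mul_assoc (e 0), R.cup_mul_rows_pow le_rfl n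
      (by omega), ← hG, ← mul_assoc, ← mul_assoc, R.central_pow, mul_assoc, mul_assoc, hT,
      mul_assoc, mul_assoc, ← pow_add, ← pow_add, add_comm 4]
  rw [h1, show n + 1 + 3 = 2 + (n + 1 + 1) by omega, pow_add, ← mul_assoc (e n),
    R.cup_mul_row_sq (by omega), mul_assoc, ← mul_assoc, ← pow_add,
    R.trace_cups hT (n + 1) le_rfl]

end TurnbackRelations

end Turnback

end Khovanov

namespace Khovanov

variable {m : ℕ}

/-! ## The monoid of framed tangle words -/

/-- The framed homology of the closure of a word, with a framing correction. -/
abbrev framedH (w : List (Letter m)) (f : ℤ) (a b : ℤ) : Type := wordH w (a + f) (b + 3 * f)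

/-- The closures of two framed words have isomorphic homology. -/
def Sim (w w' : List (Letter m)) (f f' : ℤ) : Prop :=
  ∀ a b, Nonempty (framedH w f a b ≃+ framedH w' f' a b)

theorem Sim.refl (w : List (Letter m)) (f : ℤ) : Sim w w f f := fun _ _ => ⟨AddEquiv.refl _⟩

variable {w w' w'' : List (Letter m)} {f f' f'' : ℤ}

theorem Sim.symm (h : Sim w w' f f') : Sim w' w f' f := fun a b => by
  obtain ⟨e⟩ := h a b
  exact ⟨e.symm⟩

theorem Sim.trans (h : Sim w w' f f') (h' : Sim w' w'' f' f'') : Sim w w'' f f'' := fun a b => by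
  obtain ⟨e⟩ := h a b
  obtain ⟨e'⟩ := h' a b
  exact ⟨e.trans e'⟩

theorem Sim.of_equiv {d : ℤ} (h : ∀ a b, Nonempty (wordH w a b ≃+ wordH w' (a + d) (b + 3 * d))) :
    Sim w w' f (d + f) := fun a b => by
  have := h (a + f) (b + 3 * f)
  rwa [show a + f + d = a + (d + f) by ring, show b + 3 * f + 3 * d = b + 3 * (d + f) by ring]
    at this

theorem Sim.of_equiv_zero (h : ∀ a b, Nonempty (wordH w a b ≃+ wordH w' a b)) : Sim w w' f f :=
  fun a b => h _ _

theorem Sim.shift (h : Sim w w' f f') (d : ℤ) : Sim w w' (d + f) (d + f') := fun a b => by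
  have : Nonempty (wordH w (a + d + f) (b + 3 * d + 3 * f) ≃+
    wordH w' (a + d + f') (b + 3 * d + 3 * f')) := h (a + d) (b + 3 * d)
  rwa [show a + d + f = a + (d + f) by ring,
    show b + 3 * d + 3 * f = b + 3 * (d + f) by ring, show a + d + f' = a + (d + f') by ring,
    show b + 3 * d + 3 * f' = b + 3 * (d + f') by ring] at this

theorem Sim.rotate (u v : List (Letter m)) (f : ℤ) : Sim (u ++ v) (v ++ u) f f := by
  induction u generalizing v with
  | nil => simpa using Sim.refl _ _
  | cons x u ih =>
    have h1 : Sim (x :: (u ++ v)) (u ++ v ++ [x]) f f := Sim.of_equiv_zero (wordH_rotate x _)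
    have h2 := ih (v ++ [x])
    rw [← List.append_assoc] at h2
    simpa using h1.trans h2

theorem Sim.reverse (w : List (Letter m)) (f : ℤ) : Sim w w.reverse f f :=
  Sim.of_equiv_zero (wordH_reverse w)

/-- Framed tangle words. -/
abbrev FramedWord (m : ℕ) : Type := FreeMonoid (Letter m) × Multiplicative ℤ

/-- Two framed words define the same tangle up to moves under which the homology of all closures is
invariant. -/
def TangleRel (x y : FramedWord m) : Prop :=
  ∀ r : List (Letter m), r ≠ [] →
    Sim (x.1.toList ++ r) (y.1.toList ++ r) x.2.toAdd y.2.toAdd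

/-- Tangle equivalence is a congruence. -/
def tangleCon (m : ℕ) : Con (FramedWord m) where
  r := TangleRel
  iseqv := ⟨fun _ _ _ => Sim.refl _ _, fun h r hr => (h r hr).symm,
    fun h h' r hr => (h r hr).trans (h' r hr)⟩
  mul' := by
    intro w x y z h1 h2 r hr
    have e1 : Sim ((w * y).1.toList ++ r) ((x * y).1.toList ++ r) (w * y).2.toAdd
        (x * y).2.toAdd := by
      have := (h1 (y.1.toList ++ r) (by simp [hr])).shift y.2.toAdd
      rw [← List.append_assoc, ← List.append_assoc] at this
      simpa [add_comm] using this
    have e2 : Sim ((x * y).1.toList ++ r) ((x * z).1.toList ++ r) (x * y).2.toAdd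
        (x * z).2.toAdd := by
      have h := (h2 (r ++ x.1.toList) (by simp [hr])).shift x.2.toAdd
      have r1 := Sim.rotate x.1.toList (y.1.toList ++ r) (x.2.toAdd + y.2.toAdd)
      have r2 := Sim.rotate x.1.toList (z.1.toList ++ r) (x.2.toAdd + z.2.toAdd)
      rw [List.append_assoc] at r1 r2
      have := (r1.trans h).trans r2.symm
      simpa using this
    exact e1.trans e2

/-- The monoid of framed tangle words. -/
abbrev Tangle (m : ℕ) : Type := (tangleCon m).Quotient

/-- The class of a word. -/
def Tangle.mk (w : List (Letter m)) : Tangle m :=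
  ((FreeMonoid.ofList w, 1) : FramedWord m)

/-- A change of framing. -/
def Tangle.framing (f : ℤ) : Tangle m := ((1, Multiplicative.ofAdd f) : FramedWord m)

namespace Tangle

theorem mk_append (u v : List (Letter m)) : mk (u ++ v) = mk u * mk v := rfl

theorem mk_cons (x : Letter m) (v : List (Letter m)) : mk (x :: v) = mk [x] * mk v := rfl

theorem framing_comm (f : ℤ) (x : Tangle m) : framing f * x = x * framing f := by
  induction x using Con.induction_on with
  | H x => exact congrArg _ (Prod.ext (by simp) (mul_comm _ _))

theorem framing_mul (f g : ℤ) : (framing f * framing g : Tangle m) = framing (f + g) := rfl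

theorem framing_zero : (framing 0 : Tangle m) = 1 := rfl

theorem framing_pow (f : ℤ) (k : ℕ) : (framing f : Tangle m) ^ k = framing (k * f) := by
  induction k with
  | zero => simp [framing_zero]
  | succ k ih => rw [pow_succ, ih, framing_mul]; congr 1; push_cast; ring

theorem framing_mul_mk (f : ℤ) (w : List (Letter m)) : (framing f * mk w : Tangle m) =
    ((FreeMonoid.ofList w, Multiplicative.ofAdd f) : FramedWord m) :=
  congrArg _ (Prod.ext (by simp) (by simp))

theorem eq_of_sim {u v : List (Letter m)} {d : ℤ}
    (h : ∀ r : List (Letter m), r ≠ [] → Sim (u ++ r) (v ++ r) 0 d) :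
    mk u = framing d * mk v := by
  rw [framing_mul_mk]
  exact Quotient.sound fun r hr => h r hr

theorem eq_of_sim_zero {u v : List (Letter m)}
    (h : ∀ r : List (Letter m), r ≠ [] → Sim (u ++ r) (v ++ r) 0 0) : mk u = mk v :=
  Quotient.sound fun r hr => h r hr

theorem sim_of_eq_framing {u v : List (Letter m)} {d : ℤ} (h : mk u = framing d * mk v)
    {r : List (Letter m)} (hr : r ≠ []) : Sim (u ++ r) (v ++ r) 0 d := by
  rw [framing_mul_mk] at h
  exact Quotient.exact h r hr

/-- Closures are invariant under reflection of the heights, so a relation may be read backwards; the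
context word is reversed along with it. -/
theorem mk_reverse_framing {u v : List (Letter m)} {d : ℤ} (h : mk u = framing d * mk v) :
    mk u.reverse = framing d * mk v.reverse := by
  refine eq_of_sim fun r hr => ?_
  have h1 := sim_of_eq_framing h (r := r.reverse) (by simpa using hr)
  have e : ∀ (u : List (Letter m)) (f : ℤ), Sim (u.reverse ++ r) (u ++ r.reverse) f f := by
    intro u f
    have h2 := Sim.reverse (u.reverse ++ r) f
    have h3 := Sim.rotate u r.reverse f
    rw [List.reverse_append, List.reverse_reverse] at h2
    exact h2.trans h3.symm
  exact (e u 0).trans (h1.trans (e v d).symm)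

theorem mk_reverse {u v : List (Letter m)} (h : mk u = mk v) : mk u.reverse = mk v.reverse := by
  rw [← one_mul (mk v), ← framing_zero] at h
  rw [mk_reverse_framing h, framing_zero, one_mul]

theorem mk_one : mk [(.one : Letter m)] = 1 :=
  eq_of_sim_zero (v := []) fun _ hr => Sim.of_equiv_zero (wordH_one hr)

theorem mk_comm {x y : Letter m} (h : ∀ p, x.Meets p → ¬ y.Meets p) :
    mk [x] * mk [y] = mk [y] * mk [x] := by
  rw [← mk_append, ← mk_append]
  exact eq_of_sim_zero fun _ hr => Sim.of_equiv_zero (wordH_comm h hr)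

theorem mk_one_cons (r : List (Letter m)) : mk (.one :: r) = mk r := by
  rw [mk_cons, mk_one, one_mul]

theorem _root_.Khovanov.nxt_mk {N i : ℕ} (h : i + 1 < N) :
    nxt (⟨i, by omega⟩ : Fin N) = ⟨i + 1, h⟩ :=
  Fin.ext (if_neg h.ne)

/-- Replacing the third letter of a word. -/
theorem wordH_update_third (x y z z' : Letter m) (r : List (Letter m)) (a b : ℤ) :
    Nonempty ((wordCube (Function.update (x :: y :: z :: r).get
      (nxt (nxt (0 : Fin (r.length + 1 + 1 + 1)))) z')).cx.H a b ≃+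
        wordH (x :: y :: z' :: r) a b) := by
  have h2 : nxt (nxt (0 : Fin (r.length + 1 + 1 + 1))) = ⟨2, by omega⟩ :=
    (congrArg nxt (nxt_mk (i := 0) (by omega))).trans (nxt_mk (i := 1) (by omega))
  obtain ⟨e⟩ := nonempty_wordH (w := x :: y :: z' :: r) (u := Function.update (x :: y :: z :: r).get
      (nxt (nxt (0 : Fin (r.length + 1 + 1 + 1)))) z') rfl (by
    rw [h2]
    refine Fin.cases rfl (fun t => Fin.cases rfl (fun t => Fin.cases rfl (fun t => ?_) t) t)
    rw [Function.update_of_ne]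
    · rfl
    · intro h
      have := congrArg Fin.val h
      simp at this) a b
  exact ⟨e.symm⟩

/-- Replacing the second letter of a word. -/
theorem update_second (x y y' z : Letter m) (r : List (Letter m)) :
    Function.update (x :: y :: z :: r).get (nxt (0 : Fin (r.length + 1 + 1 + 1))) y' =
      (x :: y' :: z :: r).get := by
  have h1 : nxt (0 : Fin (r.length + 1 + 1 + 1)) = ⟨1, by omega⟩ :=
    nxt_mk (i := 0) (by omega)
  rw [h1]
  funext t
  refine Fin.cases rfl (fun t => Fin.cases rfl (fun t => ?_) t) t
  rw [Function.update_of_ne]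
  · rfl
  · intro h
    have := congrArg Fin.val h
    simp at this

theorem get_second (x y z : Letter m) (r : List (Letter m)) :
    (x :: y :: z :: r).get (nxt (0 : Fin (r.length + 1 + 1 + 1))) = y := by
  have h1 : nxt (0 : Fin (r.length + 1 + 1 + 1)) = ⟨1, by omega⟩ :=
    nxt_mk (i := 0) (by omega)
  rw [h1]; rfl

theorem get_third (x y z : Letter m) (r : List (Letter m)) :
    (x :: y :: z :: r).get (nxt (nxt (0 : Fin (r.length + 1 + 1 + 1)))) = z := by
  have h2 : nxt (nxt (0 : Fin (r.length + 1 + 1 + 1))) = ⟨2, by omega⟩ :=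
    (congrArg nxt (nxt_mk (i := 0) (by omega))).trans (nxt_mk (i := 1) (by omega))
  rw [h2]; rfl

theorem mk_cup_one (S : Site m) (x : Letter m) : mk [.cup S, .one, x] = mk [.cup S, x] := by
  rw [mk_cons, mk_one_cons, ← mk_cons]

theorem mk_one_last (x y : Letter m) : mk [x, y, .one] = mk [x, y] := by
  rw [mk_cons, mk_cons y, mk_one, mul_one, ← mk_cons]

/-- The local move needs a height between the cup-cap and the crossing, so an identity letter is
inserted and removed afterwards. -/
theorem mk_kink_pos (S : Site m) : mk [.cup S, .pos S] = framing 1 * mk [.cup S] := by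
  rw [← mk_cup_one, ← mul_one (mk [.cup S]), ← mk_one, ← mk_one_cons [.one], ← mk_cons]
  refine eq_of_sim fun r _ => ?_
  refine Sim.of_equiv (d := 1) (f := 0) fun a b => ?_
  obtain ⟨e⟩ := wordCube_kink_pos (w := (Letter.cup S :: .one :: .pos S :: r).get)
    (t := (0 : Fin (r.length + 1 + 1 + 1))) (S := S) (by omega) rfl (get_second ..) (get_third ..)
    a b
  obtain ⟨e'⟩ := wordH_update_third (.cup S) .one (.pos S) .one r (a + 1) (b + 3)
  rw [mul_one]
  exact ⟨e.trans e'⟩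

theorem mk_kink_neg (S : Site m) : mk [.cup S, .neg S] = framing (-1) * mk [.cup S] := by
  rw [← mk_cup_one, ← mul_one (mk [.cup S]), ← mk_one, ← mk_one_cons [.one], ← mk_cons]
  refine eq_of_sim fun r _ => ?_
  rw [show (-1 : ℤ) = -1 + 0 by ring]
  refine Sim.of_equiv fun a b => ?_
  obtain ⟨e⟩ := wordCube_kink_neg (w := (Letter.cup S :: .one :: .neg S :: r).get)
    (t := (0 : Fin (r.length + 1 + 1 + 1))) (S := S) (by omega) rfl (get_second ..) (get_third ..)
    a b
  obtain ⟨e'⟩ := wordH_update_third (.cup S) .one (.neg S) .one r (a - 1) (b - 3)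
  rw [show a + -1 = a - 1 by ring, show b + 3 * -1 = b - 3 by ring]
  exact ⟨e.trans e'⟩

/-! ### Relations on two pairs of strands sharing one strand -/

section adjacent

variable {S S' : Site m} {p q r : Fin m} (hS : S.Joins p q) (hS' : S'.Joins q r) (hpr : p ≠ r)
  (hpq : p ≠ q) (hqr : q ≠ r)
include hS hS' hpr hpq hqr

theorem mk_turn : mk [.cup S, .pos S', .pos S] = mk [.cup S, .cup S'] := by
  rw [← mk_one_last (.cup S) (.cup S')]
  refine eq_of_sim_zero fun l _ => Sim.of_equiv_zero fun a b => ?_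
  obtain ⟨e⟩ := wordCube_reidemeister_two (w := (Letter.cup S :: .pos S' :: .pos S :: l).get)
    (t := (0 : Fin (l.length + 1 + 1 + 1))) (S := S) (by omega) rfl (get_second ..) (get_third ..)
    hS hS' hpr hpq hqr a b
  obtain ⟨e'⟩ := wordH_update_third (.cup S) (.cup S') (.pos S) .one l a b
  rw [update_second] at e
  exact ⟨e.trans e'⟩

theorem mk_zigzag : mk [.cup S, .cup S', .cup S] = mk [.cup S] := by
  have : mk [.cup S] = mk [.cup S, .one, .one] := by rw [mk_cup_one, mk_cons _ [.one], mk_one, mul_one]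
  rw [this]
  refine eq_of_sim_zero fun l _ => Sim.of_equiv_zero fun a b => ?_
  obtain ⟨e⟩ := wordCube_isotopy (w := (Letter.cup S :: .cup S' :: .cup S :: l).get)
    (t := (0 : Fin (l.length + 1 + 1 + 1))) (S := S) (by omega) rfl (get_second ..) (get_third ..)
    hS hS' hpr hpq hqr a b
  obtain ⟨e'⟩ := wordH_update_third (.cup S) .one (.cup S) .one l a b
  rw [update_second] at e
  exact ⟨e.trans e'⟩

theorem mk_turn_back : mk [.pos S, .pos S', .cup S] = mk [.cup S', .cup S] :=
  mk_reverse (mk_turn hS hS' hpr hpq hqr)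

end adjacent

end Tangle

/-- The site of the strands `i` and `i + 1`. -/
def site {i : ℕ} (h : i + 1 < m) : Site m :=
  ⟨⟨i, by omega⟩, ⟨i + 1, h⟩, by change i % 2 ≠ (i + 1) % 2; omega⟩

/-- A letter at the strands `i` and `i + 1`. -/
def letterAt (c : Site m → Letter m) (i : ℕ) : Letter m :=
  if h : i + 1 < m then c (site h) else .one

namespace Tangle

/-- The tangle with a given letter at the strands `i` and `i + 1`. -/
def gen (c : Site m → Letter m) (i : ℕ) : Tangle m := mk [letterAt c i]

theorem gen_eq (c : Site m → Letter m) {i : ℕ} (h : i + 1 < m) : gen c i = mk [c (site h)] := by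
  rw [gen, letterAt, dif_pos h]

theorem mk_range (c : Site m → Letter m) (k : ℕ) :
    mk ((List.range k).reverse.map (letterAt c)) = desc (gen c) 0 k := by
  induction k with
  | zero => rfl
  | succ k ih =>
    rw [List.range_succ, List.reverse_append, List.reverse_singleton, List.map_append,
      List.map_singleton, List.singleton_append, mk_cons, ih, desc_succ, zero_add]
    rfl

/-- A tangle absorbing one letter at the cost of a framing change absorbs all its powers. Applied to
the twists `σ₁^k` in front of the cup-cap. -/
theorem mk_replicate_append {x : Letter m} {u : List (Letter m)} {d : ℤ}
    (h : mk (x :: u) = framing d * mk u) (k : ℕ) :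
    mk (List.replicate k x ++ u) = framing (k * d) * mk u := by
  induction k with
  | zero => simp [framing_zero]
  | succ k ih =>
    rw [List.replicate_succ, List.cons_append, mk_cons, ih, ← mul_assoc, ← framing_comm, mul_assoc,
      ← mk_cons, h, ← mul_assoc, framing_mul]
    congr 2
    push_cast
    ring

theorem mk_flatten_replicate (u : List (Letter m)) (k : ℕ) :
    mk (List.replicate k u).flatten = mk u ^ k := by
  induction k with
  | zero => rfl
  | succ k ih => rw [List.replicate_succ, List.flatten_cons, mk_append, ih, pow_succ']

theorem mk_site_comm {c c' : Site m → Letter m} (hc : ∀ S p, (c S).Meets p → S.Mem p)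
    (hc' : ∀ S p, (c' S).Meets p → S.Mem p) {i j : ℕ} (hi : i + 1 < m) (hj : j + 1 < m)
    (hij : i + 1 < j) : mk [c (site hi)] * mk [c' (site hj)] =
      mk [c' (site hj)] * mk [c (site hi)] := by
  refine mk_comm fun p h h' => ?_
  have h1 := hc _ _ h
  have h2 := hc' _ _ h'
  have h3 : p.val = i ∨ p.val = i + 1 := by
    rcases h1 with rfl | rfl
    exacts [Or.inl rfl, Or.inr rfl]
  have h4 : p.val = j ∨ p.val = j + 1 := by
    rcases h2 with rfl | rfl
    exacts [Or.inl rfl, Or.inr rfl]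
  omega

theorem meets_cup (S : Site m) (p : Fin m) (h : (Letter.cup S).Meets p) : S.Mem p := by
  obtain ⟨l, S', h1, h2⟩ := h
  cases h1
  exact h2

theorem meets_pos (S : Site m) (p : Fin m) (h : (Letter.pos S).Meets p) : S.Mem p := by
  obtain ⟨l, S', h1, h2⟩ := h
  cases l
  · cases h1
  · cases h1
    exact h2

/-- The relations in which `e (i+1)` absorbs or emits the crossings are the same local moves with
the outer strands exchanged, hence the symmetric versions of the incidence data. -/
theorem turnbackRelations (m : ℕ) :
    TurnbackRelations (m - 1) (framing 1 : Tangle m) (gen .pos) (gen .cup) := by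
  have adj : ∀ {i : ℕ} (h : i + 1 < m) (h' : i + 1 + 1 < m),
      (site h).Joins ⟨i, by omega⟩ ⟨i + 1, h⟩ ∧ (site h').Joins ⟨i + 1, h⟩ ⟨i + 1 + 1, h'⟩ ∧
        (⟨i, by omega⟩ : Fin m) ≠ ⟨i + 1 + 1, h'⟩ ∧ (⟨i, by omega⟩ : Fin m) ≠ ⟨i + 1, h⟩ ∧
          (⟨i + 1, h⟩ : Fin m) ≠ ⟨i + 1 + 1, h'⟩ := fun h h' =>
    ⟨Or.inl ⟨rfl, rfl⟩, Or.inl ⟨rfl, rfl⟩, by simp [Fin.ext_iff, add_assoc], by simp [Fin.ext_iff],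
      by simp [Fin.ext_iff]⟩
  refine ⟨framing_comm 1, fun i hi => ?_, fun i hi => ?_, fun i hi => ?_, fun i hi => ?_,
    fun i hi => ?_, fun i j hij hj => ?_, fun i j hij hj => ?_, fun i j hij hj => ?_⟩
  · have h : i + 1 < m := by omega
    rw [gen_eq _ h, gen_eq _ h]
    exact mk_kink_pos _
  · have h : i + 1 < m := by omega
    have h' : i + 1 + 1 < m := by omega
    obtain ⟨h1, h2, h3, h4, h5⟩ := adj h h'
    rw [gen_eq _ h, gen_eq _ h, gen_eq _ h', gen_eq _ h']
    exact mk_turn h1 h2 h3 h4 h5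
  · have h : i + 1 < m := by omega
    have h' : i + 1 + 1 < m := by omega
    obtain ⟨h1, h2, h3, h4, h5⟩ := adj h h'
    rw [gen_eq _ h, gen_eq _ h, gen_eq _ h', gen_eq _ h']
    exact mk_turn h2.symm h1.symm h3.symm h5.symm h4.symm
  · have h : i + 1 < m := by omega
    have h' : i + 1 + 1 < m := by omega
    obtain ⟨h1, h2, h3, h4, h5⟩ := adj h h'
    rw [gen_eq _ h, gen_eq _ h, gen_eq _ h', gen_eq _ h']
    exact mk_turn_back h2.symm h1.symm h3.symm h5.symm h4.symm
  · have h : i + 1 < m := by omega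
    have h' : i + 1 + 1 < m := by omega
    obtain ⟨h1, h2, h3, h4, h5⟩ := adj h h'
    rw [gen_eq _ h, gen_eq _ h']
    exact mk_zigzag h2.symm h1.symm h3.symm h5.symm h4.symm
  · rw [gen_eq _ (by omega : i + 1 < m), gen_eq _ (by omega : j + 1 < m)]
    exact mk_site_comm meets_pos meets_pos _ _ hij
  · rw [gen_eq _ (by omega : i + 1 < m), gen_eq _ (by omega : j + 1 < m)]
    exact mk_site_comm meets_cup meets_pos _ _ hij
  · rw [gen_eq _ (by omega : i + 1 < m), gen_eq _ (by omega : j + 1 < m)]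
    exact (mk_site_comm meets_pos meets_cup _ _ hij).symm

/-! ### The trace -/

/-- The framed words have isomorphic closures. -/
def ClosureRel (x y : FramedWord m) : Prop :=
  Sim (x.1.toList ++ [.one]) (y.1.toList ++ [.one]) x.2.toAdd y.2.toAdd

/-- The equivalence of framed words with isomorphic closures. -/
def closureSetoid (m : ℕ) : Setoid (FramedWord m) where
  r := ClosureRel
  iseqv := ⟨fun _ => Sim.refl _ _, fun h => Sim.symm h, fun h h' => Sim.trans h h'⟩

/-- The closure of a tangle. -/
def trace : Tangle m → Quotient (closureSetoid m) :=
  Quotient.map' (s₂ := closureSetoid m) id fun _ _ h => h [.one] (by simp)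

theorem sim_append_one {u : List (Letter m)} (hu : u ≠ []) (f : ℤ) : Sim (u ++ [.one]) u f f :=
  (Sim.rotate u [.one] f).trans (Sim.of_equiv_zero (wordH_one hu))

/-- This is invariance under rotation of the heights. The identity letter appended in `ClosureRel`
gives the empty word a height; it is dropped again when the word is not empty. -/
theorem trace_comm (x y : Tangle m) : trace (x * y) = trace (y * x) := by
  induction x using Con.induction_on with
  | H x =>
    induction y using Con.induction_on with
    | H y =>
      refine Quotient.sound (s := closureSetoid m) (?_ : ClosureRel _ _)
      have h : Sim (x.1.toList ++ y.1.toList ++ [.one]) (y.1.toList ++ x.1.toList ++ [.one])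
          (x.2.toAdd + y.2.toAdd) (y.2.toAdd + x.2.toAdd) := by
        rw [add_comm y.2.toAdd]
        by_cases h0 : x.1.toList ++ y.1.toList = []
        · obtain ⟨h1, h2⟩ := List.append_eq_nil_iff.1 h0
          rw [h1, h2]
          exact Sim.refl _ _
        · have h1 : y.1.toList ++ x.1.toList ≠ [] := fun h => h0 (by simp_all)
          exact (sim_append_one h0 _).trans
            ((Sim.rotate _ _ _).trans (sim_append_one h1 _).symm)
      exact h

theorem sim_of_trace_eq {u v : List (Letter m)} {f f' : ℤ}
    (h : trace (framing f * mk u) = trace (framing f' * mk v)) (hu : u ≠ []) (hv : v ≠ []) :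
    Sim u v f f' := by
  rw [framing_mul_mk, framing_mul_mk] at h
  have h1 : Sim (u ++ [.one]) (v ++ [.one]) f f' := Quotient.exact h
  exact (sim_append_one hu f).symm.trans (h1.trans (sim_append_one hv f'))

end Tangle
end Khovanov

namespace Khovanov

/-! ## Framed Khovanov homology of diagrams -/

namespace LinkDiagram

variable {V X : Type} (D : LinkDiagram V X)

/-- The cube of resolutions of a diagram. -/
def cube : Cube V X where
  part s := Relation.EqvGen.setoid (D.Joined s)
  free := Set.univ

variable {D}

theorem circleAt_eq_iff {s : X → Label} {v w : V} :
    D.circleAt s v = D.circleAt s w ↔ D.cube.part s v w :=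
  ⟨fun h => Quot.eqvGen_exact h, fun h => Quot.eqvGen_sound h⟩

/-- The labelling of a state and its signs as a function on the marked points. -/
def toState (S : D.EnhancedState) : State V X := (S.label, fun v => S.sign (D.circleAt S.label v))

theorem toState_injective : Function.Injective (toState (D := D)) := by
  rintro ⟨s, e⟩ ⟨s', e'⟩ h
  obtain ⟨h1, h2⟩ := Prod.mk.inj h
  change s = s' at h1
  subst h1
  congr 1
  funext c
  induction c using Quot.ind with
  | mk v => exact congrFun h2 v

variable [Fintype V] [Fintype X] [LinearOrder X]

theorem toState_mem (S : D.EnhancedState) : toState S ∈ D.cube.cx.T :=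
  ⟨fun x hx => absurd (Set.mem_univ x) hx, fun _ _ h => congrArg S.sign (circleAt_eq_iff.2 h)⟩

theorem exists_toState {g : State V X} (hg : g ∈ D.cube.cx.T) : ∃ S : D.EnhancedState, toState S = g :=
  ⟨⟨g.1, Quot.lift g.2 fun v w h => hg.2 v w (Relation.EqvGen.rel _ _ h)⟩, rfl⟩

theorem cx_a_toState (S : D.EnhancedState) : D.cube.cx.a (toState S) = S.a := by
  classical
  rw [Cube.a_def, EnhancedState.a, EnhancedState.σ, Finset.card_filter, Finset.card_filter]
  push_cast
  rw [← Finset.sum_sub_distrib]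
  refine Finset.sum_congr rfl fun x _ => ?_
  rw [if_pos (show x ∈ D.cube.free from trivial)]
  change (if S.label x = Label.A then (1 : ℤ) else -1) = _
  cases S.label x <;> simp

theorem tau_toState (S : D.EnhancedState) : tau (D.cube.part S.label) (toState S).2 = S.τ := by
  classical
  let f : Quotient (D.cube.part S.label) → D.Circle S.label :=
    Quotient.lift (fun v => D.circleAt S.label v) fun v w h => circleAt_eq_iff.2 h
  have hf : Function.Bijective f := by
    constructor
    · intro x y
      induction x using Quotient.ind with
      | _ v =>
        induction y using Quotient.ind with
        | _ w => exact fun h => Quotient.sound (circleAt_eq_iff.1 h)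
    · intro c
      induction c using Quot.ind with
      | mk v => exact ⟨Quotient.mk _ v, rfl⟩
  unfold tau EnhancedState.τ
  refine Fintype.sum_bijective f hf _ _ fun c => ?_
  change ((S.sign (D.circleAt S.label c.out) : ℤˣ) : ℤ) = _
  congr 2
  conv_rhs => rw [← Quotient.out_eq c]
  rfl

theorem cx_b_toState (S : D.EnhancedState) : D.cube.cx.b (toState S) = S.b := by
  rw [Cube.b_def, cx_a_toState]
  change _ + 2 * tau (D.cube.part S.label) (toState S).2 = _
  rw [tau_toState]
  rfl

/-- As `b = σ + 2τ` is preserved and `σ` drops by `2`, the sum of the signs rises by `1`. Circles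
with equal point sets are the common classes of the two partitions. -/
theorem adjacentAt_iff (S S' : D.EnhancedState) (x : X) :
    AdjacentAt S S' x ↔ D.cube.Step (toState S) (toState S') x := by
  classical
  constructor
  · intro h
    have h1 : S'.label = Function.update S.label x Label.B := by
      funext y
      by_cases hy : y = x
      · subst hy
        rw [Function.update_self, h.label_B]
      · rw [Function.update_of_ne hy, h.label_eq y hy]
    refine ⟨h.label_A, h1, ?_, fun v hv => ?_⟩
    · change tau (D.cube.part S'.label) _ = tau (D.cube.part S.label) _ + 1
      rw [tau_toState, tau_toState]
      have h2 := h.a_eq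
      have h3 := h.b_eq
      unfold EnhancedState.b at h3
      unfold EnhancedState.a at h2
      omega
    · refine h.sign_eq _ _ ?_
      ext u
      change D.circleAt _ u = _ ↔ D.circleAt _ u = _
      rw [eq_comm, circleAt_eq_iff, eq_comm, circleAt_eq_iff]
      exact hv u
  · intro h
    have h2 := h.a_eq (toState_mem S')
    rw [cx_a_toState, cx_a_toState] at h2
    have h3 : tau (D.cube.part S'.label) _ = tau (D.cube.part S.label) _ + 1 := h.2.2.1
    rw [tau_toState, tau_toState] at h3
    refine ⟨h2, ?_, h.label_A, h.label_B, fun y hy => h.label_ne hy, fun c c' hc => ?_⟩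
    · unfold EnhancedState.a at h2
      unfold EnhancedState.b
      omega
    · induction c using Quot.ind with
      | mk v =>
        have hv : v ∈ D.points (D.circleAt S.label v) := rfl
        have hv' : v ∈ D.points c' := by
          rw [← hc]
          exact hv
        obtain rfl : D.circleAt S'.label v = c' := hv'
        refine h.2.2.2 v fun u => ?_
        have hu := Set.ext_iff.1 hc u
        change D.circleAt _ u = D.circleAt _ v ↔ D.circleAt _ u = D.circleAt _ v at hu
        rw [eq_comm, circleAt_eq_iff, eq_comm, circleAt_eq_iff] at hu
        exact hu

theorem incidence_eq (S S' : D.EnhancedState) :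
    incidence S S' = D.cube.cx.c (toState S) (toState S') := by
  classical
  unfold incidence
  rw [Cube.c_def]
  refine Finset.sum_congr rfl fun x _ => ?_
  simp only [adjacentAt_iff]
  rfl

variable (D) in
/-- The coefficients of a chain. -/
noncomputable def restrict (a b : ℤ) : (State V X → ℤ) →+ D.Chain a b where
  toFun u := Finsupp.equivFunOnFinite.symm fun S => u (toState S.1)
  map_zero' := by ext; simp
  map_add' u v := by ext; simp

theorem restrict_apply (a b : ℤ) (u : State V X → ℤ) (S : D.Gen a b) :
    D.restrict a b u S = u (toState S.1) := by
  simp [restrict]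

theorem restrict_eq_zero {a b : ℤ} {u : State V X → ℤ} (hu : u ∈ D.cube.cx.Ch a b)
    (h : D.restrict a b u = 0) : u = 0 := by
  funext g
  by_contra h0
  obtain ⟨h1, h2, h3⟩ := hu g h0
  obtain ⟨S, rfl⟩ := exists_toState h1
  rw [cx_a_toState] at h2
  rw [cx_b_toState] at h3
  have h4 := restrict_apply a b u ⟨S, h2, h3⟩
  rw [h] at h4
  exact h0 h4.symm

theorem exists_restrict {a b : ℤ} (x : D.Chain a b) : ∃ u ∈ D.cube.cx.Ch a b, D.restrict a b u = x := by
  classical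
  refine ⟨fun g => if h : ∃ S : D.Gen a b, toState S.1 = g then x h.choose else 0, ?_, ?_⟩
  · intro g hg
    by_cases h : ∃ S : D.Gen a b, toState S.1 = g
    · obtain ⟨S, rfl⟩ := h
      exact ⟨toState_mem _, (cx_a_toState _).trans S.2.1, (cx_b_toState _).trans S.2.2⟩
    · exact absurd (dif_neg h) hg
  · ext S
    have h : ∃ S' : D.Gen a b, toState S'.1 = toState S.1 := ⟨S, rfl⟩
    rw [restrict_apply, dif_pos h]
    congr 1
    exact Subtype.ext (toState_injective h.choose_spec)

theorem boundary_restrict {a b : ℤ} (a' : ℤ) {u : State V X → ℤ} (hu : u ∈ D.cube.cx.Ch a b) :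
    D.boundary a a' b (D.restrict a b u) = D.restrict a' b (D.cube.cx.d u) := by
  classical
  ext S'
  rw [restrict_apply, BasedComplex.d_apply, if_pos (toState_mem _), boundary,
    Finsupp.linearCombination_apply, Finsupp.sum_fintype _ _ (by simp), Finsupp.finsetSum_apply]
  have h1 : ∀ S : D.Gen a b, (D.restrict a b u S • ∑ S'' : D.Gen a' b,
      incidence S.1 S''.1 • Finsupp.single S'' (1 : ℤ)) S' =
        u (toState S.1) * D.cube.cx.c (toState S.1) (toState S'.1) := by
    intro S
    rw [Finsupp.smul_apply, Finsupp.finsetSum_apply, Finset.sum_eq_single S', restrict_apply,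
      incidence_eq]
    · simp
    · intro S'' _ h
      simp [h]
    · simp
  simp only [h1]
  refine Finset.sum_of_injOn (fun S : D.Gen a b => toState S.1)
    (fun S _ S' _ h => Subtype.ext (toState_injective h)) (by simp) ?_ (fun _ _ => rfl)
  intro g _ hg
  by_contra h0
  obtain ⟨h2, h3, h4⟩ := hu g (left_ne_zero_of_mul h0)
  obtain ⟨S, rfl⟩ := exists_toState h2
  rw [cx_a_toState] at h3
  rw [cx_b_toState] at h4
  exact hg ⟨⟨S, h3, h4⟩, Finset.mem_coe.2 (Finset.mem_univ _), rfl⟩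

theorem d_mem_Ch {a b : ℤ} {u : State V X → ℤ} (hu : u ∈ D.cube.cx.Ch a b) :
    D.cube.cx.d u ∈ D.cube.cx.Ch (a - 2) b := by
  classical
  intro h hh
  rw [BasedComplex.d_apply] at hh
  split_ifs at hh with hT
  · obtain ⟨g, -, hg⟩ := Finset.exists_ne_zero_of_sum_ne_zero hh
    obtain ⟨h1, h2, h3⟩ := hu g (left_ne_zero_of_mul hg)
    obtain ⟨x, hx⟩ := Cube.c_ne_zero (right_ne_zero_of_mul hg)
    have h4 := hx.a_eq hT
    refine ⟨hT, by omega, ?_⟩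
    rw [← h3, Cube.b_def, Cube.b_def, h4, hx.2.2.1]
    ring
  · exact absurd rfl hh

/-- The framed Khovanov homology is the homology of the cube of resolutions. -/
theorem nonempty_framedHomology_equiv (a b : ℤ) :
    Nonempty (D.cube.cx.H a b ≃+ D.FramedHomology a b) := by
  have hker : ∀ u ∈ D.cube.cx.Z a b, D.boundary a (a - 2) b (D.restrict a b u) = 0 := by
    intro u hu
    rw [boundary_restrict _ hu.1, show D.cube.cx.d u = 0 from hu.2, map_zero]
  let F₀ : D.cube.cx.Z a b →+ LinearMap.ker (D.boundary a (a - 2) b) :=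
    -- Restriction to the generators of bidegree `(a, b)` is injective on chains and surjective, so
    -- only the passage to the quotient remains.
    AddMonoidHom.codRestrict ((D.restrict a b).comp (D.cube.cx.Z a b).subtype)
      (LinearMap.ker (D.boundary a (a - 2) b)) fun u => hker u u.2
  let F : D.cube.cx.Z a b →+ D.FramedHomology a b :=
    (Submodule.mkQ ((LinearMap.range (D.boundary (a + 2) a b)).submoduleOf
      (LinearMap.ker (D.boundary a (a - 2) b)))).toAddMonoidHom.comp F₀
  have hF : Function.Surjective F := by
    intro y
    obtain ⟨x, rfl⟩ := Submodule.mkQ_surjective _ y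
    obtain ⟨u, hu, hux⟩ := exists_restrict x.1
    have hd : D.cube.cx.d u = 0 := by
      refine restrict_eq_zero (d_mem_Ch hu) ?_
      rw [← boundary_restrict _ hu, hux]
      exact x.2
    refine ⟨⟨u, hu, hd⟩, ?_⟩
    exact congrArg (Submodule.mkQ _) (Subtype.ext hux : F₀ ⟨u, hu, hd⟩ = x)
  have hFker : (D.cube.cx.Bd a b).addSubgroupOf (D.cube.cx.Z a b) = F.ker := by
    ext ⟨u, hu⟩
    have h1 : (⟨u, hu⟩ : D.cube.cx.Z a b) ∈ F.ker ↔
        D.restrict a b u ∈ LinearMap.range (D.boundary (a + 2) a b) :=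
      Submodule.Quotient.mk_eq_zero _
    rw [h1, AddSubgroup.mem_addSubgroupOf]
    constructor
    · rintro ⟨v, hv, hvu⟩
      refine ⟨D.restrict (a + 2) b v, ?_⟩
      rw [boundary_restrict _ hv, hvu]
    · rintro ⟨y, hy⟩
      obtain ⟨v, hv, rfl⟩ := exists_restrict y
      refine ⟨v, hv, ?_⟩
      rw [boundary_restrict _ hv] at hy
      have h2 := d_mem_Ch hv
      rw [add_sub_cancel_right] at h2
      have h3 := restrict_eq_zero (sub_mem h2 hu.1) (by rw [map_sub, hy, sub_self])
      exact sub_eq_zero.1 h3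
  exact ⟨(QuotientAddGroup.quotientAddEquivOfEq hFker).trans
    (QuotientAddGroup.quotientKerEquivOfSurjective F hF)⟩

end LinkDiagram
end Khovanov

namespace Khovanov

/-! ## Closed braids as words -/

namespace BraidWord

variable {m : ℕ}

/-- The strands at which a letter of a braid word acts. -/
def siteOf (i : Fin (m - 1)) : Site m :=
  ⟨left i, right i, by change i.val % 2 ≠ (i.val + 1) % 2; omega⟩

/-- A letter of a braid word as a letter of a tangle word. -/
def toLetter (l : Fin (m - 1) × Bool) : Letter m :=
  if l.2 then .pos (siteOf l.1) else .neg (siteOf l.1)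

variable (β : BraidWord m)

theorem ends_pos {t : Fin β.length} (h : (β.get t).2 = true) : β.closure.ends t =
    ![(right (β.get t).1, t.castSucc), (right (β.get t).1, t.succ), (left (β.get t).1, t.succ),
      (left (β.get t).1, t.castSucc)] := if_pos h

theorem ends_neg {t : Fin β.length} (h : (β.get t).2 = false) : β.closure.ends t =
    ![(left (β.get t).1, t.castSucc), (right (β.get t).1, t.castSucc), (right (β.get t).1, t.succ),
      (left (β.get t).1, t.succ)] := if_neg (by rw [h]; decide)

/-- The smoothed letters of a braid word. -/
def smoothing (s : Fin β.length → Label) (t : Fin β.length) : Option (Site m) :=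
  (toLetter (β.get t)).smooth (s t)

variable {β} {s : Fin β.length → Label}

theorem smoothing_eq (t : Fin β.length) : smoothing β s t =
    if ((β.get t).2 = true ↔ s t = Label.A) then none else some (siteOf (β.get t).1) := by
  unfold smoothing toLetter
  cases (β.get t).2 <;> cases s t <;> rfl

/-- The circles of a smoothing of a closed braid, in terms of its crossings. -/
theorem part_le_iff {R : Setoid (Fin m × Fin (β.length + 1))} : β.closure.cube.part s ≤ R ↔
    (∀ t p, (∀ S, smoothing β s t = some S → ¬ S.Mem p) → R (p, t.castSucc) (p, t.succ)) ∧
    (∀ t S, smoothing β s t = some S →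
      R (S.a, t.castSucc) (S.b, t.castSucc) ∧ R (S.a, t.succ) (S.b, t.succ)) ∧
    ∀ p, R (p, Fin.last _) (p, 0) := by
  have hJ : ∀ {v w}, β.closure.Joined s v w → β.closure.cube.part s v w := fun h =>
    Relation.EqvGen.rel _ _ h
  constructor
  · intro h
    refine ⟨fun t p hp => ?_, fun t S hS => ?_, fun p => h (hJ (.arc (Or.inr ⟨p, rfl, rfl⟩)))⟩
    · by_cases hm : (siteOf (β.get t).1).Mem p
      · have h1 : (β.get t).2 = true ↔ s t = Label.A := by
          by_contra h1
          exact hp _ (by rw [smoothing_eq, if_neg h1]) hm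
        cases h2 : (β.get t).2 with
        | true =>
          have hA := h1.1 h2
          have e1 := hJ (.a₁ t hA)
          have e2 := hJ (.a₂ t hA)
          rw [ends_pos β h2] at e1 e2
          rcases hm with rfl | rfl
          exacts [R.symm (h e2), h e1]
        | false =>
          have hB : s t = Label.B := by
            cases h3 : s t
            · rw [h1.2 h3] at h2; cases h2
            · rfl
          have e1 := hJ (.b₁ t hB)
          have e2 := hJ (.b₂ t hB)
          rw [ends_neg β h2] at e1 e2
          rcases hm with rfl | rfl
          exacts [h e1, h e2]
      · obtain ⟨h1, h2⟩ := not_or.1 hm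
        exact h (hJ (.arc (Or.inl ⟨p, t, h1, h2, rfl, rfl⟩)))
    · rw [smoothing_eq] at hS
      split_ifs at hS with h1
      cases hS
      cases h2 : (β.get t).2 with
      | true =>
        have hB : s t = Label.B := by
          cases h3 : s t
          · exact absurd (iff_of_true h2 h3) h1
          · rfl
        have e1 := hJ (.b₁ t hB)
        have e2 := hJ (.b₂ t hB)
        rw [ends_pos β h2] at e1 e2
        exact ⟨R.symm (h e1), R.symm (h e2)⟩
      | false =>
        have hA : s t = Label.A := by
          by_contra h3
          exact h1 (iff_of_false (by rw [h2]; decide) h3)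
        have e1 := hJ (.a₁ t hA)
        have e2 := hJ (.a₂ t hA)
        rw [ends_neg β h2] at e1 e2
        exact ⟨h e1, R.symm (h e2)⟩
  · rintro ⟨h1, h2, h3⟩ v w hvw
    have key : ∀ v w, β.closure.Joined s v w → R v w := by
      have hv : ∀ t, ((β.get t).2 = true ↔ s t = Label.A) → ∀ p, R (p, t.castSucc) (p, t.succ) :=
        fun t ht p => h1 t p fun S hS => by rw [smoothing_eq, if_pos ht] at hS; cases hS
      have hc : ∀ t, ¬ ((β.get t).2 = true ↔ s t = Label.A) →
          R (left (β.get t).1, t.castSucc) (right (β.get t).1, t.castSucc) ∧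
            R (left (β.get t).1, t.succ) (right (β.get t).1, t.succ) :=
        fun t ht => h2 t (siteOf (β.get t).1) (by rw [smoothing_eq, if_neg ht])
      rintro _ _ (h | ⟨t, hs⟩ | ⟨t, hs⟩ | ⟨t, hs⟩ | ⟨t, hs⟩)
      · rcases h with ⟨p, t, h4, h5, rfl, rfl⟩ | ⟨p, rfl, rfl⟩
        · refine h1 t p fun S hS => ?_
          rw [smoothing_eq] at hS
          split_ifs at hS
          cases hS
          exact not_or.2 ⟨h4, h5⟩
        · exact h3 p
      all_goals
        have hN : s t = Label.B → s t ≠ Label.A := fun h h' => by rw [h] at h'; cases h'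
        cases h4 : (β.get t).2
      · rw [ends_neg β h4]
        exact (hc t fun h => absurd (h.2 hs) (by rw [h4]; decide)).1
      · rw [ends_pos β h4]
        exact hv t (iff_of_true h4 hs) _
      · rw [ends_neg β h4]
        exact R.symm (hc t fun h => absurd (h.2 hs) (by rw [h4]; decide)).2
      · rw [ends_pos β h4]
        exact R.symm (hv t (iff_of_true h4 hs) _)
      · rw [ends_neg β h4]
        exact hv t (iff_of_false (by rw [h4]; decide) (hN hs)) _
      · rw [ends_pos β h4]
        exact R.symm (hc t fun h => hN hs (h.1 h4)).1
      · rw [ends_neg β h4]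
        exact hv t (iff_of_false (by rw [h4]; decide) (hN hs)) _
      · rw [ends_pos β h4]
        exact R.symm (hc t fun h => hN hs (h.1 h4)).2
    have hvw' : Relation.EqvGen (β.closure.Joined s) v w := hvw
    induction hvw' with
    | rel v w h => exact key v w h
    | refl v => exact R.refl v
    | symm v w h ih => exact R.symm (ih h)
    | trans u v w h h' ih ih' => exact R.trans (ih h) (ih' h')

/-- The framed Khovanov homology of a closed braid is the homology of the closed word. -/
theorem nonempty_framedHomology_equiv_wordH (hβ : β ≠ []) (a b : ℤ) :
    Nonempty (β.closure.FramedHomology a b ≃+ wordH (β.map toLetter) a b) := by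
  have hpos : 0 < β.length := List.length_pos_iff.2 hβ
  obtain ⟨e1⟩ := nonempty_wordH (w := β.map toLetter) (N := β.length)
    (u := fun t => toLetter (β.get t)) (by simp) (fun t => by simp) a b
  obtain ⟨e3⟩ := β.closure.nonempty_framedHomology_equiv a b
  -- The diagram has one height more than the cyclic word: its top height, joined to height `0` by
  -- the closing arcs, is identified with it.
  let wrap : Fin (β.length + 1) → Fin β.length := fun t =>
    ⟨if t.val = β.length then 0 else t.val, by split_ifs <;> omega⟩
  have hwc : ∀ t : Fin β.length, wrap t.castSucc = t := fun t => by
    ext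
    exact if_neg (by simpa using t.isLt.ne)
  have hws : ∀ t : Fin β.length, wrap t.succ = nxt t := fun t => by
    ext; rfl
  have hwl : wrap (Fin.last _) = wrap 0 := by
    ext
    simp only [wrap, Fin.val_last, Fin.val_zero, if_true]
    exact (if_neg hpos.ne).symm
  have hcw : ∀ (s : Fin β.length → Label) (p : Fin m) (t : Fin (β.length + 1)),
      β.closure.cube.part s (p, t) (p, (wrap t).castSucc) := by
    intro s p t
    by_cases ht : t.val = β.length
    · obtain rfl : t = Fin.last _ := Fin.ext ht
      have : (wrap (Fin.last _)).castSucc = 0 := by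
        ext
        simp [wrap]
      rw [this]
      exact (part_le_iff.1 le_rfl).2.2 p
    · have : (wrap t).castSucc = t := by
        ext
        exact if_neg ht
      rw [this]
  have h1 : ∀ s, β.closure.cube.part s ≤ (tl (smoothing β s)).comap (Prod.map id wrap) := by
    intro s
    refine part_le_iff.2 ⟨fun t p hp => ?_, fun t S hS => ?_, fun p => ?_⟩
    · change tl _ (p, wrap t.castSucc) (p, wrap t.succ)
      rw [hwc, hws]
      exact tl_straight hp
    · change tl _ (_, wrap t.castSucc) (_, wrap t.castSucc) ∧ tl _ (_, wrap t.succ) (_, wrap t.succ)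
      rw [hwc, hws]
      exact ⟨tl_joins hS S.joins_self, tl_joins_nxt hS S.joins_self⟩
    · change tl _ (p, wrap (Fin.last _)) (p, wrap 0)
      rw [hwl]
  have h2 : ∀ s, tl (smoothing β s) ≤ (β.closure.cube.part s).comap (Prod.map id Fin.castSucc) := by
    intro s
    obtain ⟨e1, e2, -⟩ := part_le_iff.1 (le_refl (β.closure.cube.part s))
    have hs : ∀ p t, β.closure.cube.part s (p, t.succ) (p, (nxt t).castSucc) := fun p t => by
      rw [← hws]
      exact hcw s p _
    refine tl_le_iff.2 ⟨fun t p hp => (β.closure.cube.part s).trans (e1 t p hp) (hs p t), fun t S hS => ?_⟩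
    obtain ⟨e4, e5⟩ := e2 t S hS
    exact ⟨e4, (β.closure.cube.part s).trans ((β.closure.cube.part s).symm (hs _ t))
      ((β.closure.cube.part s).trans e5 (hs _ t))⟩
  have h3 : ∀ t : Fin β.length, (toLetter (β.get t)).IsCrossing := by
    intro t
    unfold toLetter
    split_ifs <;> trivial
  obtain ⟨e2⟩ := Cube.compare (C := wordCube fun t => toLetter (β.get t)) (C' := β.closure.cube)
    (wordCube_elementary _) id Function.injective_id (fun t => ⟨fun _ => h3 t, fun _ => trivial⟩)
    (fun t _ => ⟨t, rfl⟩) (Prod.map id wrap)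
    (fun s _ v w => ⟨fun h => h1 s h, fun h => Setoid.trans' _ (hcw s v.1 v.2)
      (Setoid.trans' _ (h2 s h) (Setoid.symm' _ (hcw s w.1 w.2)))⟩)
    (fun s _ v => ⟨(v.1, v.2.castSucc), by
      change tl _ v (v.1, wrap v.2.castSucc)
      rw [hwc]⟩) a b
  exact ⟨(e1.trans (e2.trans e3)).symm⟩

end BraidWord
end Khovanov

namespace Khovanov

/-! ## The unknot -/

/-- Induction around the cycle of heights from an arbitrary start: climb to the top, wrap to `0`,
and climb again. -/
theorem nxt_induction {N : ℕ} {Q : Fin N → Prop} (t₀ : Fin N) (h0 : Q t₀)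
    (h : ∀ t, Q t → Q (nxt t)) (t : Fin N) : Q t := by
  have up : ∀ (i : ℕ) (hi : i < N), Q ⟨i, hi⟩ → ∀ k, ∀ hk : i + k < N, Q ⟨i + k, hk⟩ := by
    intro i hi hq k
    induction k with
    | zero => exact fun _ => hq
    | succ k ih =>
      intro hk
      have h1 := h _ (ih (by omega))
      rwa [nxt_mk (i := i + k) (by omega)] at h1
  have hpos : 0 < N := t.pos
  have hz : Q ⟨0, hpos⟩ := by
    have h1 := up t₀.val t₀.isLt h0 (N - 1 - t₀.val) (by omega)
    have h2 := h _ h1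
    have h3 : nxt (⟨t₀.val + (N - 1 - t₀.val), by omega⟩ : Fin N) = ⟨0, hpos⟩ :=
      Fin.ext (if_pos (by change t₀.val + (N - 1 - t₀.val) + 1 = N; omega))
    rwa [h3] at h2
  have h4 := up 0 hpos hz t.val (by omega)
  simpa using h4

/-- The closure of a descending chain of cup-caps is connected. -/
theorem tl_cups {m N : ℕ} (hm : m = N + 1) {F : Fin N → Option (Site m)}
    (hF : ∀ t, ∃ S, F t = some S ∧ S.a.val = N - 1 - t.val ∧ S.b.val = N - t.val)
    (v w : Fin m × Fin N) : tl F v w := by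
  have hpos : 0 < N := v.2.pos
  have key : ∀ (p : ℕ) (hp : p < m) (t : Fin N),
      tl F (⟨p, hp⟩, t) (⟨0, by omega⟩, ⟨0, hpos⟩) := by
    intro p
    induction p with
    | zero =>
      intro hp
      -- The strand `0` is met only by the last letter, so it runs straight from height `0` to the
      -- last height.
      refine nxt_induction ⟨0, hpos⟩ ((tl F).refl _) fun t ht => ?_
      by_cases hl : t.val + 1 = N
      · have : nxt t = ⟨0, hpos⟩ := Fin.ext (if_pos hl)
        rw [this]
      · refine (tl F).trans ((tl F).symm (tl_straight fun S hS => ?_)) ht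
        obtain ⟨S', h1, h2, h3⟩ := hF t
        rw [h1] at hS
        cases hS
        rintro (h | h)
        · rw [← h] at h2
          change 0 = _ at h2
          omega
        · rw [← h] at h3
          change 0 = _ at h3
          omega
    | succ p ih =>
      intro hp
      have hp' : p < m := by omega
      -- The letter at height `t₀` joins the strands `p` and `p + 1`, below and above. The only
      -- other letter meeting the strand `p + 1` is the preceding one, whose top is `t₀` again; so
      -- going around from `t₀` reaches every height.
      let t₀ : Fin N := ⟨N - 1 - p, by omega⟩
      obtain ⟨S, h1, h2, h3⟩ := hF t₀
      have ha : S.a = ⟨p, hp'⟩ := Fin.ext (by rw [h2]; change N - 1 - (N - 1 - p) = p; omega)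
      have hb : S.b = ⟨p + 1, hp⟩ := Fin.ext (by rw [h3]; change N - (N - 1 - p) = p + 1; omega)
      have e0 := tl_joins h1 S.joins_self
      have e1 := tl_joins_nxt h1 S.joins_self
      rw [ha, hb] at e0 e1
      have q0 := (tl F).trans ((tl F).symm e0) (ih hp' _)
      have q1 := (tl F).trans ((tl F).symm e1) (ih hp' _)
      refine nxt_induction t₀ q0 fun t ht => ?_
      by_cases c0 : t = t₀
      · rw [c0]
        exact q1
      by_cases c1 : nxt t = t₀
      · rw [c1]
        exact q0
      · refine (tl F).trans ((tl F).symm (tl_straight fun S' hS => ?_)) ht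
        obtain ⟨S'', h4, h5, h6⟩ := hF t
        rw [h4] at hS
        cases hS
        have d0 : t.val ≠ N - 1 - p := fun h => c0 (Fin.ext h)
        have d1 : t.val + 1 ≠ N - 1 - p := fun h => c1 (Fin.ext (by
          rw [nxt_val, if_neg (by omega)]; exact h))
        rintro (h | h)
        · rw [← h] at h5
          change p + 1 = _ at h5
          omega
        · rw [← h] at h6
          change p + 1 = _ at h6
          omega
  exact (tl F).trans (key _ _ _) ((tl F).symm (key _ _ _))

/-! ### Cubes without crossings -/

namespace Cube

variable {V X : Type} [Fintype V] [Fintype X] [LinearOrder X] {C : Cube V X}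

theorem d_eq_zero_of_free (hfree : C.free = ∅) (u : State V X → ℤ) : C.cx.d u = 0 := by
  classical
  funext h
  rw [BasedComplex.d_apply]
  split_ifs with hh
  · refine Finset.sum_eq_zero fun g _ => ?_
    by_contra h0
    obtain ⟨x, hx⟩ := c_ne_zero (right_ne_zero_of_mul h0)
    have := hx.mem_free hh
    rw [hfree] at this
    exact this
  · rfl

/-- The differential vanishes, so the only boundary is zero, and groups of chains have no torsion.
-/
theorem torsionFreeAt_of_free (hfree : C.free = ∅) (a b : ℤ) : C.cx.TorsionFreeAt a b := by
  rintro z - n hn ⟨y, -, hy⟩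
  rw [d_eq_zero_of_free hfree] at hy
  have : z = 0 := by
    funext g
    have := congrFun hy g
    simp only [Pi.zero_apply, Pi.smul_apply, nsmul_eq_mul] at this
    rcases mul_eq_zero.1 this.symm with h | h
    · rw [Nat.cast_eq_zero] at h
      omega
    · exact h
  rw [this]
  exact zero_mem _

/-- The homology of a circle lives in the bidegrees `(0, 2)` and `(0, -2)`. -/
theorem exactAt_circle [Nonempty V] (hfree : C.free = ∅) (hC : ∀ s v w, C.part s v w) {a b : ℤ}
    (hab : ¬ (a = 0 ∧ (b = 2 ∨ b = -2))) : C.cx.ExactAt a b := by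
  classical
  intro z hz
  have : z = 0 := by
    funext g
    by_contra h0
    obtain ⟨-, h2, h3⟩ := hz.1 g h0
    have ha : C.cx.a g = 0 := by
      rw [a_def]
      refine Finset.sum_eq_zero fun x _ => if_neg ?_
      rw [hfree]
      exact Set.notMem_empty x
    have hs : Subsingleton (Quotient (C.part g.1)) := ⟨fun x y => by
      induction x using Quotient.ind with
      | _ v =>
        induction y using Quotient.ind with
        | _ w => exact Quotient.sound (hC _ v w)⟩
    obtain ⟨v⟩ := ‹Nonempty V›
    have ht : tau (C.part g.1) g.2 = (g.2 (Quotient.mk (C.part g.1) v).out : ℤ) :=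
      Fintype.sum_subsingleton _ _
    rw [b_def, ha, ht] at h3
    rw [ha] at h2
    refine hab ⟨h2.symm, ?_⟩
    rcases unit_cases (g.2 (Quotient.mk (C.part g.1) v).out) with h | h <;> rw [h] at h3
    · left
      rw [← h3]; norm_num
    · right
      rw [← h3]; norm_num
  rw [this]
  exact zero_mem _

end Cube

/-! ## The last crossing -/

theorem nonempty_torsion_congr {A B : Type} [AddCommGroup A] [AddCommGroup B] (e : A ≃+ B) :
    Nonempty (AddCommGroup.torsion A ≃+ AddCommGroup.torsion B) :=
  BasedComplex.nonempty_torsion_equiv_of_injective e.toAddMonoidHom e.injective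
    fun y _ => e.surjective y

variable {m : ℕ}

theorem wordH_face_A {x : Letter m} (hx : x.IsCrossing) (w : List (Letter m)) (a b : ℤ) :
    Nonempty (((wordCube (x :: w).get).cx.res
      {g | g.1 (0 : Fin (w.length + 1)) = Label.A}).H a b ≃+
        wordH (x.frozen Label.A :: w) (a - 1) (b - 1)) := by
  obtain ⟨e⟩ := Cube.face_equiv (C := wordCube (x :: w).get) (x := (0 : Fin (w.length + 1))) hx
    Label.A a b
  obtain ⟨e'⟩ := nonempty_wordH (w := x.frozen Label.A :: w) (N := w.length + 1)
    (u := Function.update (x :: w).get (0 : Fin (w.length + 1)) (x.frozen Label.A)) rfl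
    (fun t => Fin.cases rfl (fun t => rfl) t) (a - 1) (b - 1)
  rw [freeze_wordCube] at e
  exact ⟨e.trans e'.symm⟩

theorem wordH_face_B {x : Letter m} (hx : x.IsCrossing) (w : List (Letter m)) (a b : ℤ) :
    Nonempty (((wordCube (x :: w).get).cx.res
      {g | g.1 (0 : Fin (w.length + 1)) = Label.B}).H a b ≃+
        wordH (x.frozen Label.B :: w) (a + 1) (b + 1)) := by
  obtain ⟨e⟩ := Cube.face_equiv (C := wordCube (x :: w).get) (x := (0 : Fin (w.length + 1))) hx
    Label.B a b
  obtain ⟨e'⟩ := nonempty_wordH (w := x.frozen Label.B :: w) (N := w.length + 1)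
    (u := Function.update (x :: w).get (0 : Fin (w.length + 1)) (x.frozen Label.B)) rfl
    (fun t => Fin.cases rfl (fun t => rfl) t) (a + 1) (b + 1)
  rw [freeze_wordCube] at e
  exact ⟨e.trans e'.symm⟩

theorem compl_label (N : ℕ) (x : Fin N) : {g : State (Fin m × Fin N) (Fin N) | g.1 x = Label.B}ᶜ =
    {g | g.1 x = Label.A} := by
  ext g
  change ¬ g.1 x = Label.B ↔ g.1 x = Label.A
  cases g.1 x <;> simp

section last

variable {S : Site m} {w : List (Letter m)} {a b : ℤ}

/-- The homology of a word vanishes in a bidegree. -/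
abbrev WordExactAt (w : List (Letter m)) (a b : ℤ) : Prop := (wordCube w.get).cx.ExactAt a b

/-- For a positive letter the cup-cap face is the subcomplex of label `B`. Its homology in degrees
`a` and `a - 2` must vanish; after the shift by smoothing these are the degrees `a + 1` and `a - 1`
of the cup-cap word. -/
theorem wordH_pos (hw : w ≠ []) (h0 : WordExactAt (.cup S :: w) (a + 1) (b + 1))
    (h1 : WordExactAt (.cup S :: w) (a - 1) (b + 1)) :
    Nonempty (wordH (.pos S :: w) a b ≃+ wordH w (a - 1) (b - 1)) := by
  have hx : (Letter.pos S).IsCrossing := trivial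
  obtain ⟨e0⟩ := wordH_face_B hx w a b
  obtain ⟨e1⟩ := wordH_face_B hx w (a - 2) b
  rw [show a - 2 + 1 = a - 1 by ring] at e1
  obtain ⟨e2⟩ := wordH_face_A hx w a b
  obtain ⟨e3⟩ := wordH_one hw (a - 1) (b - 1)
  obtain ⟨e⟩ := BasedComplex.nonempty_equiv_quo (wordCube_elementary _).isComplex
    (Cube.closedIn_label_B _) (h0.of_equiv e0) (h1.of_equiv e1)
  rw [compl_label] at e
  exact ⟨e.trans (e2.trans e3)⟩

theorem torsion_wordH_pos (hw : w ≠ []) (h0 : WordExactAt (.cup S :: w) (a + 1) (b + 1))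
    (h1 : (wordCube (Letter.cup S :: w).get).cx.TorsionFreeAt (a - 1) (b + 1)) :
    Nonempty (AddCommGroup.torsion (wordH (.pos S :: w) a b) ≃+
      AddCommGroup.torsion (wordH w (a - 1) (b - 1))) := by
  have hx : (Letter.pos S).IsCrossing := trivial
  obtain ⟨e0⟩ := wordH_face_B hx w a b
  obtain ⟨e1⟩ := wordH_face_B hx w (a - 2) b
  rw [show a - 2 + 1 = a - 1 by ring] at e1
  obtain ⟨e2⟩ := wordH_face_A hx w a b
  obtain ⟨e3⟩ := wordH_one hw (a - 1) (b - 1)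
  obtain ⟨e⟩ := BasedComplex.nonempty_torsion_equiv_quo (wordCube_elementary _).isComplex
    (Cube.closedIn_label_B _) (h0.of_equiv e0) (h1.of_equiv e1)
  rw [compl_label] at e
  obtain ⟨e4⟩ := nonempty_torsion_congr (e2.trans e3)
  exact ⟨e.trans e4⟩

/-- For a negative letter the roles are exchanged: the cup-cap face is the quotient, the identity
face the subcomplex, and the relevant degrees of the quotient are `a` and `a + 2`. -/
theorem wordH_neg (hw : w ≠ []) (h0 : WordExactAt (.cup S :: w) (a - 1) (b - 1))
    (h1 : WordExactAt (.cup S :: w) (a + 1) (b - 1)) :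
    Nonempty (wordH w (a + 1) (b + 1) ≃+ wordH (.neg S :: w) a b) := by
  have hx : (Letter.neg S).IsCrossing := trivial
  obtain ⟨e0⟩ := wordH_face_A hx w a b
  obtain ⟨e1⟩ := wordH_face_A hx w (a + 2) b
  rw [show a + 2 - 1 = a + 1 by ring] at e1
  obtain ⟨e2⟩ := wordH_face_B hx w a b
  obtain ⟨e3⟩ := wordH_one hw (a + 1) (b + 1)
  rw [← compl_label] at e0 e1
  obtain ⟨e⟩ := BasedComplex.nonempty_equiv_sub (wordCube_elementary _).isComplex
    (Cube.closedIn_label_B _) (h0.of_equiv e0) (h1.of_equiv e1)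
  exact ⟨(e2.trans e3).symm.trans e⟩

theorem torsion_wordH_neg (hw : w ≠ [])
    (h0 : (wordCube (Letter.cup S :: w).get).cx.TorsionFreeAt (a - 1) (b - 1))
    (h1 : WordExactAt (.cup S :: w) (a + 1) (b - 1)) :
    Nonempty (AddCommGroup.torsion (wordH w (a + 1) (b + 1)) ≃+
      AddCommGroup.torsion (wordH (.neg S :: w) a b)) := by
  have hx : (Letter.neg S).IsCrossing := trivial
  obtain ⟨e0⟩ := wordH_face_A hx w a b
  obtain ⟨e1⟩ := wordH_face_A hx w (a + 2) b
  rw [show a + 2 - 1 = a + 1 by ring] at e1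
  obtain ⟨e2⟩ := wordH_face_B hx w a b
  obtain ⟨e3⟩ := wordH_one hw (a + 1) (b + 1)
  rw [← compl_label] at e0 e1
  obtain ⟨e⟩ := BasedComplex.nonempty_torsion_equiv_sub (wordCube_elementary _).isComplex
    (Cube.closedIn_label_B _) (h0.of_equiv e0) (h1.of_equiv e1)
  obtain ⟨e4⟩ := nonempty_torsion_congr (e2.trans e3)
  exact ⟨e4.symm.trans e⟩

end last
end Khovanov

namespace Khovanov

open BraidWord

variable {m : ℕ}

/-! ## Twisted torus links -/

theorem map_torusWord (m n : ℕ) : (torusWord m n).map toLetter =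
    (List.replicate n ((List.range (m - 1)).reverse.map (letterAt (m := m) .pos))).flatten := by
  rw [torusWord, List.map_flatten, List.map_replicate]
  congr 2
  rw [List.map_map, List.map_reverse, List.map_reverse]
  congr 1
  rw [← List.map_coe_finRange_eq_range, List.map_map]
  refine List.map_congr_left fun i _ => ?_
  have h : i.val + 1 < m := by omega
  change Letter.pos (siteOf i) = letterAt .pos i.val
  rw [letterAt, dif_pos h]
  rfl

/-- The descending chain of cup-caps. -/
def cupsWord (m : ℕ) : List (Letter m) := (List.range (m - 1)).reverse.map (letterAt .cup)

theorem cupsWord_get (t : Fin (cupsWord m).length) (l : Label) :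
    ∃ S, ((cupsWord m).get t).smooth l = some S ∧ S.a.val = (cupsWord m).length - 1 - t.val ∧
      S.b.val = (cupsWord m).length - t.val := by
  have hl : (cupsWord m).length = m - 1 := by simp [cupsWord]
  have ht : t.val < m - 1 := hl ▸ t.isLt
  have h : m - 1 - 1 - t.val + 1 < m := by omega
  have e : (cupsWord m).get t = .cup (site h) := by
    rw [List.get_eq_getElem]
    simp only [cupsWord, List.getElem_map, List.getElem_reverse, List.getElem_range,
      List.length_range]
    rw [letterAt, dif_pos h]
  rw [e]
  refine ⟨site h, rfl, ?_, ?_⟩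
  · change m - 1 - 1 - t.val = _
    omega
  · change m - 1 - 1 - t.val + 1 = _
    omega

theorem cupsWord_ne_nil (hm : 2 ≤ m) : cupsWord m ≠ [] := by
  rw [← List.length_pos_iff]
  simp [cupsWord]
  omega

theorem cupsWord_free (m : ℕ) : (wordCube (cupsWord m).get).free = ∅ := by
  ext t
  refine iff_of_false (fun h => ?_) (Set.notMem_empty t)
  obtain ⟨S, h1, -⟩ := cupsWord_get t Label.A
  obtain ⟨S', h2, -⟩ := cupsWord_get t Label.B
  change ((cupsWord m).get t).IsCrossing at h
  cases hx : (cupsWord m).get t with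
  | one => rw [hx] at h; exact h
  | cup S => rw [hx] at h; exact h
  | pos S => rw [hx] at h1; cases h1
  | neg S => rw [hx] at h2; cases h2

theorem cupsWord_exactAt (hm : 2 ≤ m) {a b : ℤ} (hab : ¬ (a = 0 ∧ (b = 2 ∨ b = -2))) :
    WordExactAt (cupsWord m) a b := by
  have hl : (cupsWord m).length = m - 1 := by simp [cupsWord]
  have : Nonempty (Fin m × Fin (cupsWord m).length) := ⟨⟨0, by omega⟩, ⟨0, by omega⟩⟩
  exact Cube.exactAt_circle (cupsWord_free m)
    (fun s => tl_cups (by omega) fun t => cupsWord_get t (s t)) hab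

/-- The torus word followed by a power of a letter. -/
def twistWord (m : ℕ) (x : Letter m) (l : ℕ) : List (Letter m) :=
  (torusWord m (m + 2)).map toLetter ++ List.replicate l x

theorem torusWord_ne_nil (hm : 2 ≤ m) (n : ℕ) : torusWord m (n + 1) ≠ [] := by
  obtain ⟨m, rfl⟩ : ∃ m', m = m' + 2 := ⟨m - 2, by omega⟩
  rw [← List.length_pos_iff]
  simp [torusWord]

theorem twistWord_ne_nil (hm : 2 ≤ m) (x : Letter m) (l : ℕ) : twistWord m x l ≠ [] := by
  have := torusWord_ne_nil hm (m + 1)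
  simp [twistWord, this]

theorem nonempty_wordH_twistWord_succ (x : Letter m) (l : ℕ) (a b : ℤ) :
    Nonempty (wordH (twistWord m x (l + 1)) a b ≃+ wordH (x :: twistWord m x l) a b) := by
  obtain ⟨e⟩ := wordH_rotate x (twistWord m x l) a b
  have : twistWord m x (l + 1) = twistWord m x l ++ [x] := by
    rw [twistWord, twistWord, List.replicate_succ', List.append_assoc]
  rw [this]
  exact ⟨e.symm⟩

/-- The closure of the torus word, a power of a crossing and a cup-cap is a circle. -/
theorem nonempty_wordH_cup_twistWord (hm : 2 ≤ m) {x : Letter m} {d : ℤ}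
    (hx : Tangle.mk [x, .cup (site (show 0 + 1 < m by omega))] =
      Tangle.framing d * Tangle.mk [.cup (site (show 0 + 1 < m by omega))]) (l : ℕ) (a b : ℤ) :
    Nonempty (wordH (.cup (site (show 0 + 1 < m by omega)) :: twistWord m x l) a b ≃+
      wordH (cupsWord m) (a + (l * d + 2 + 2 * (m / 2 : ℕ)))
        (b + 3 * (l * d + 2 + 2 * (m / 2 : ℕ)))) := by
  set S : Site m := site (show 0 + 1 < m by omega) with hS
  have h1 : Sim (.cup S :: twistWord m x l) (twistWord m x l ++ [.cup S]) 0 0 :=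
    Sim.rotate [.cup S] _ _
  -- Adding a fixed framing, that of the absorbed twists, to the trace keeps it cyclic.
  have hT : ∀ y z : Tangle m, Tangle.trace (Tangle.framing (l * d) * (y * z)) =
      Tangle.trace (Tangle.framing (l * d) * (z * y)) := by
    intro y z
    rw [← mul_assoc, Tangle.trace_comm, ← mul_assoc, ← Tangle.framing_comm, mul_assoc]
  have h2 := (Tangle.turnbackRelations m).trace_rows
    (T := fun y => Tangle.trace (Tangle.framing (l * d) * y)) hT (by omega) 0
  have h3 : Tangle.mk (twistWord m x l ++ [.cup S]) = Tangle.framing (l * d) *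
      (Tangle.framing 1 ^ 0 * (desc (Tangle.gen .pos) 0 (m - 1) ^ (m - 1 + 3) *
        Tangle.gen .cup 0)) := by
    -- The twists stand next to the cup-cap and are removed as kinks, each contributing `d`. What
    -- remains is `m + 2 = n + 3` rows and `e 0`, with `n = m - 1`.
    rw [twistWord, List.append_assoc, Tangle.mk_append, Tangle.mk_replicate_append hx,
      map_torusWord, Tangle.mk_flatten_replicate, Tangle.mk_range, ← mul_assoc,
      ← Tangle.framing_comm, mul_assoc, pow_zero, one_mul, Tangle.gen_eq _ (by omega : 0 + 1 < m),
      show m - 1 + 3 = m + 2 by omega]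
  have h4 : Tangle.framing (l * d) * (Tangle.framing 1 ^ (0 + 2 + 2 * ((m - 1 + 1) / 2)) *
      desc (Tangle.gen .cup) 0 (m - 1)) =
        Tangle.framing (l * d + 2 + 2 * (m / 2 : ℕ)) * Tangle.mk (cupsWord m) := by
    rw [cupsWord, Tangle.mk_range, Tangle.framing_pow, ← mul_assoc, Tangle.framing_mul]
    congr 2
    rw [show m - 1 + 1 = m by omega]
    push_cast
    ring
  have h5 : Sim (twistWord m x l ++ [.cup S]) (cupsWord m) 0 (l * d + 2 + 2 * (m / 2 : ℕ)) := by
    refine Tangle.sim_of_trace_eq ?_ (by simp) (cupsWord_ne_nil hm)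
    rw [Tangle.framing_zero, one_mul, h3, ← h4]
    exact h2
  have h6 := (h1.trans h5) a b
  unfold framedH at h6
  rwa [mul_zero, add_zero, add_zero] at h6

theorem exactAt_cup_twistWord (hm : 2 ≤ m) {x : Letter m} {d : ℤ}
    (hx : Tangle.mk [x, .cup (site (show 0 + 1 < m by omega))] =
      Tangle.framing d * Tangle.mk [.cup (site (show 0 + 1 < m by omega))]) (l : ℕ) {a b : ℤ}
    (hab : ¬ (a + (l * d + 2 + 2 * (m / 2 : ℕ)) = 0 ∧
      (b + 3 * (l * d + 2 + 2 * (m / 2 : ℕ)) = 2 ∨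
        b + 3 * (l * d + 2 + 2 * (m / 2 : ℕ)) = -2))) :
    WordExactAt (.cup (site (show 0 + 1 < m by omega)) :: twistWord m x l) a b := by
  obtain ⟨e⟩ := nonempty_wordH_cup_twistWord hm hx l a b
  exact (cupsWord_exactAt hm hab).of_equiv e

theorem torsionFreeAt_cup_twistWord (hm : 2 ≤ m) {x : Letter m} {d : ℤ}
    (hx : Tangle.mk [x, .cup (site (show 0 + 1 < m by omega))] =
      Tangle.framing d * Tangle.mk [.cup (site (show 0 + 1 < m by omega))]) (l : ℕ) (a b : ℤ) :
    (wordCube (Letter.cup (site (show 0 + 1 < m by omega)) ::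
      twistWord m x l).get).cx.TorsionFreeAt a b := by
  obtain ⟨e⟩ := nonempty_wordH_cup_twistWord hm hx l a b
  exact (Cube.torsionFreeAt_of_free (cupsWord_free m) _ _).of_equiv e

theorem writhe_append (u v : BraidWord m) : (u ++ v : BraidWord m).writhe = u.writhe + v.writhe := by
  simp [writhe]

theorem writhe_torusWord (hm : 2 ≤ m) (n : ℕ) :
    (torusWord m n).writhe = ((m : ℤ) - 1) * n := by
  induction n with
  | zero => simp [torusWord, writhe]
  | succ n ih =>
    have : torusWord m (n + 1) =
        ((List.finRange (m - 1)).reverse.map fun i => (i, true)) ++ torusWord m n := by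
      rw [torusWord, List.replicate_succ, List.flatten_cons]
      rfl
    rw [this, writhe_append, ih]
    have h : writhe (m := m) ((List.finRange (m - 1)).reverse.map fun i => (i, true)) =
        (m : ℤ) - 1 := by
      simp [writhe, Function.comp_def]
      omega
    rw [h]
    push_cast
    ring

theorem writhe_twistedTorusWord (hm : 2 ≤ m) (n : ℕ) (k : ℤ) :
    (twistedTorusWord m n hm k).writhe = ((m : ℤ) - 1) * n + k := by
  rw [twistedTorusWord, writhe_append, writhe_torusWord hm]
  congr 1
  rcases le_or_gt 0 k with h | h
  · simp [writhe, h]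
  · simp [writhe, not_le.2 h, abs_of_neg h]

theorem map_twistedTorusWord_pos (hm : 2 ≤ m) (l : ℕ) :
    (twistedTorusWord m (m + 2) hm l).map toLetter =
      twistWord m (.pos (site (show 0 + 1 < m by omega))) l := by
  rw [twistedTorusWord, List.map_append, List.map_replicate, twistWord]
  congr 2

theorem map_twistedTorusWord_neg (hm : 2 ≤ m) (l : ℕ) :
    (twistedTorusWord m (m + 2) hm (-l)).map toLetter =
      twistWord m (.neg (site (show 0 + 1 < m by omega))) l := by
  rw [twistedTorusWord, List.map_append, List.map_replicate, twistWord, Int.natAbs_neg,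
    Int.natAbs_natCast]
  rcases Nat.eq_zero_or_pos l with rfl | h
  · rfl
  · congr 2
    have h : ¬ (0 : ℤ) ≤ -l := by omega
    simp only [toLetter, h, decide_false]
    rfl

theorem nonempty_twistedTorusHomology_equiv (hm : 2 ≤ m) (k i j : ℤ) :
    Nonempty (twistedTorusHomology m (m + 2) hm k i j ≃+
      wordH ((twistedTorusWord m (m + 2) hm k).map toLetter)
        (((m : ℤ) - 1) * (m + 2) + k - 2 * i) (3 * (((m : ℤ) - 1) * (m + 2) + k) - 2 * j)) := by
  have := nonempty_framedHomology_equiv_wordH (β := twistedTorusWord m (m + 2) hm k)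
    (by simp [twistedTorusWord, torusWord_ne_nil hm (m + 1)])
    (((m : ℤ) - 1) * (m + 2) + k - 2 * i) (3 * (((m : ℤ) - 1) * (m + 2) + k) - 2 * j)
  have hw := writhe_twistedTorusWord hm (m + 2) k
  push_cast at hw
  rw [← hw] at this ⊢
  exact this

/-- The right side is the writhe of the torus word plus the framing of the unknot. Since `m(m + 2) =
(m - 1)(m + 2) + 2 + m`, it remains to round down to an even number, which happens according to the
parity of `m`. -/
theorem two_mul_half (m : ℕ) :
    2 * (((m : ℤ) * (m + 2)) / 2) = ((m : ℤ) - 1) * (m + 2) + 2 + 2 * (m / 2 : ℕ) := by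
  rcases Nat.even_or_odd' m with ⟨p, rfl | rfl⟩
  · have h1 : ((2 * p : ℕ) : ℤ) * ((2 * p : ℕ) + 2) = 2 * (2 * p * (p + 1)) := by push_cast; ring
    rw [h1, Int.mul_ediv_cancel_left _ (by norm_num), Nat.mul_div_cancel_left _ (by norm_num)]
    push_cast
    ring
  · have h1 : ((2 * p + 1 : ℕ) : ℤ) * ((2 * p + 1 : ℕ) + 2) = 1 + 2 * (2 * p * p + 4 * p + 1) := by
      push_cast; ring
    rw [h1, Int.add_mul_ediv_left _ _ (by norm_num), show (2 * p + 1) / 2 = p by omega]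
    push_cast
    ring

end Khovanov

theorem mainTheorem2 (m : ℕ) (hm : 2 ≤ m) (k u : ℤ) (hu : u = ((m : ℤ) * (m + 2)) / 2 + k) :
    (∀ i j : ℤ,
      (i, j) ≠ (u, 3 * u) → (i, j) ≠ (u, 3 * u - 2) →
      (i, j) ≠ (u - 1, 3 * u) → (i, j) ≠ (u - 1, 3 * u - 2) →
      Nonempty (Khovanov.twistedTorusHomology m (m + 2) hm k i j ≃+
        Khovanov.twistedTorusHomology m (m + 2) hm (k - 1) i (j - 1))) ∧
    (∀ i j : ℤ,
      (i, j) ≠ (u, 3 * u) → (i, j) ≠ (u, 3 * u - 2) →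
      Nonempty
        (AddCommGroup.torsion (Khovanov.twistedTorusHomology m (m + 2) hm k i j) ≃+
          AddCommGroup.torsion
            (Khovanov.twistedTorusHomology m (m + 2) hm (k - 1) i (j - 1)))) := by
  open Khovanov in
  have hf := two_mul_half m
  generalize ((m : ℤ) * (m + 2)) / 2 = P at hu hf
  have E := nonempty_twistedTorusHomology_equiv hm
  generalize ((m : ℤ) - 1) * (m + 2) = ω at hf E
  generalize hq : ((m / 2 : ℕ) : ℤ) = q at hf
  have ne : ∀ {i j x y : ℤ}, (i, j) ≠ (x, y) → ¬ (i = x ∧ j = y) := fun h h' =>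
    h (Prod.ext h'.1 h'.2)
  have hx₁ := Tangle.mk_reverse_framing (Tangle.mk_kink_pos (site (show 0 + 1 < m by omega)))
  have hx₂ := Tangle.mk_reverse_framing (Tangle.mk_kink_neg (site (show 0 + 1 < m by omega)))
  -- For `k ≤ 0` it is the link with parameter `k - 1` that has the additional, negative crossing.
  -- For `k > 0` it is the link with parameter `k`, and the crossing is positive.
  rcases le_or_gt k 0 with hk | hk
  · obtain ⟨l, rfl⟩ : ∃ l : ℕ, k = -l := ⟨k.natAbs, by omega⟩
    have key : ∀ i j, 
        (Nonempty (wordH ((twistedTorusWord m (m + 2) hm (-l - 1)).map BraidWord.toLetter)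
          (ω + (-l - 1) - 2 * i) (3 * (ω + (-l - 1)) - 2 * (j - 1)) ≃+
          wordH (.neg (site (show 0 + 1 < m by omega)) ::
            twistWord m (.neg (site (show 0 + 1 < m by omega))) l)
            (ω + (-l - 1) - 2 * i) (3 * (ω + (-l - 1)) - 2 * (j - 1)))) := by
      intro i j
      rw [show (-(l : ℤ) - 1) = -((l + 1 : ℕ) : ℤ) by push_cast; ring, map_twistedTorusWord_neg]
      exact nonempty_wordH_twistWord_succ _ _ _ _
    have shift : ∀ i j : ℤ, ω + -l - 2 * i = ω + (-l - 1) - 2 * i + 1 ∧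
        3 * (ω + -l) - 2 * j = 3 * (ω + (-l - 1)) - 2 * (j - 1) + 1 := fun i j =>
      ⟨by ring, by ring⟩
    constructor
    · intro i j h1 h2 h3 h4
      obtain ⟨e1⟩ := E (-l) i j
      obtain ⟨e2⟩ := E (-l - 1) i (j - 1)
      obtain ⟨e3⟩ := key i j
      rw [(shift i j).1, (shift i j).2, map_twistedTorusWord_neg] at e1
      -- The cup-cap word carries the framing `-l + 2 + 2q`. By `hf`, degree `a - 1` is nonzero only
      -- for `i = u - 1` and degree `a + 1` only for `i = u`; the two values of `b` give `j = 3u`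
      -- and `j = 3u - 2`.
      obtain ⟨e4⟩ := wordH_neg (S := site (show 0 + 1 < m by omega))
        (twistWord_ne_nil hm (.neg (site (show 0 + 1 < m by omega))) l)
        (a := ω + (-l - 1) - 2 * i) (b := 3 * (ω + (-l - 1)) - 2 * (j - 1))
        (exactAt_cup_twistWord hm hx₂ l (by
          rw [hq]
          have := ne h3
          have := ne h4
          omega))
        (exactAt_cup_twistWord hm hx₂ l (by
          rw [hq]
          have := ne h1
          have := ne h2
          omega))
      exact ⟨e1.trans (e4.trans (e3.symm.trans e2.symm))⟩
    · intro i j h1 h2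
      obtain ⟨e1⟩ := E (-l) i j
      obtain ⟨e2⟩ := E (-l - 1) i (j - 1)
      obtain ⟨e3⟩ := key i j
      rw [(shift i j).1, (shift i j).2, map_twistedTorusWord_neg] at e1
      obtain ⟨e4⟩ := torsion_wordH_neg (S := site (show 0 + 1 < m by omega))
        (twistWord_ne_nil hm (.neg (site (show 0 + 1 < m by omega))) l)
        (a := ω + (-l - 1) - 2 * i) (b := 3 * (ω + (-l - 1)) - 2 * (j - 1))
        (torsionFreeAt_cup_twistWord hm hx₂ l _ _)
        (exactAt_cup_twistWord hm hx₂ l (by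
          rw [hq]
          have := ne h1
          have := ne h2
          omega))
      obtain ⟨t1⟩ := nonempty_torsion_congr e1
      obtain ⟨t2⟩ := nonempty_torsion_congr (e3.symm.trans e2.symm)
      exact ⟨t1.trans (e4.trans t2)⟩
  · obtain ⟨l, rfl⟩ : ∃ l : ℕ, k = (l + 1 : ℕ) := ⟨k.natAbs - 1, by omega⟩
    have hl : ((l + 1 : ℕ) : ℤ) - 1 = l := by push_cast; ring
    rw [hl]
    have shift : ∀ i j : ℤ, ω + l - 2 * i = ω + (l + 1 : ℕ) - 2 * i - 1 ∧
        3 * (ω + l) - 2 * (j - 1) = 3 * (ω + (l + 1 : ℕ)) - 2 * j - 1 := fun i j =>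
      ⟨by push_cast; ring, by push_cast; ring⟩
    constructor
    · intro i j h1 h2 h3 h4
      obtain ⟨e1⟩ := E (l + 1 : ℕ) i j
      obtain ⟨e2⟩ := E l i (j - 1)
      rw [map_twistedTorusWord_pos] at e1
      rw [(shift i j).1, (shift i j).2, map_twistedTorusWord_pos] at e2
      obtain ⟨e3⟩ := nonempty_wordH_twistWord_succ (.pos (site (show 0 + 1 < m by omega))) l
        (ω + (l + 1 : ℕ) - 2 * i) (3 * (ω + (l + 1 : ℕ)) - 2 * j)
      -- Here the framing is `l + 2 + 2q`, and the degrees `a + 1` and `a - 1` correspond to `i = u`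
      -- and `i = u - 1`.
      obtain ⟨e4⟩ := wordH_pos (S := site (show 0 + 1 < m by omega))
        (twistWord_ne_nil hm (.pos (site (show 0 + 1 < m by omega))) l)
        (a := ω + (l + 1 : ℕ) - 2 * i) (b := 3 * (ω + (l + 1 : ℕ)) - 2 * j)
        (exactAt_cup_twistWord hm hx₁ l (by
          rw [hq]
          have := ne h1
          have := ne h2
          omega))
        (exactAt_cup_twistWord hm hx₁ l (by
          rw [hq]
          have := ne h3
          have := ne h4
          omega))
      exact ⟨e1.trans (e3.trans (e4.trans e2.symm))⟩
    · intro i j h1 h2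
      obtain ⟨e1⟩ := E (l + 1 : ℕ) i j
      obtain ⟨e2⟩ := E l i (j - 1)
      rw [map_twistedTorusWord_pos] at e1
      rw [(shift i j).1, (shift i j).2, map_twistedTorusWord_pos] at e2
      obtain ⟨e3⟩ := nonempty_wordH_twistWord_succ (.pos (site (show 0 + 1 < m by omega))) l
        (ω + (l + 1 : ℕ) - 2 * i) (3 * (ω + (l + 1 : ℕ)) - 2 * j)
      obtain ⟨e4⟩ := torsion_wordH_pos (S := site (show 0 + 1 < m by omega))
        (twistWord_ne_nil hm (.pos (site (show 0 + 1 < m by omega))) l)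
        (a := ω + (l + 1 : ℕ) - 2 * i) (b := 3 * (ω + (l + 1 : ℕ)) - 2 * j)
        (exactAt_cup_twistWord hm hx₁ l (by
          rw [hq]
          have := ne h1
          have := ne h2
          omega))
        (torsionFreeAt_cup_twistWord hm hx₁ l _ _)
      obtain ⟨t1⟩ := nonempty_torsion_congr (e1.trans e3)
      obtain ⟨t2⟩ := nonempty_torsion_congr e2.symm
      exact ⟨t1.trans (e4.trans t2)⟩
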